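/- **Setting.** Let $m\ge 0$, and let $((U_t,X_t))_{t\in\mathbb Z}$ be a stationary ergodic process with values in $\mathbb R^2\times\mathbb R^m$, $\mathcal F_t=\sigma((U_s,X_s):s\le t)$, such that for every $t$ the vector $U_t$ is independent of $\mathcal F_{t-1}$ and has as its law a copula $C$ (marginals uniform on $[0,1]$). Let $\varepsilon$ be a real random variable with mean $0$ and variance $1$, and let $F_\varepsilon^{-1}$ be its quantile function. Parameters are $\theta=(d,\Gamma,A,B)$ with $d\in\mathbb R_+^2$, $\Gamma\in\mathbb R_+^{2\times m}$ and $A,B\in\mathbb R_+^{2\times 2}$, regarded as vectors of real numbers. The parameter set $\Theta$ is compact, contains $\theta_0=(d_0,\Gamma_0,A_0,B_0)$, and satisfies $\min(d_1,d_2)\ge d_->0$ for all $\theta\in\Theta$, with $d_-$ a constant ($\Theta$ may consist only of parameters with $B$ diagonal). The covariates are such that for every $\theta\in\Theta$ the vector $\Gamma X_0$ has almost surely nonnegative coordinates (automatic if $X_0\in\mathbb R_+^m$), so that the latent processes below take values in $\mathbb R_+^2$. Let $((Y_t,\lambda_t))_{t\in\mathbb Z}$, with $Y_t\in\mathbb R\times\mathbb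 N$, be a stationary, $(\mathcal F_t)$-adapted process with $\mathbb E|\lambda_0|_1<\infty$ that solves the GAIN (GARCH-INGARCH) model with parameter $\theta_0$: almost surely, for all $t\in\mathbb Z$, $$Y_{1,t}=\lambda_{1,t}^{1/2}F_\varepsilon^{-1}(U_{1,t}),\qquad Y_{2,t}=\inf\Big\{y\in\mathbb N:\sum_{j=0}^y e^{-\lambda_{2,t}}\frac{\lambda_{2,t}^j}{j!}\ge U_{2,t}\Big\},$$ $$\lambda_t=d_0+B_0\lambda_{t-1}+A_0\overline Y_{t-1}+\Gamma_0X_{t-1},\qquad \overline Y_t=(Y_{1,t}^2,Y_{2,t})'.$$ **Estimator.** Fix a deterministic $\overline\lambda_0\in\mathbb R_+^2$. For $\theta\in\Theta$ put $\overline\lambda_0(\theta)=\overline\lambda_0$ and $\overline\lambda_t(\theta)=d+B\overline\lambda_{t-1}(\theta)+A\overline Y_{t-1}+\Gamma X_{t-1}$ for $t\ge 1$. The Gaussian-QML/Poisson pseudo-maximum likelihood estimator $\hat\theta_n$ ($n\ge 1$) is any minimizer over $\theta\in\Theta$ of $$\frac1n\sum_{t=1}^n\Big\{\frac{Y_{1,t}^2}{\overline\lambda_{1,t}(\theta)}+\log\overline\lambda_{1,t}(\theta)+\overline\lambda_{2,t}(\theta)-Y_{2,t}\log\overline\lambda_{2,t}(\theta)\Big\}.$$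 **Assumptions.** Let $\rho$ denote the spectral radius. Assume: * (I0) $\rho(B)<1$ for every $\theta\in\Theta$; * one of the following two conditions holds: * (I1) if $v\in\mathbb R^m$ and $v'X_1$ is almost surely equal to an $\mathcal F_0\vee\sigma(U_1)$-measurable random variable, then $v=0$; * (I1') the processes $(U_t)$ and $(X_t)$ are independent, and if $\Phi_j\in\mathbb R^{2\times m}$ $(j\ge1)$ and $c\in\mathbb R^2$ are such that almost surely the series $\sum_{j\ge1}\Phi_jX_{-j}$ converges absolutely and $\sum_{j\ge1}\Phi_jX_{-j}+c=0$, then $c=0$ and $\Phi_j=0$ for all $j$; * (I2) for every $s>0$, the function $y\mapsto y^2$ is not constant on the support of the law of $\sqrt s\,\varepsilon$ and the function $y\mapsto y$ is not constant on the support of the Poisson law with parameter $s$; moreover $C$ has a density with respect to Lebesgue measure on $[0,1]^2$ that is positive on $(0,1)^2$; * (I3) if $\theta\in\Theta$ and $B^jv=B_0^jv$ for all $j\ge1$ and all columns $v$ of $A_0$ and of $\Gamma_0$, then $B=B_0$; * $\rho(A_0+B_0)<1$; * there is $\delta>0$ with $\mathbb E|X_0|_1^{1+\delta}<\infty$ and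 $\mathbb E|\varepsilon|^{2(1+\delta)}<\infty$. **Conclusion.** Almost surely a minimizer exists for every $n\ge1$, and every such sequence of estimators is strongly consistent: $$\lim_{n\to\infty}\hat\theta_n=\theta_0\quad\text{a.s.}$$ -/

import Mathlib

open MeasureTheory ProbabilityTheory Filter Topology

noncomputable section

namespace Gain

/-! ### Stationary processes indexed by the integers -/

/-- The left shift on bi-infinite sequences. -/
def shift {E : Type*} (x : ℤ → E) : ℤ → E := fun t => x (t + 1)

/-- The law, on the space of bi-infinite sequences, of a process indexed by `ℤ`. -/
def processLaw {Ω E : Type*} [MeasurableSpace Ω] [MeasurableSpace E]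
    (P : Measure Ω) (Z : ℤ → Ω → E) : Measure (ℤ → E) :=
  P.map (fun ω t => Z t ω)

/-- Strict stationarity: the law of the process is invariant under the shift. -/
def IsStationary {Ω E : Type*} [MeasurableSpace Ω] [MeasurableSpace E]
    (P : Measure Ω) (Z : ℤ → Ω → E) : Prop :=
  MeasurePreserving shift (processLaw P Z) (processLaw P Z)

/-- Stationarity and ergodicity: the shift is ergodic for the law of the process. -/
def IsStationaryErgodic {Ω E : Type*} [MeasurableSpace Ω] [MeasurableSpace E]
    (P : Measure Ω) (Z : ℤ → Ω → E) : Prop :=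
  Ergodic shift (processLaw P Z)

/-- The sigma-field `𝓕_t` generated by the vectors `(U_s, X_s)`, `s ≤ t`. -/
@[reducible] def past {Ω : Type*} {m : ℕ} (U : ℤ → Ω → Fin 2 → ℝ) (X : ℤ → Ω → Fin m → ℝ) (t : ℤ) :
    MeasurableSpace Ω :=
  ⨆ s : {s : ℤ // s ≤ t}, MeasurableSpace.comap (fun ω => (U s ω, X s ω)) inferInstance

/-- Standing assumption on noise and covariates: `((U_t, X_t))` is stationary and ergodic, and
`U_t` is independent of `𝓕_{t-1}` for every `t`. -/
structure NoiseCovariateAssumption {Ω : Type*} [MeasurableSpace Ω] {m : ℕ} (P : Measure Ω)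
    (U : ℤ → Ω → Fin 2 → ℝ) (X : ℤ → Ω → Fin m → ℝ) : Prop where
  stationary_ergodic : IsStationaryErgodic P (fun t ω => (U t ω, X t ω))
  indep_past : ∀ t : ℤ,
    Indep (MeasurableSpace.comap (U t) inferInstance) (past U X (t - 1)) P

/-- A bivariate copula: a probability law with marginals uniform on `[0,1]`. -/
def IsCopula (C : Measure (Fin 2 → ℝ)) : Prop :=
  IsProbabilityMeasure C ∧
    ∀ i, C.map (fun u => u i) = volume.restrict (Set.Icc (0 : ℝ) 1)

/-! ### The model -/

/-- Parameters `θ = (d, Γ, A, B)`, identified with vectors of real numbers. -/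
abbrev Param (m : ℕ) : Type :=
  (Fin 2 → ℝ) × Matrix (Fin 2) (Fin m) ℝ × Matrix (Fin 2) (Fin 2) ℝ × Matrix (Fin 2) (Fin 2) ℝ

/-- The intercept `d`. -/
def Param.d {m : ℕ} (θ : Param m) : Fin 2 → ℝ := θ.1
/-- The matrix `Γ` multiplying the covariates. -/
def Param.Γ {m : ℕ} (θ : Param m) : Matrix (Fin 2) (Fin m) ℝ := θ.2.1
/-- The matrix `A` multiplying the past observations. -/
def Param.A {m : ℕ} (θ : Param m) : Matrix (Fin 2) (Fin 2) ℝ := θ.2.2.1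
/-- The matrix `B` multiplying the past latent vector. -/
def Param.B {m : ℕ} (θ : Param m) : Matrix (Fin 2) (Fin 2) ℝ := θ.2.2.2

/-- Spectral radius of a real matrix (largest modulus of its complex eigenvalues). -/
def specRad (M : Matrix (Fin 2) (Fin 2) ℝ) : ENNReal :=
  spectralRadius ℂ (M.map (algebraMap ℝ ℂ))

/-- Quantile function (generalized inverse of the cdf) of a law on `ℝ`. -/
def quantile (ν : Measure ℝ) (u : ℝ) : ℝ := sInf {x : ℝ | u ≤ cdf ν x}

/-- Quantile function of the Poisson law with parameter `s`. -/
def poissonQuantile (s u : ℝ) : ℕ :=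
  sInf {y : ℕ | u ≤ ∑ j ∈ Finset.range (y + 1), Real.exp (-s) * s ^ j / (j.factorial : ℝ)}

/-- The map `F_s⁻¹` sending a point of `[0,1]²` to an observation in `ℝ × ℕ`. -/
def observe (ν : Measure ℝ) (s u : Fin 2 → ℝ) : ℝ × ℕ :=
  (√(s 0) * quantile ν (u 0), poissonQuantile (s 1) (u 1))

/-- `ȳ = (y₁², y₂)`. -/
def transformed (y : ℝ × ℕ) : Fin 2 → ℝ := ![y.1 ^ 2, (y.2 : ℝ)]

/-- One step `d + B s + A ȳ + Γ x` of the latent recursion. -/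
def latentStep {m : ℕ} (θ : Param m) (s : Fin 2 → ℝ) (y : ℝ × ℕ) (x : Fin m → ℝ) : Fin 2 → ℝ :=
  θ.d + θ.B.mulVec s + θ.A.mulVec (transformed y) + θ.Γ.mulVec x

/-- `((Y_t, L_t))` is a stationary, adapted solution of the GARCH-INGARCH model with parameter
`θ`, noise law `ν`, uniform variables `U` and covariates `X`, whose latent process `L` is
integrable. -/
structure IsStationarySolution {Ω : Type*} [MeasurableSpace Ω] {m : ℕ} (P : Measure Ω)
    (ν : Measure ℝ) (θ : Param m) (U : ℤ → Ω → Fin 2 → ℝ) (X : ℤ → Ω → Fin m → ℝ)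
    (Y : ℤ → Ω → ℝ × ℕ) (L : ℤ → Ω → Fin 2 → ℝ) : Prop where
  adapted : ∀ t : ℤ, Measurable[past U X t] (fun ω => (Y t ω, L t ω))
  stationary : IsStationary P (fun t ω => (Y t ω, L t ω))
  integrable : ∀ i, Integrable (fun ω => L 0 ω i) P
  observation : ∀ t : ℤ, ∀ᵐ ω ∂P, Y t ω = observe ν (L t ω) (U t ω)
  latent : ∀ t : ℤ, ∀ᵐ ω ∂P, L t ω = latentStep θ (L (t - 1) ω) (Y (t - 1) ω) (X (t - 1) ω)

/-! ### The pseudo-maximum likelihood estimator -/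

/-- The computable latent recursion `λ̄_t(θ)`, started at the deterministic vector `l₀` and driven
by the observed paths `y` and `x`. -/
def approxLatent {m : ℕ} (θ : Param m) (l₀ : Fin 2 → ℝ) (y : ℤ → ℝ × ℕ) (x : ℤ → Fin m → ℝ) :
    ℕ → Fin 2 → ℝ
  | 0 => l₀
  | t + 1 => latentStep θ (approxLatent θ l₀ y x t) (y t) (x t)

/-- Gaussian quasi-likelihood contrast `y²/μ + log μ`. -/
def contrastGaussian (y μ : ℝ) : ℝ := y ^ 2 / μ + Real.log μ

/-- Poisson contrast `μ - y log μ`. -/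
def contrastPoisson (y : ℕ) (μ : ℝ) : ℝ := μ - (y : ℝ) * Real.log μ

/-- The criterion computed from the sample up to time `n`. -/
def criterion {m : ℕ} (l₀ : Fin 2 → ℝ) (y : ℤ → ℝ × ℕ) (x : ℤ → Fin m → ℝ) (n : ℕ)
    (θ : Param m) : ℝ :=
  (n : ℝ)⁻¹ * ∑ t ∈ Finset.Icc 1 n,
    (contrastGaussian (y t).1 (approxLatent θ l₀ y x t 0) +
      contrastPoisson (y t).2 (approxLatent θ l₀ y x t 1))

/-- `θ'` minimizes the criterion over `Θ`. -/
def IsPMLE {m : ℕ} (Θ : Set (Param m)) (l₀ : Fin 2 → ℝ) (y : ℤ → ℝ × ℕ) (x : ℤ → Fin m → ℝ)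
    (n : ℕ) (θ' : Param m) : Prop :=
  θ' ∈ Θ ∧ IsMinOn (criterion l₀ y x n) Θ θ'

/-! ### Identifiability conditions -/

/-- `ρ(B) < 1` for every parameter of `Θ`. -/
def I0 {m : ℕ} (Θ : Set (Param m)) : Prop := ∀ θ ∈ Θ, specRad θ.B < 1

/-- A linear combination `v'X₁` is (almost surely equal to) an `𝓕₀ ∨ σ(U₁)`-measurable variable
only for `v = 0`. -/
def I1 {Ω : Type*} [MeasurableSpace Ω] {m : ℕ} (P : Measure Ω)
    (U : ℤ → Ω → Fin 2 → ℝ) (X : ℤ → Ω → Fin m → ℝ) : Prop :=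
  ∀ v : Fin m → ℝ,
    (∃ Z : Ω → ℝ,
      Measurable[past U X 0 ⊔ MeasurableSpace.comap (U 1) inferInstance] Z ∧
        (fun ω => v ⬝ᵥ X 1 ω) =ᵐ[P] Z) →
    v = 0

/-- The processes `U` and `X` are independent, and `∑_{j ≥ 1} Φ_j X_{-j} + c = 0` almost surely
(the series being convergent) only if all `Φ_j` and `c` vanish; `Φ j` below stands for
`Φ_{j+1}`. -/
def I1' {Ω : Type*} [MeasurableSpace Ω] {m : ℕ} (P : Measure Ω)
    (U : ℤ → Ω → Fin 2 → ℝ) (X : ℤ → Ω → Fin m → ℝ) : Prop :=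
  IndepFun (fun ω (t : ℤ) => U t ω) (fun ω (t : ℤ) => X t ω) P ∧
    ∀ (Φ : ℕ → Matrix (Fin 2) (Fin m) ℝ) (c : Fin 2 → ℝ),
      (∀ᵐ ω ∂P, HasSum (fun j : ℕ => (Φ j).mulVec (X (-((j : ℤ) + 1)) ω)) (-c)) →
      (∀ j, Φ j = 0) ∧ c = 0

/-- The conditional marginal laws `P_i(· | s)`: the law of `√s ε` for the first coordinate, the
Poisson law with parameter `s` (seen on `ℝ`) for the second one. -/
def marginal (ν : Measure ℝ) : Fin 2 → ℝ → Measure ℝ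
  | 0, s => ν.map (fun e => √s * e)
  | 1, s => (poissonMeasure s.toNNReal).map (fun k : ℕ => (k : ℝ))

/-- The functions `g₁(y) = y²` and `g₂(y) = y`. -/
def g : Fin 2 → ℝ → ℝ
  | 0, y => y ^ 2
  | 1, y => y

/-- `g_i` is not constant on the support of `P_i(· | s)`, and the copula `C` has a density that is
positive on the open unit square. -/
def I2 (ν : Measure ℝ) (C : Measure (Fin 2 → ℝ)) : Prop :=
  (∀ i, ∀ s : ℝ, 0 < s → ¬ ∃ a : ℝ, ∀ y ∈ (marginal ν i s).support, g i y = a) ∧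
  ∃ c : (Fin 2 → ℝ) → ℝ, Measurable c ∧
    (∀ u : Fin 2 → ℝ, (∀ i, u i ∈ Set.Ioo (0 : ℝ) 1) → 0 < c u) ∧
    C = (volume.restrict (Set.Icc (0 : Fin 2 → ℝ) 1)).withDensity (fun u => ENNReal.ofReal (c u))

/-- If the parameter `θ` of `Θ` is such that `B^j v = B₀^j v`, `j ≥ 1`, for all columns `v` of
`A₀` and of `Γ₀`, then `B = B₀`. -/
def I3 {m : ℕ} (Θ : Set (Param m)) (θ₀ : Param m) : Prop :=
  ∀ θ ∈ Θ,
    (∀ v : Fin 2 → ℝ, (v ∈ Set.range θ₀.A.col ∨ v ∈ Set.range θ₀.Γ.col) →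
      ∀ j : ℕ, 1 ≤ j → (θ.B ^ j).mulVec v = (θ₀.B ^ j).mulVec v) →
    θ.B = θ₀.B

end Gain

end

/-! The argument is of Wald type, carried out on the space of bi-infinite paths of `(U, X)`, where
the shift is ergodic.

Representation. For a fixed uniform vector the transformed observation is monotone in the latent
vector, coordinate by coordinate, and its conditional mean is the latent vector. Two predictable
integrable solutions fed with the same noise therefore satisfy `E|λ_t - λ'_t| ≤ (A₀ + B₀) E|λ_{t-1}
- λ'_{t-1}|`, and `ρ(A₀ + B₀) < 1` forces them to agree. A solution thus agrees with its own time
shift, so `λ_t` is one fixed function `f` of the shifted path (`exists_stationaryModel`). For the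
other parameters the latent process is the series `latentSeries`, which converges because the powers
of `B` decay geometrically, uniformly over the compact set (`exists_geometric_bound`).

Identification. If `latentSeries` at `θ` equals `f`, subtracting the two recursions gives a linear
relation between the current observation, the current covariate and the past. The positive copula
density excludes the observation from such a relation, (I1) or (I1') excludes the covariates, and
iterating the recursion yields equality of the impulse responses, from which (I3) recovers `B`
(`StationaryModel.param_eq`).

Separation. The conditional mean of the contrast at `θ` minus the contrast at `θ₀` is a sum of terms
of the form `x - 1 - log x`, hence positive unless the latent vectors agree. As `λ log λ` need not
be integrable, the difference is bounded below by `contrastLower`, whose logarithm is truncated; the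
truncation keeps the mean positive. The bound also absorbs the oscillation in `θ` over a small
neighbourhood and the error from the arbitrary initial value. Its Birkhoff sums diverge to infinity
(`ae_tendsto_birkhoffSum_atTop`), so near each `θ ≠ θ₀` the criterion eventually exceeds its value
at `θ₀`. Compactness of `Θ` away from `θ₀` concludes. Only divergence of sums with positive mean is
needed, which follows from the maximal ergodic inequality alone. -/

noncomputable section

namespace Gain

/-! ### Divergence of Birkhoff sums of functions with positive mean -/

section Birkhoff

variable {α : Type*} {T : α → α} {f : α → ℝ}

/-- The running maximum `max (0, S₁ f, …, Sₙ f)` of the Birkhoff sums. -/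
def birkhoffMax (T : α → α) (f : α → ℝ) : ℕ → α → ℝ
  | 0, _ => 0
  | n + 1, x => max 0 (f x + birkhoffMax T f n (T x))

lemma birkhoffMax_nonneg (n : ℕ) (x : α) : 0 ≤ birkhoffMax T f n x := by
  cases n <;> simp [birkhoffMax]

lemma birkhoffMax_le_succ (n : ℕ) (x : α) : birkhoffMax T f n x ≤ birkhoffMax T f (n + 1) x := by
  induction n generalizing x with
  | zero => exact birkhoffMax_nonneg 1 x
  | succ n ih =>
    rw [birkhoffMax, birkhoffMax]
    exact max_le_max le_rfl (by linarith [ih (T x)])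

lemma birkhoffMax_mono (x : α) : Monotone (fun n => birkhoffMax T f n x) :=
  monotone_nat_of_le_succ fun n => birkhoffMax_le_succ n x

lemma birkhoffSum_le_birkhoffMax (n : ℕ) (x : α) : birkhoffSum T f n x ≤ birkhoffMax T f n x := by
  induction n generalizing x with
  | zero => simp [birkhoffMax]
  | succ n ih =>
    rw [birkhoffSum_succ', birkhoffMax]
    exact le_max_of_le_right (by linarith [ih (T x)])

variable [MeasurableSpace α] {μ : Measure α}

lemma measurable_birkhoffMax (hT : Measurable T) (hf : Measurable f) (n : ℕ) :
    Measurable (birkhoffMax T f n) := by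
  induction n with
  | zero => exact measurable_const
  | succ n ih => exact measurable_const.max (hf.add (ih.comp hT))

lemma integrable_birkhoffMax (hT : MeasurePreserving T μ μ) (hf : Integrable f μ) (n : ℕ) :
    Integrable (birkhoffMax T f n) μ := by
  induction n with
  | zero => exact integrable_zero _ _ _
  | succ n ih =>
    exact (integrable_zero _ _ _).sup (hf.add (hT.integrable_comp_of_integrable ih))

/-- The maximal ergodic inequality, by Garsia's argument: where the running maximum `M` is positive,
`M ≤ f + M ∘ T`; elsewhere `M = 0 ≤ M ∘ T`. So `M - M ∘ T` is at most `f` restricted to `{M > 0}`,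
and it integrates to zero. -/
lemma setIntegral_birkhoffMax_pos_nonneg (hT : MeasurePreserving T μ μ) (hfm : Measurable f)
    (hf : Integrable f μ) (n : ℕ) : 0 ≤ ∫ x in {x | 0 < birkhoffMax T f n x}, f x ∂μ := by
  have hM := integrable_birkhoffMax hT hf n
  have hMT : Integrable (fun x => birkhoffMax T f n (T x)) μ := hT.integrable_comp_of_integrable hM
  have hs : MeasurableSet {x | 0 < birkhoffMax T f n x} :=
    measurableSet_lt measurable_const (measurable_birkhoffMax hT.measurable hfm n)
  rw [← integral_indicator hs]
  have h0 : ∫ x, (birkhoffMax T f n x - birkhoffMax T f n (T x)) ∂μ = 0 := by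
    rw [integral_sub hM hMT]
    have : ∫ x, birkhoffMax T f n x ∂(μ.map T) = ∫ x, birkhoffMax T f n (T x) ∂μ :=
      integral_map hT.measurable.aemeasurable
        (measurable_birkhoffMax hT.measurable hfm n).aestronglyMeasurable
    rw [hT.map_eq] at this
    linarith
  refine h0.symm.le.trans ?_
  refine integral_mono (hM.sub hMT) (hf.indicator hs) fun x => ?_
  by_cases hx : 0 < birkhoffMax T f n x
  · have hx' : x ∈ {x | 0 < birkhoffMax T f n x} := hx
    rw [Set.indicator_of_mem hx']
    cases n with
    | zero => simp [birkhoffMax] at hx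
    | succ n =>
      have h1 : birkhoffMax T f (n + 1) x = f x + birkhoffMax T f n (T x) := by
        rw [birkhoffMax] at hx ⊢
        exact max_eq_right (by by_contra h; simp [max_eq_left (not_le.1 h).le] at hx)
      have := birkhoffMax_le_succ (T := T) (f := f) n (T x)
      simp only
      linarith
  · have hx' : x ∉ {x | 0 < birkhoffMax T f n x} := hx
    rw [Set.indicator_of_notMem hx']
    have := birkhoffMax_nonneg (T := T) (f := f) n (T x)
    simp only
    linarith

/-- Boundedness above of the sums is a shift-invariant event. If it were null, the running maxima
would become positive almost everywhere, and the maximal inequality would give a nonnegative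
integral in the limit. -/
lemma ae_bddAbove_birkhoffSum [IsProbabilityMeasure μ] (hT : Ergodic T μ) (hfm : Measurable f)
    (hf : Integrable f μ) (hneg : ∫ x, f x ∂μ < 0) :
    ∀ᵐ x ∂μ, BddAbove (Set.range fun n => birkhoffSum T f n x) := by
  have hTm := hT.measurable
  have hSm : ∀ n, Measurable (birkhoffSum T f n) := fun n => by
    unfold birkhoffSum
    exact Finset.measurable_sum _ fun i _ => hfm.comp (hTm.iterate i)
  set A : Set α := {x | BddAbove (Set.range fun n => birkhoffSum T f n x)} with hA
  have hAm : MeasurableSet A := measurableSet_bddAbove_range hSm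
  have hinv : T ⁻¹' A = A := by
    ext x
    constructor
    · rintro ⟨K, hK⟩
      refine ⟨max 0 (f x + K), ?_⟩
      rintro _ ⟨n, rfl⟩
      cases n with
      | zero => simp
      | succ n =>
        simp only [birkhoffSum_succ']
        exact le_max_of_le_right (by linarith [hK ⟨n, rfl⟩])
    · rintro ⟨K, hK⟩
      refine ⟨K - f x, ?_⟩
      rintro _ ⟨n, rfl⟩
      have := hK ⟨n + 1, rfl⟩
      simp only [birkhoffSum_succ'] at this
      simp only
      linarith
  rcases hT.toPreErgodic.ae_empty_or_univ hAm hinv with h | h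
  · exfalso
    have hpos : ∀ᵐ x ∂μ, ∀ᶠ n in atTop, 0 < birkhoffMax T f n x := by
      filter_upwards [h] with x hx
      have hxA : x ∉ A := fun hxA => by
        have : (∅ : Set α) x := hx.mp hxA
        exact this
      have : ∃ n, 0 < birkhoffSum T f n x := by
        by_contra! hcon
        exact hxA ⟨0, by rintro _ ⟨n, rfl⟩; exact hcon n⟩
      obtain ⟨n, hn⟩ := this
      filter_upwards [eventually_ge_atTop n] with k hk
      exact hn.trans_le ((birkhoffSum_le_birkhoffMax n x).trans (birkhoffMax_mono x hk))
    have hlim : Tendsto (fun n => ∫ x, ({x | 0 < birkhoffMax T f n x}.indicator f) x ∂μ) atTop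
        (𝓝 (∫ x, f x ∂μ)) := by
      refine tendsto_integral_of_dominated_convergence (fun x => |f x|)
        (fun n => (hfm.indicator (measurableSet_lt measurable_const
          (measurable_birkhoffMax hTm hfm n))).aestronglyMeasurable) hf.abs ?_ ?_
      · intro n
        refine Eventually.of_forall fun x => ?_
        rw [Real.norm_eq_abs]
        by_cases hx : x ∈ {x | 0 < birkhoffMax T f n x}
        · rw [Set.indicator_of_mem hx]
        · rw [Set.indicator_of_notMem hx]; simp
      · filter_upwards [hpos] with x hx
        refine tendsto_const_nhds.congr' ?_
        filter_upwards [hx] with n hn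
        exact (Set.indicator_of_mem (show x ∈ {x | 0 < birkhoffMax T f n x} from hn) f).symm
    have : 0 ≤ ∫ x, f x ∂μ := ge_of_tendsto' hlim fun n => by
      rw [integral_indicator (measurableSet_lt measurable_const
          (measurable_birkhoffMax hTm hfm n))]
      exact setIntegral_birkhoffMax_pos_nonneg hT.toMeasurePreserving hfm hf n
    linarith
  · filter_upwards [h] with x hx
    exact hx.mpr trivial

/-- The Birkhoff sums of a function with positive mean diverge to infinity almost surely. -/
theorem ae_tendsto_birkhoffSum_atTop [IsProbabilityMeasure μ] (hT : Ergodic T μ)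
    (hfm : Measurable f) (hf : Integrable f μ) (hpos : 0 < ∫ x, f x ∂μ) :
    ∀ᵐ x ∂μ, Tendsto (fun n => birkhoffSum T f n x) atTop atTop := by
  -- With half the mean, `c - f` still has negative mean, so its sums are bounded above; this says
  -- that the sums of `f` grow at least like `n * c`.
  set c := (∫ x, f x ∂μ) / 2 with hc
  have hc0 : 0 < c := by positivity
  have hneg : ∫ x, (c - f x) ∂μ < 0 := by
    rw [integral_sub (integrable_const _) hf]
    simp
    linarith
  filter_upwards [ae_bddAbove_birkhoffSum hT (measurable_const.sub hfm)
    ((integrable_const c).sub hf) hneg] with x ⟨K, hK⟩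
  have hlow : ∀ n : ℕ, n * c - K ≤ birkhoffSum T f n x := fun n => by
    have := hK ⟨n, rfl⟩
    simp only [birkhoffSum, Pi.sub_apply, Finset.sum_sub_distrib, Finset.sum_const,
      Finset.card_range, nsmul_eq_mul] at this
    simp only [birkhoffSum]
    linarith
  refine tendsto_atTop_mono hlow ?_
  exact tendsto_atTop_add_const_right _ _ (tendsto_natCast_atTop_atTop.atTop_mul_const hc0)

end Birkhoff

/-! ### Powers of matrices with spectral radius less than one -/

/-- The sum of the absolute values of the entries of a matrix. -/
def entrySum {k l : ℕ} (M : Matrix (Fin k) (Fin l) ℝ) : ℝ := ∑ i, ∑ j, |M i j|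

lemma entrySum_nonneg {k l : ℕ} (M : Matrix (Fin k) (Fin l) ℝ) : 0 ≤ entrySum M :=
  Finset.sum_nonneg fun _ _ => Finset.sum_nonneg fun _ _ => abs_nonneg _

lemma continuous_entrySum {k l : ℕ} : Continuous (entrySum (k := k) (l := l)) := by
  unfold entrySum
  fun_prop

lemma abs_mulVec_le {k l : ℕ} (M : Matrix (Fin k) (Fin l) ℝ) {v : Fin l → ℝ} {c : ℝ}
    (hv : ∀ j, |v j| ≤ c) (i : Fin k) : |M.mulVec v i| ≤ (∑ j, |M i j|) * c := by
  rw [Matrix.mulVec, dotProduct, Finset.sum_mul]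
  refine (Finset.abs_sum_le_sum_abs _ _).trans (Finset.sum_le_sum fun j _ => ?_)
  rw [abs_mul]
  exact mul_le_mul_of_nonneg_left (hv j) (abs_nonneg _)

lemma abs_mulVec_le_entrySum {k l : ℕ} (M : Matrix (Fin k) (Fin l) ℝ) {v : Fin l → ℝ} {c : ℝ}
    (hc : 0 ≤ c) (hv : ∀ j, |v j| ≤ c) (i : Fin k) : |M.mulVec v i| ≤ entrySum M * c :=
  (abs_mulVec_le M hv i).trans <| mul_le_mul_of_nonneg_right
    (Finset.single_le_sum (f := fun i => ∑ j, |M i j|)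
      (fun _ _ => Finset.sum_nonneg fun _ _ => abs_nonneg _) (Finset.mem_univ i)) hc

lemma entrySum_mul_le {k l n : ℕ} (M : Matrix (Fin k) (Fin l) ℝ) (N : Matrix (Fin l) (Fin n) ℝ) :
    entrySum (M * N) ≤ entrySum M * entrySum N := by
  have h1 : entrySum (M * N) ≤ ∑ i, ∑ j, |M i j| * ∑ a, |N j a| := by
    refine Finset.sum_le_sum fun i _ => ?_
    calc ∑ a, |(M * N) i a| ≤ ∑ a, ∑ j, |M i j| * |N j a| := by
          refine Finset.sum_le_sum fun a _ => ?_
          rw [Matrix.mul_apply]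
          refine (Finset.abs_sum_le_sum_abs _ _).trans (le_of_eq ?_)
          exact Finset.sum_congr rfl fun j _ => abs_mul _ _
      _ = ∑ j, |M i j| * ∑ a, |N j a| := by
          rw [Finset.sum_comm]
          exact Finset.sum_congr rfl fun j _ => (Finset.mul_sum _ _ _).symm
  refine h1.trans ?_
  rw [entrySum, Finset.sum_mul]
  refine Finset.sum_le_sum fun i _ => ?_
  rw [Finset.sum_mul]
  exact Finset.sum_le_sum fun j _ => mul_le_mul_of_nonneg_left
    (Finset.single_le_sum (f := fun i => ∑ j, |N i j|)
      (fun _ _ => Finset.sum_nonneg fun _ _ => abs_nonneg _) (Finset.mem_univ j)) (abs_nonneg _)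

/-- The exponent zero is excluded because the entries of the identity matrix sum to its size, not to
one. -/
lemma entrySum_pow_le {k : ℕ} (M : Matrix (Fin k) (Fin k) ℝ) {n : ℕ} (hn : n ≠ 0) :
    entrySum (M ^ n) ≤ entrySum M ^ n := by
  induction n with
  | zero => exact absurd rfl hn
  | succ n ih =>
    rcases Nat.eq_zero_or_pos n with rfl | h
    · simp
    · rw [pow_succ, pow_succ]
      exact (entrySum_mul_le _ _).trans
        (mul_le_mul_of_nonneg_right (ih h.ne') (entrySum_nonneg _))

section Gelfand

attribute [local instance] Matrix.linftyOpNormedRing Matrix.linftyOpNormedAlgebra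

lemma norm_entry_le_linftyOpNorm (M : Matrix (Fin 2) (Fin 2) ℂ) (i j : Fin 2) :
    ‖M i j‖ ≤ ‖M‖ := by
  have h : ‖M i j‖₊ ≤ ‖M‖₊ := by
    rw [Matrix.linfty_opNNNorm_def]
    exact (Finset.single_le_sum (f := fun j => ‖M i j‖₊) (fun _ _ => zero_le)
      (Finset.mem_univ j)).trans
      (Finset.le_sup (f := fun i => ∑ j, ‖M i j‖₊) (Finset.mem_univ i))
  exact h

/-- The powers of a matrix with spectral radius less than one tend to zero. -/
lemma tendsto_entrySum_pow {M : Matrix (Fin 2) (Fin 2) ℝ} (hM : specRad M < 1) :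
    Tendsto (fun n => entrySum (M ^ n)) atTop (𝓝 0) := by
  set a : Matrix (Fin 2) (Fin 2) ℂ := M.map (algebraMap ℝ ℂ) with ha
  have : CompleteSpace (Matrix (Fin 2) (Fin 2) ℂ) := FiniteDimensional.complete ℂ _
  have hG := spectrum.pow_nnnorm_pow_one_div_tendsto_nhds_spectralRadius a
  obtain ⟨q, hq1, hq2⟩ := ENNReal.lt_iff_exists_nnreal_btwn.1 hM
  have hq3 : q < 1 := by exact_mod_cast hq2
  have hev : ∀ᶠ n : ℕ in atTop, ‖a ^ n‖ ≤ (q : ℝ) ^ n := by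
    filter_upwards [hG.eventually_lt_const hq1, eventually_gt_atTop 0] with n hn hn0
    have hn' : (0 : ℝ) < n := by exact_mod_cast hn0
    have h1 : (‖a ^ n‖₊ : ENNReal) ≤ (q : ENNReal) ^ n := by
      have h2 := ENNReal.rpow_le_rpow hn.le hn'.le
      rw [← ENNReal.rpow_mul, one_div, inv_mul_cancel₀ hn'.ne', ENNReal.rpow_one,
        ENNReal.rpow_natCast] at h2
      exact h2
    exact_mod_cast h1
  have hnorm : Tendsto (fun n => ‖a ^ n‖) atTop (𝓝 0) :=
    squeeze_zero' (Eventually.of_forall fun _ => norm_nonneg _) hev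
      (tendsto_pow_atTop_nhds_zero_of_lt_one q.2 (by exact_mod_cast hq3))
  have hentry : ∀ n i j, |(M ^ n) i j| ≤ ‖a ^ n‖ := fun n i j => by
    have h1 : a ^ n = (M ^ n).map (algebraMap ℝ ℂ) :=
      (map_pow (algebraMap ℝ ℂ).mapMatrix M n).symm
    have h2 := norm_entry_le_linftyOpNorm (a ^ n) i j
    have h3 : ‖(a ^ n) i j‖ = |(M ^ n) i j| := by
      rw [h1]
      simp [Matrix.map_apply]
    rwa [h3] at h2
  refine squeeze_zero (fun n => entrySum_nonneg _) (g := fun n => 4 * ‖a ^ n‖) (fun n => ?_)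
    (by simpa using hnorm.const_mul 4)
  simp only [entrySum, Fin.sum_univ_two]
  linarith [hentry n 0 0, hentry n 0 1, hentry n 1 0, hentry n 1 1]

end Gelfand

/-- A halving property along steps of length `N` yields a geometric bound. -/
lemma geometric_bound_of_halving {b : ℕ → ℝ} {N : ℕ} (hN : 0 < N) {K : ℝ} (hK : 0 ≤ K)
    (hbase : ∀ j < N, b j ≤ K) (hstep : ∀ j, b (j + N) ≤ b j / 2) (j : ℕ) :
    b j ≤ 2 * K * (1 - (1 / 2) / (N : ℝ)) ^ j := by
  set r : ℝ := 1 - (1 / 2) / (N : ℝ) with hr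
  have hN' : (1 : ℝ) ≤ N := by exact_mod_cast hN
  have hdiv : (1 / 2) / (N : ℝ) ≤ 1 / 2 := div_le_self (by norm_num) hN'
  have hr0 : 0 < r := by rw [hr]; linarith
  have hr1 : r ≤ 1 := by
    rw [hr]
    have : 0 ≤ (1 / 2) / (N : ℝ) := by positivity
    linarith
  -- Bernoulli's inequality. It means that the rate `r` loses at most a factor two over `N` steps;
  -- this also explains the factor two in front of `K`, which covers the indices below `N`.
  have hrN : 1 / 2 ≤ r ^ N := by
    have h := one_add_mul_le_pow (a := -((1 / 2) / (N : ℝ))) (by linarith) N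
    have h2 : (1 : ℝ) + N * -((1 / 2) / (N : ℝ)) = 1 / 2 := by field_simp; norm_num
    rw [h2] at h
    rw [hr, sub_eq_add_neg]
    exact h
  induction j using Nat.strong_induction_on with
  | _ j ih =>
    rcases lt_or_ge j N with h | h
    · have h1 : 1 / 2 ≤ r ^ j := hrN.trans (pow_le_pow_of_le_one hr0.le hr1 h.le)
      have := hbase j h
      nlinarith
    · obtain ⟨i, rfl⟩ := Nat.exists_eq_add_of_le' h
      have h1 := hstep i
      have h2 := ih i (by omega)
      rw [pow_add]
      have h3 : 0 ≤ 2 * K * r ^ i := by positivity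
      nlinarith

/-- Powers of the matrices of a compact set on which the spectral radius is less than one decay
at a uniform geometric rate. -/
theorem exists_geometric_bound {S : Set (Matrix (Fin 2) (Fin 2) ℝ)} (hS : IsCompact S)
    (hρ : ∀ B ∈ S, specRad B < 1) :
    ∃ C r : ℝ, 0 ≤ C ∧ 0 < r ∧ r < 1 ∧ ∀ B ∈ S, ∀ j, entrySum (B ^ j) ≤ C * r ^ j := by
  have hcont : ∀ k : ℕ, Continuous fun B : Matrix (Fin 2) (Fin 2) ℝ => entrySum (B ^ k) :=
    fun k => continuous_entrySum.comp (continuous_pow k)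
  obtain ⟨F, hF⟩ := hS.elim_finite_subcover
    (fun k : ℕ => {B : Matrix (Fin 2) (Fin 2) ℝ | entrySum (B ^ (k + 1)) < 1 / 2})
    (fun k => isOpen_lt (hcont _) continuous_const) fun B hB => by
      obtain ⟨k, hk, hk'⟩ := (((tendsto_entrySum_pow (hρ B hB)).eventually_lt_const
        (show (0 : ℝ) < 1 / 2 by norm_num)).and (eventually_gt_atTop 0)).exists
      obtain ⟨i, rfl⟩ := Nat.exists_eq_succ_of_ne_zero hk'.ne'
      exact Set.mem_iUnion.2 ⟨i, hk⟩
  -- A common multiple of the finitely many exponents of the subcover, so that the single power `N`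
  -- has size at most one half for every matrix of the set.
  set N : ℕ := ∏ k ∈ F, (k + 1) with hN
  have hN0 : 0 < N := Finset.prod_pos fun k _ => Nat.succ_pos k
  have hhalf : ∀ B ∈ S, entrySum (B ^ N) ≤ 1 / 2 := fun B hB => by
    obtain ⟨k, hkF, hk⟩ := Set.mem_iUnion₂.1 (hF hB)
    obtain ⟨q, hq⟩ : k + 1 ∣ N := Finset.dvd_prod_of_mem (fun k => k + 1) hkF
    have hq0 : q ≠ 0 := by rintro rfl; simp at hq; omega
    rw [hq, pow_mul]
    refine (entrySum_pow_le _ hq0).trans ?_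
    have hk' : entrySum (B ^ (k + 1)) < 1 / 2 := hk
    calc entrySum (B ^ (k + 1)) ^ q ≤ (1 / 2) ^ q :=
          pow_le_pow_left₀ (entrySum_nonneg _) hk'.le _
      _ ≤ (1 / 2 : ℝ) ^ 1 := pow_le_pow_of_le_one (by norm_num) (by norm_num) (by omega)
      _ = 1 / 2 := pow_one _
  have hbd : ∀ j : ℕ, ∃ K, ∀ B ∈ S, entrySum (B ^ j) ≤ K := fun j => by
    obtain ⟨K, hK⟩ := (hS.image (hcont j)).bddAbove
    exact ⟨K, fun B hB => hK ⟨B, hB, rfl⟩⟩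
  choose K hK using hbd
  set K' : ℝ := ∑ j ∈ Finset.range N, |K j| with hK'
  have hK'0 : 0 ≤ K' := Finset.sum_nonneg fun _ _ => abs_nonneg _
  have hN' : (1 : ℝ) ≤ N := by exact_mod_cast hN0
  have hdiv : (1 / 2) / (N : ℝ) ≤ 1 / 2 := div_le_self (by norm_num) hN'
  have hdiv' : 0 < (1 / 2) / (N : ℝ) := by positivity
  refine ⟨2 * K', 1 - (1 / 2) / (N : ℝ), by positivity, by linarith, by linarith,
    fun B hB j => ?_⟩
  refine geometric_bound_of_halving (b := fun j => entrySum (B ^ j)) hN0 hK'0 (fun j hj => ?_) (fun j => ?_) j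
  · exact ((hK j B hB).trans (le_abs_self _)).trans (Finset.single_le_sum (f := fun j => |K j|)
      (fun _ _ => abs_nonneg _) (Finset.mem_range.2 hj))
  · simp only [pow_add]
    refine (entrySum_mul_le _ _).trans ?_
    have := hhalf B hB
    nlinarith [entrySum_nonneg (B ^ j)]

/-- A bounded nonnegative family indexed by `ℤ` that is dominated by its predecessor multiplied
by a nonnegative matrix with vanishing powers is identically zero. -/
lemma eq_zero_of_le_mulVec_pred {M : Matrix (Fin 2) (Fin 2) ℝ} (hM0 : ∀ i j, 0 ≤ M i j)
    (hM : specRad M < 1) {e : ℤ → Fin 2 → ℝ} {K : ℝ} (he0 : ∀ t i, 0 ≤ e t i)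
    (heK : ∀ t i, e t i ≤ K) (he : ∀ t i, e t i ≤ M.mulVec (e (t - 1)) i) (t : ℤ) (i : Fin 2) :
    e t i = 0 := by
  have hpow0 : ∀ n i j, 0 ≤ (M ^ n) i j := fun n => by
    induction n with
    | zero => intro i j; rw [pow_zero, Matrix.one_apply]; split_ifs <;> norm_num
    | succ n ih =>
      intro i j
      rw [pow_succ, Matrix.mul_apply]
      exact Finset.sum_nonneg fun k _ => mul_nonneg (ih i k) (hM0 k j)
  -- The inequality is iterated into the remote past, where the family stays bounded by `K` while
  -- the powers of `M` vanish.
  have hiter : ∀ n : ℕ, ∀ i, e t i ≤ (M ^ n).mulVec (e (t - n)) i := fun n => by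
    induction n with
    | zero => intro i; simp
    | succ n ih =>
      intro i
      refine (ih i).trans ?_
      rw [pow_succ, ← Matrix.mulVec_mulVec]
      simp only [Matrix.mulVec, dotProduct]
      refine Finset.sum_le_sum fun j _ => mul_le_mul_of_nonneg_left ?_ (hpow0 n i j)
      have := he (t - n) j
      rw [show t - ((n + 1 : ℕ) : ℤ) = t - n - 1 by push_cast; ring]
      exact this
  have hK0 : 0 ≤ K := (he0 t i).trans (heK t i)
  have hbd : ∀ n : ℕ, e t i ≤ entrySum (M ^ n) * K := fun n =>
    (hiter n i).trans ((le_abs_self _).trans (abs_mulVec_le_entrySum _ hK0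
      (fun j => by rw [abs_of_nonneg (he0 _ j)]; exact heK _ j) i))
  refine le_antisymm ?_ (he0 t i)
  refine ge_of_tendsto' (x := atTop) (f := fun n : ℕ => entrySum (M ^ n) * K) ?_ hbd
  simpa using (tendsto_entrySum_pow hM).mul_const K

/-! ### Quantile transforms -/

/-- The uniform law on `[0,1]`. -/
def unif : Measure ℝ := volume.restrict (Set.Icc (0 : ℝ) 1)

instance : IsProbabilityMeasure unif := ⟨by simp [unif]⟩

lemma ae_unif_mem_Ioo : ∀ᵐ u ∂unif, u ∈ Set.Ioo (0 : ℝ) 1 := by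
  have : unif = volume.restrict (Set.Ioo (0 : ℝ) 1) :=
    (Measure.restrict_congr_set Ioo_ae_eq_Icc).symm
  rw [this]
  exact ae_restrict_mem measurableSet_Ioo

lemma unif_Iic {p : ℝ} (h1 : p ≤ 1) : unif (Set.Iic p) = ENNReal.ofReal p := by
  rw [unif, Measure.restrict_apply measurableSet_Iic]
  have : Set.Iic p ∩ Set.Icc 0 1 = Set.Icc 0 p := by
    ext x
    simp only [Set.mem_inter_iff, Set.mem_Iic, Set.mem_Icc]
    exact ⟨fun h => ⟨h.2.1, h.1⟩, fun h => ⟨h.2, h.1, h.2.trans h1⟩⟩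
  rw [this]
  simp

/-- The image of the uniform law under a generalized inverse of `F`. -/
lemma map_unif_Iic {α : Type*} [MeasurableSpace α] [Preorder α] {Q : ℝ → α} (hQ : Measurable Q)
    {a : α} (ha : MeasurableSet (Set.Iic a)) {p : ℝ} (h1 : p ≤ 1)
    (h : ∀ u ∈ Set.Ioo (0 : ℝ) 1, Q u ≤ a ↔ u ≤ p) :
    (unif.map Q) (Set.Iic a) = ENNReal.ofReal p := by
  rw [Measure.map_apply hQ ha, ← unif_Iic h1]
  refine measure_congr ?_
  filter_upwards [ae_unif_mem_Ioo] with u hu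
  exact propext (h u hu)

section Quantile

variable (ν : Measure ℝ)

/-- The Galois property of the generalized inverse. For `u` in the open interval the defining set is
nonempty and bounded below, and right continuity of the distribution function makes it contain its
infimum. -/
lemma quantile_le_iff {u : ℝ} (hu : u ∈ Set.Ioo (0 : ℝ) 1) (x : ℝ) :
    quantile ν u ≤ x ↔ u ≤ cdf ν x := by
  have hne : {x : ℝ | u ≤ cdf ν x}.Nonempty :=
    ((tendsto_cdf_atTop ν).eventually_const_le hu.2).exists
  obtain ⟨b, hb⟩ := ((tendsto_cdf_atBot ν).eventually_lt_const hu.1).exists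
  have hbdd : BddBelow {x : ℝ | u ≤ cdf ν x} := ⟨b, fun y hy => by
    by_contra! hlt
    have h1 : u ≤ cdf ν y := hy
    exact absurd (h1.trans (monotone_cdf ν hlt.le)) (not_le.2 hb)⟩
  refine ⟨fun h => ?_, fun h => csInf_le hbdd h⟩
  have hright : ContinuousWithinAt (cdf ν) (Set.Ici x) x := (cdf ν).right_continuous x
  have hev : ∀ y > x, u ≤ cdf ν y := fun y hy => by
    obtain ⟨z, hz, hzy⟩ := exists_lt_of_csInf_lt hne (h.trans_lt hy)
    exact le_trans hz (monotone_cdf ν hzy.le)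
  have hright' : Tendsto (cdf ν) (𝓝[>] x) (𝓝 (cdf ν x)) :=
    hright.mono_left (nhdsWithin_mono _ Set.Ioi_subset_Ici_self)
  exact ge_of_tendsto hright' (eventually_nhdsWithin_of_forall fun y hy => hev y hy)

lemma measurable_quantile : Measurable (quantile ν) := by
  refine measurable_of_Iic fun x => ?_
  have h : quantile ν ⁻¹' Set.Iic x =
      (Set.Ioo 0 1 ∩ Set.Iic (cdf ν x)) ∪ (quantile ν ⁻¹' Set.Iic x ∩ {1}) ∪
        ((Set.Iic 0 ∪ Set.Ioi 1) ∩ {_u | 0 ≤ x}) := by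
    ext u
    -- Outside `(0, 1]` the defining set is everything or empty, and its real infimum is zero by
    -- convention. The endpoint `u = 1` depends on `ν` and is set aside as a single point.
    have key : u ≤ 0 ∨ 1 < u → quantile ν u = 0 := by
      rintro (hu | hu)
      · have : {x : ℝ | u ≤ cdf ν x} = Set.univ :=
          Set.eq_univ_of_forall fun y => hu.trans (cdf_nonneg ν y)
        rw [quantile, this, Real.sInf_univ]
      · have : {x : ℝ | u ≤ cdf ν x} = ∅ :=
          Set.eq_empty_of_forall_notMem fun y hy => by
            have h1 : u ≤ cdf ν y := hy
            linarith [cdf_le_one ν y]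
        rw [quantile, this, Real.sInf_empty]
    simp only [Set.mem_preimage, Set.mem_Iic, Set.mem_union, Set.mem_inter_iff, Set.mem_Ioo,
      Set.mem_singleton_iff, Set.mem_Ioi, Set.mem_ofPred_eq]
    constructor
    · intro hu
      rcases lt_trichotomy u 1 with h1 | h1 | h1
      · rcases le_or_gt u 0 with h0 | h0
        · exact Or.inr ⟨Or.inl h0, by rwa [key (Or.inl h0)] at hu⟩
        · exact Or.inl (Or.inl ⟨⟨h0, h1⟩, (quantile_le_iff ν ⟨h0, h1⟩ x).1 hu⟩)
      · exact Or.inl (Or.inr ⟨hu, h1⟩)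
      · exact Or.inr ⟨Or.inr h1, by rwa [key (Or.inr h1)] at hu⟩
    · rintro ((⟨hu, hx⟩ | ⟨hu, -⟩) | ⟨hu, hx⟩)
      · exact (quantile_le_iff ν hu x).2 hx
      · exact hu
      · rw [key hu]; exact hx
  rw [h]
  exact ((measurableSet_Ioo.inter measurableSet_Iic).union
    ((Set.subsingleton_singleton.anti Set.inter_subset_right).measurableSet)).union
    ((measurableSet_Iic.union measurableSet_Ioi).inter (MeasurableSet.const _))

lemma map_quantile [IsProbabilityMeasure ν] : unif.map (quantile ν) = ν := by
  refine Measure.ext_of_Iic _ _ fun x => ?_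
  rw [map_unif_Iic (measurable_quantile ν) measurableSet_Iic (cdf_le_one ν x)
    (fun u hu => quantile_le_iff ν hu x), ofReal_cdf]

end Quantile

section Poisson

/-- The distribution function of the Poisson law with parameter `s` at the integer `y`. -/
def poissonCdf (s : ℝ) (y : ℕ) : ℝ :=
  ∑ j ∈ Finset.range (y + 1), Real.exp (-s) * s ^ j / (j.factorial : ℝ)

lemma poissonCdf_mono {s : ℝ} (hs : 0 ≤ s) : Monotone (poissonCdf s) := fun a b hab =>
  Finset.sum_le_sum_of_subset_of_nonneg
    (Finset.range_subset_range.2 (by omega)) fun _ _ _ => by positivity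

lemma hasSum_poisson {s : ℝ} (hs : 0 ≤ s) :
    HasSum (fun j : ℕ => Real.exp (-s) * s ^ j / (j.factorial : ℝ)) 1 := by
  have := hasSum_one_poissonMeasure s.toNNReal
  rwa [Real.coe_toNNReal s hs] at this

lemma poissonCdf_le_one {s : ℝ} (hs : 0 ≤ s) (y : ℕ) : poissonCdf s y ≤ 1 :=
  sum_le_hasSum _ (fun _ _ => by positivity) (hasSum_poisson hs)

lemma poissonQuantile_le_iff {s u : ℝ} (hs : 0 ≤ s) (hu : u < 1) (y : ℕ) :
    poissonQuantile s u ≤ y ↔ u ≤ poissonCdf s y := by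
  have hne : {y : ℕ | u ≤ poissonCdf s y}.Nonempty := by
    have h := ((hasSum_poisson hs).tendsto_sum_nat.comp (tendsto_add_atTop_nat 1))
    exact (h.eventually_const_le hu).exists
  refine ⟨fun h => ?_, fun h => Nat.sInf_le h⟩
  have h1 : u ≤ poissonCdf s (poissonQuantile s u) := Nat.sInf_mem hne
  exact h1.trans (poissonCdf_mono hs h)

lemma measurable_poissonQuantile : Measurable fun p : ℝ × ℝ => poissonQuantile p.1 p.2 := by
  have hF : ∀ y : ℕ, MeasurableSet {p : ℝ × ℝ | p.2 ≤ poissonCdf p.1 y} := fun y => by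
    refine measurableSet_le measurable_snd ?_
    unfold poissonCdf
    fun_prop
  refine measurable_of_Iic fun y => ?_
  -- The second set collects the points where no integer qualifies; there the infimum of the empty
  -- set is zero.
  have h : (fun p : ℝ × ℝ => poissonQuantile p.1 p.2) ⁻¹' Set.Iic y =
      (⋃ k ∈ Set.Iic y, {p : ℝ × ℝ | p.2 ≤ poissonCdf p.1 k}) ∪
        ⋂ k : ℕ, {p : ℝ × ℝ | p.2 ≤ poissonCdf p.1 k}ᶜ := by
    ext p
    simp only [Set.mem_preimage, Set.mem_Iic, Set.mem_union, Set.mem_iUnion, Set.mem_iInter,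
      Set.mem_compl_iff, Set.mem_ofPred_eq, exists_prop]
    constructor
    · intro hp
      by_cases hne : {k : ℕ | p.2 ≤ poissonCdf p.1 k}.Nonempty
      · exact Or.inl ⟨_, hp, Nat.sInf_mem hne⟩
      · exact Or.inr fun k hk => hne ⟨k, hk⟩
    · rintro (⟨k, hk, hpk⟩ | hp)
      · exact (Nat.sInf_le (s := {k : ℕ | p.2 ≤ poissonCdf p.1 k}) hpk).trans hk
      · have : {k : ℕ | p.2 ≤ poissonCdf p.1 k} = ∅ :=
          Set.eq_empty_of_forall_notMem fun k hk => hp k hk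
        have h0 : poissonQuantile p.1 p.2 = sInf {k : ℕ | p.2 ≤ poissonCdf p.1 k} := rfl
        rw [h0, this, Nat.sInf_empty]
        exact Nat.zero_le _
  rw [h]
  exact (MeasurableSet.biUnion (Set.to_countable _) fun k _ => hF k).union
    (MeasurableSet.iInter fun k => (hF k).compl)

/-- The derivatives of the individual masses telescope, leaving minus the mass at `y`. Its sign
makes the distribution function decrease in the parameter, and hence the quantile increase. -/
lemma hasDerivAt_poissonCdf (y : ℕ) (s : ℝ) :
    HasDerivAt (fun s => poissonCdf s y) (-(Real.exp (-s) * s ^ y / (y.factorial : ℝ))) s := by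
  induction y with
  | zero =>
    have : (fun s => poissonCdf s 0) = fun s => Real.exp (-s) := by
      funext s; simp [poissonCdf]
    rw [this]
    have := (hasDerivAt_neg s).exp
    simpa using this
  | succ y ih =>
    have : (fun s => poissonCdf s (y + 1)) = fun s => poissonCdf s y +
        Real.exp (-s) * s ^ (y + 1) / ((y + 1).factorial : ℝ) := by
      funext s; rw [poissonCdf, Finset.sum_range_succ, poissonCdf]
    rw [this]
    have h1 := ((((hasDerivAt_neg s).exp).mul (hasDerivAt_pow (y + 1) s)).div_const
      ((y + 1).factorial : ℝ))
    refine (ih.add h1).congr_deriv ?_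
    rw [Nat.factorial_succ]
    have h2 : (y.factorial : ℝ) ≠ 0 := by positivity
    have h3 : ((y : ℝ) + 1) ≠ 0 := by positivity
    push_cast
    field_simp
    simp

lemma poissonCdf_anti {s s' : ℝ} (hs : 0 ≤ s) (h : s ≤ s') (y : ℕ) :
    poissonCdf s' y ≤ poissonCdf s y := by
  have hd : Differentiable ℝ fun s => poissonCdf s y :=
    fun s => (hasDerivAt_poissonCdf y s).differentiableAt
  refine antitoneOn_of_deriv_nonpos (convex_Ici 0) hd.continuous.continuousOn hd.differentiableOn
    (fun x hx => ?_) (Set.mem_Ici.2 hs) (Set.mem_Ici.2 (hs.trans h)) h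
  rw [interior_Ici, Set.mem_Ioi] at hx
  rw [(hasDerivAt_poissonCdf y x).deriv]
  have : 0 ≤ Real.exp (-x) * x ^ y / (y.factorial : ℝ) := by positivity
  linarith

lemma poissonQuantile_mono {s s' u : ℝ} (hs : 0 ≤ s) (h : s ≤ s') (hu : u < 1) :
    poissonQuantile s u ≤ poissonQuantile s' u :=
  (poissonQuantile_le_iff hs hu _).2
    (((poissonQuantile_le_iff (hs.trans h) hu _).1 le_rfl).trans (poissonCdf_anti hs h _))

lemma measurable_poissonQuantile_right (s : ℝ) : Measurable (poissonQuantile s) :=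
  measurable_poissonQuantile.comp (measurable_const.prodMk measurable_id)

lemma map_poissonQuantile {s : ℝ} (hs : 0 ≤ s) :
    unif.map (poissonQuantile s) = poissonMeasure s.toNNReal := by
  refine Measure.ext_of_Iic _ _ fun y => ?_
  rw [map_unif_Iic (measurable_poissonQuantile_right s) measurableSet_Iic (poissonCdf_le_one hs y) (fun u hu => poissonQuantile_le_iff hs hu.2 y)]
  have h1 : (Set.Iic y : Set ℕ) = ((Finset.range (y + 1) : Finset ℕ) : Set ℕ) := by
    ext k; simp
  rw [h1, ← MeasureTheory.sum_measure_singleton, poissonCdf,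
    ENNReal.ofReal_sum_of_nonneg (fun _ _ => by positivity)]
  refine Finset.sum_congr rfl fun j _ => ?_
  rw [poissonMeasure_singleton, Real.coe_toNNReal s hs]

lemma lintegral_poissonMeasure {s : ℝ} (hs : 0 ≤ s) :
    ∫⁻ n, (n : ENNReal) ∂(poissonMeasure s.toNNReal) = ENNReal.ofReal s := by
  rw [poissonMeasure, lintegral_sum_measure]
  simp only [lintegral_smul_measure, lintegral_dirac, Real.coe_toNNReal s hs, smul_eq_mul]
  rw [tsum_eq_zero_add' ENNReal.summable]
  simp only [Nat.cast_zero, mul_zero, zero_add]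
  have h : ∀ n : ℕ, ENNReal.ofReal (Real.exp (-s) * s ^ (n + 1) / ((n + 1).factorial : ℝ)) *
      ((n + 1 : ℕ) : ENNReal) =
      ENNReal.ofReal (Real.exp (-s) * s ^ n / (n.factorial : ℝ)) * ENNReal.ofReal s := fun n => by
    rw [← ENNReal.ofReal_natCast, ← ENNReal.ofReal_mul (by positivity),
      ← ENNReal.ofReal_mul (by positivity), Nat.factorial_succ]
    congr 1
    push_cast
    field_simp
    ring
  simp_rw [h]
  rw [ENNReal.tsum_mul_right, ← ENNReal.ofReal_tsum_of_nonneg (fun _ => by positivity)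
    (hasSum_poisson hs).summable, (hasSum_poisson hs).tsum_eq, ENNReal.ofReal_one, one_mul]

lemma lintegral_poissonQuantile {s : ℝ} (hs : 0 ≤ s) :
    ∫⁻ u, (poissonQuantile s u : ENNReal) ∂unif = ENNReal.ofReal s := by
  rw [← lintegral_poissonMeasure hs, ← map_poissonQuantile hs,
    lintegral_map (by fun_prop) (measurable_poissonQuantile_right s)]

end Poisson

/-! ### Conditional means and couplings of the transformed observations -/

/-- The transformed observation `ȳ` as a function of the latent vector and the uniform vector. -/
def transObs (ν : Measure ℝ) (s u : Fin 2 → ℝ) : Fin 2 → ℝ := transformed (observe ν s u)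

lemma transObs_zero (ν : Measure ℝ) {s : Fin 2 → ℝ} (hs : 0 ≤ s 0) (u : Fin 2 → ℝ) :
    transObs ν s u 0 = s 0 * quantile ν (u 0) ^ 2 := by
  simp [transObs, transformed, observe, mul_pow, Real.sq_sqrt hs]

lemma transObs_one (ν : Measure ℝ) (s u : Fin 2 → ℝ) :
    transObs ν s u 1 = (poissonQuantile (s 1) (u 1) : ℝ) := by
  simp [transObs, transformed, observe]

lemma transformed_nonneg (y : ℝ × ℕ) (i : Fin 2) : 0 ≤ transformed y i := by
  fin_cases i <;> simp [transformed]
  positivity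

lemma transObs_nonneg (ν : Measure ℝ) (s u : Fin 2 → ℝ) (i : Fin 2) : 0 ≤ transObs ν s u i :=
  transformed_nonneg _ i

lemma measurable_observe (ν : Measure ℝ) :
    Measurable fun p : (Fin 2 → ℝ) × (Fin 2 → ℝ) => observe ν p.1 p.2 := by
  refine Measurable.prodMk ?_ ?_
  · exact (by fun_prop : Measurable fun p : (Fin 2 → ℝ) × (Fin 2 → ℝ) => √(p.1 0)).mul
      ((measurable_quantile ν).comp (by fun_prop))
  · exact measurable_poissonQuantile.comp
      (by fun_prop : Measurable fun p : (Fin 2 → ℝ) × (Fin 2 → ℝ) => (p.1 1, p.2 1))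

lemma measurable_transformed : Measurable transformed := by
  refine measurable_pi_lambda _ fun i => ?_
  fin_cases i
  · simp only [transformed]
    exact measurable_fst.pow_const 2
  · exact (measurable_from_nat (f := fun n : ℕ => (n : ℝ))).comp measurable_snd

lemma measurable_transObs (ν : Measure ℝ) :
    Measurable fun p : (Fin 2 → ℝ) × (Fin 2 → ℝ) => transObs ν p.1 p.2 :=
  measurable_transformed.comp (measurable_observe ν)

section Coupling

variable {ν : Measure ℝ} {C : Measure (Fin 2 → ℝ)}

/-- The basis of the coupling: a shared uniform vector orders the observations as their latent
vectors are ordered. The exceptional null set does not depend on the latent vectors. -/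
lemma transObs_mono_ae (hC : IsCopula C) (i : Fin 2) :
    ∀ᵐ u ∂C, ∀ s s' : Fin 2 → ℝ, 0 ≤ s i → s i ≤ s' i → transObs ν s u i ≤ transObs ν s' u i := by
  have h : ∀ᵐ u ∂(C.map fun u => u i), u ∈ Set.Ioo (0 : ℝ) 1 := by
    rw [hC.2 i]; exact ae_unif_mem_Ioo
  filter_upwards [ae_of_ae_map (measurable_pi_apply i).aemeasurable h] with u hu s s' hs hss
  fin_cases i
  · simp only [Fin.zero_eta] at *
    rw [transObs_zero ν hs, transObs_zero ν (hs.trans hss)]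
    exact mul_le_mul_of_nonneg_right hss (sq_nonneg _)
  · simp only [Fin.mk_one] at *
    rw [transObs_one, transObs_one]
    exact_mod_cast poissonQuantile_mono hs hss hu.2

variable [IsProbabilityMeasure ν]

lemma lintegral_copula (hC : IsCopula C) (i : Fin 2) {F : ℝ → ENNReal} (hF : Measurable F) :
    ∫⁻ u, F (u i) ∂C = ∫⁻ u, F u ∂unif := by
  rw [unif, ← hC.2 i, lintegral_map hF (measurable_pi_apply i)]

lemma lintegral_sq_quantile (hν_var : ∫ e, e ^ 2 ∂ν = 1) :
    ∫⁻ u, ENNReal.ofReal (quantile ν u ^ 2) ∂unif = 1 := by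
  have h : ∫⁻ u, ENNReal.ofReal (quantile ν u ^ 2) ∂unif = ∫⁻ e, ENNReal.ofReal (e ^ 2) ∂ν := by
    conv_rhs => rw [← map_quantile ν]
    rw [lintegral_map (by fun_prop) (measurable_quantile ν)]
  have hint : Integrable (fun e : ℝ => e ^ 2) ν := by
    by_contra hcon
    rw [integral_undef hcon] at hν_var
    norm_num at hν_var
  rw [h, ← ofReal_integral_eq_lintegral_ofReal hint (Eventually.of_forall fun e => sq_nonneg e),
    hν_var, ENNReal.ofReal_one]

/-- The conditional mean of the transformed observation is the latent vector. -/
lemma lintegral_transObs (hC : IsCopula C) (hν_var : ∫ e, e ^ 2 ∂ν = 1) {s : Fin 2 → ℝ}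
    (hs : ∀ i, 0 ≤ s i) (i : Fin 2) :
    ∫⁻ u, ENNReal.ofReal (transObs ν s u i) ∂C = ENNReal.ofReal (s i) := by
  fin_cases i
  · simp only [Fin.zero_eta, transObs_zero ν (hs 0)]
    rw [lintegral_copula hC 0 (F := fun u => ENNReal.ofReal (s 0 * quantile ν u ^ 2))
      (((measurable_quantile ν).pow_const 2).const_mul _).ennreal_ofReal]
    simp_rw [ENNReal.ofReal_mul (hs 0)]
    rw [lintegral_const_mul _ ((measurable_quantile ν).pow_const 2).ennreal_ofReal,
      lintegral_sq_quantile hν_var, mul_one]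
  · simp only [Fin.mk_one, transObs_one, ENNReal.ofReal_natCast]
    rw [lintegral_copula hC 1 (F := fun u => (poissonQuantile (s 1) u : ENNReal))
      (by have := measurable_poissonQuantile_right (s 1); fun_prop),
      lintegral_poissonQuantile (hs 1)]

/-- The observations driven by the same uniform vector are monotonically coupled. -/
lemma lintegral_abs_transObs_sub (hC : IsCopula C) (hν_var : ∫ e, e ^ 2 ∂ν = 1)
    {s s' : Fin 2 → ℝ} (hs : ∀ i, 0 ≤ s i) (hs' : ∀ i, 0 ≤ s' i) (i : Fin 2) :
    ∫⁻ u, ENNReal.ofReal |transObs ν s u i - transObs ν s' u i| ∂C =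
      ENNReal.ofReal |s i - s' i| := by
  wlog hle : s' i ≤ s i generalizing s s'
  · have := this hs' hs (le_of_not_ge hle)
    simpa only [abs_sub_comm] using this
  have hm : ∀ s, Measurable fun u => transObs ν s u i := fun s =>
    (measurable_pi_apply i).comp ((measurable_transObs ν).comp (measurable_const.prodMk measurable_id))
  -- Since the coupled observations are ordered, the mean of their absolute difference is the
  -- difference of their means.
  have h1 : ∫⁻ u, ENNReal.ofReal (transObs ν s u i) ∂C =
      ∫⁻ u, ENNReal.ofReal |transObs ν s u i - transObs ν s' u i| ∂C +
        ∫⁻ u, ENNReal.ofReal (transObs ν s' u i) ∂C := by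
    rw [← lintegral_add_right _ (hm s').ennreal_ofReal]
    refine lintegral_congr_ae ?_
    filter_upwards [transObs_mono_ae (ν := ν) hC i] with u hu
    have := hu s' s (hs' i) hle
    rw [← ENNReal.ofReal_add (abs_nonneg _) (transObs_nonneg _ _ _ _),
      abs_of_nonneg (by linarith), sub_add_cancel]
  rw [lintegral_transObs hC hν_var hs, lintegral_transObs hC hν_var hs'] at h1
  rw [abs_of_nonneg (by linarith), ENNReal.ofReal_sub _ (hs' i), h1,
    ENNReal.add_sub_cancel_right ENNReal.ofReal_ne_top]

end Coupling

/-! ### Observations driven by a uniform vector independent of a sigma-field -/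

section Innovation

variable {Ω : Type*} {G : MeasurableSpace Ω} [mΩ : MeasurableSpace Ω] {P : Measure Ω}
  [IsProbabilityMeasure P] {V : Ω → Fin 2 → ℝ}

/-- Fubini's theorem for the product law of `(W, V)`: a variable known from `G` may be frozen while
the independent innovation is integrated out. -/
lemma lintegral_comp_indep (hV : Measurable V) (hG : G ≤ mΩ)
    (hind : Indep (MeasurableSpace.comap V inferInstance) G P) {β : Type*} [MeasurableSpace β]
    {W : Ω → β} (hW : Measurable[G] W) {F : β × (Fin 2 → ℝ) → ENNReal} (hF : Measurable F) :
    ∫⁻ ω, F (W ω, V ω) ∂P = ∫⁻ ω, ∫⁻ v, F (W ω, v) ∂(P.map V) ∂P := by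
  have hW' : Measurable W := hW.mono hG le_rfl
  have h1 : IndepFun W V P :=
    ((IndepFun_iff_Indep V W P).2 (indep_of_indep_of_le_right hind hW.comap_le)).symm
  have h2 := (indepFun_iff_map_prod_eq_prod_map_map hW'.aemeasurable hV.aemeasurable).1 h1
  have : IsProbabilityMeasure (P.map V) := Measure.isProbabilityMeasure_map hV.aemeasurable
  rw [← lintegral_map hF (hW'.prodMk hV), h2, lintegral_prod _ hF.aemeasurable,
    lintegral_map hF.lintegral_prod_right' hW']

variable {ν : Measure ℝ}

lemma lintegral_transObs_mul [IsProbabilityMeasure ν] (hV : Measurable V) (hG : G ≤ mΩ)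
    (hind : Indep (MeasurableSpace.comap V inferInstance) G P) (hC : IsCopula (P.map V))
    (hν_var : ∫ e, e ^ 2 ∂ν = 1) {W : Ω → Fin 2 → ℝ} (hW : Measurable[G] W)
    (hW0 : ∀ᵐ ω ∂P, ∀ i, 0 ≤ W ω i) {k : Ω → ENNReal} (hk : Measurable[G] k) (i : Fin 2) :
    ∫⁻ ω, ENNReal.ofReal (transObs ν (W ω) (V ω) i) * k ω ∂P =
      ∫⁻ ω, ENNReal.ofReal (W ω i) * k ω ∂P := by
  have hm := measurable_transObs ν
  have hF : Measurable fun p : ((Fin 2 → ℝ) × ENNReal) × (Fin 2 → ℝ) =>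
      ENNReal.ofReal (transObs ν p.1.1 p.2 i) * p.1.2 :=
    ((measurable_pi_apply i).comp
      (hm.comp (measurable_fst.fst.prodMk measurable_snd))).ennreal_ofReal.mul measurable_fst.snd
  rw [lintegral_comp_indep (F := fun p : ((Fin 2 → ℝ) × ENNReal) × (Fin 2 → ℝ) =>
    ENNReal.ofReal (transObs ν p.1.1 p.2 i) * p.1.2) hV hG hind (hW.prodMk hk) hF]
  refine lintegral_congr_ae ?_
  filter_upwards [hW0] with ω hω
  rw [lintegral_mul_const, lintegral_transObs hC hν_var hω]
  exact ((measurable_pi_apply i).comp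
    (hm.comp (measurable_const.prodMk measurable_id))).ennreal_ofReal

/-- Tower property: an observation may be replaced by its conditional mean. -/
lemma integral_transObs_mul [IsProbabilityMeasure ν] (hV : Measurable V) (hG : G ≤ mΩ)
    (hind : Indep (MeasurableSpace.comap V inferInstance) G P) (hC : IsCopula (P.map V))
    (hν_var : ∫ e, e ^ 2 ∂ν = 1) {W : Ω → Fin 2 → ℝ} (hW : Measurable[G] W)
    (hW0 : ∀ᵐ ω ∂P, ∀ i, 0 ≤ W ω i) {w : Ω → ℝ} (hw : Measurable[G] w) (i : Fin 2)
    (hint : Integrable (fun ω => W ω i * w ω) P) :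
    Integrable (fun ω => transObs ν (W ω) (V ω) i * w ω) P ∧
      ∫ ω, transObs ν (W ω) (V ω) i * w ω ∂P = ∫ ω, W ω i * w ω ∂P := by
  have hm : Measurable fun ω => transObs ν (W ω) (V ω) i :=
    (measurable_pi_apply i).comp ((measurable_transObs ν).comp ((hW.mono hG le_rfl).prodMk hV))
  have hkey := fun {k : Ω → ENNReal} (hk : Measurable[G] k) =>
    lintegral_transObs_mul hV hG hind hC hν_var hW hW0 hk i
  have hint' : Integrable (fun ω => transObs ν (W ω) (V ω) i * w ω) P := by
    refine ⟨(hm.mul (hw.mono hG le_rfl)).aestronglyMeasurable, ?_⟩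
    have h1 := hint.2
    rw [hasFiniteIntegral_iff_norm] at h1 ⊢
    have hk := hkey (k := fun ω => ENNReal.ofReal ‖w ω‖) (measurable_norm.ennreal_ofReal.comp hw)
    calc ∫⁻ ω, ENNReal.ofReal ‖transObs ν (W ω) (V ω) i * w ω‖ ∂P
        = ∫⁻ ω, ENNReal.ofReal (transObs ν (W ω) (V ω) i) * ENNReal.ofReal ‖w ω‖ ∂P := by
          refine lintegral_congr fun ω => ?_
          rw [norm_mul, ENNReal.ofReal_mul (norm_nonneg _),
            Real.norm_of_nonneg (transObs_nonneg ν _ _ i)]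
      _ = ∫⁻ ω, ENNReal.ofReal ‖W ω i * w ω‖ ∂P := by
          rw [hk]
          refine lintegral_congr_ae ?_
          filter_upwards [hW0] with ω hω
          rw [norm_mul, ENNReal.ofReal_mul (norm_nonneg _), Real.norm_of_nonneg (hω i)]
      _ < ⊤ := h1
  refine ⟨hint', ?_⟩
  -- The observation and its conditional mean are nonnegative, so the positive and negative parts of
  -- the products come from those of `w`, and the nonnegative tower property applies to each.
  rw [integral_eq_lintegral_pos_part_sub_lintegral_neg_part hint',
    integral_eq_lintegral_pos_part_sub_lintegral_neg_part hint]
  have hpos : ∀ w' : Ω → ℝ, Measurable[G] w' →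
      ∫⁻ ω, ENNReal.ofReal (transObs ν (W ω) (V ω) i * w' ω) ∂P =
        ∫⁻ ω, ENNReal.ofReal (W ω i * w' ω) ∂P := fun w' hw' => by
    have hk := hkey (k := fun ω => ENNReal.ofReal (w' ω)) (ENNReal.measurable_ofReal.comp hw')
    calc _ = ∫⁻ ω, ENNReal.ofReal (transObs ν (W ω) (V ω) i) * ENNReal.ofReal (w' ω) ∂P :=
          lintegral_congr fun ω => ENNReal.ofReal_mul (transObs_nonneg ν _ _ i)
      _ = _ := by
          rw [hk]
          refine lintegral_congr_ae ?_
          filter_upwards [hW0] with ω hω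
          rw [ENNReal.ofReal_mul (hω i)]
  have hneg := hpos (fun ω => -w ω) (measurable_neg.comp hw)
  simp only [mul_neg] at hneg
  rw [hpos w hw, hneg]

/-- Observations driven by the same innovation contract to the distance of the latent vectors. -/
lemma lintegral_abs_transObs_sub_comp [IsProbabilityMeasure ν] (hV : Measurable V) (hG : G ≤ mΩ)
    (hind : Indep (MeasurableSpace.comap V inferInstance) G P) (hC : IsCopula (P.map V))
    (hν_var : ∫ e, e ^ 2 ∂ν = 1) {W W' : Ω → Fin 2 → ℝ} (hW : Measurable[G] W)
    (hW' : Measurable[G] W') (hW0 : ∀ᵐ ω ∂P, ∀ i, 0 ≤ W ω i) (hW0' : ∀ᵐ ω ∂P, ∀ i, 0 ≤ W' ω i)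
    (i : Fin 2) :
    ∫⁻ ω, ENNReal.ofReal |transObs ν (W ω) (V ω) i - transObs ν (W' ω) (V ω) i| ∂P =
      ∫⁻ ω, ENNReal.ofReal |W ω i - W' ω i| ∂P := by
  have hm := measurable_transObs ν
  have hF : Measurable fun p : ((Fin 2 → ℝ) × (Fin 2 → ℝ)) × (Fin 2 → ℝ) =>
      ENNReal.ofReal |transObs ν p.1.1 p.2 i - transObs ν p.1.2 p.2 i| := by
    have h1 : Measurable fun p : ((Fin 2 → ℝ) × (Fin 2 → ℝ)) × (Fin 2 → ℝ) =>
        transObs ν p.1.1 p.2 i :=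
      (measurable_pi_apply i).comp (hm.comp (measurable_fst.fst.prodMk measurable_snd))
    have h2 : Measurable fun p : ((Fin 2 → ℝ) × (Fin 2 → ℝ)) × (Fin 2 → ℝ) =>
        transObs ν p.1.2 p.2 i :=
      (measurable_pi_apply i).comp (hm.comp (measurable_fst.snd.prodMk measurable_snd))
    exact (h1.sub h2).abs.ennreal_ofReal
  rw [lintegral_comp_indep (F := fun p : ((Fin 2 → ℝ) × (Fin 2 → ℝ)) × (Fin 2 → ℝ) =>
    ENNReal.ofReal |transObs ν p.1.1 p.2 i - transObs ν p.1.2 p.2 i|) hV hG hind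
    (hW.prodMk hW') hF]
  refine lintegral_congr_ae ?_
  filter_upwards [hW0, hW0'] with ω h h'
  exact lintegral_abs_transObs_sub hC hν_var h h' i

/-! ### Non-degeneracy of the innovations -/

/-- The quantile transform has the Poisson law; if it were almost surely `κ`, the closed set `{κ}`
would contain the support. -/
lemma not_ae_poissonQuantile_const {s : ℝ} (hs : 0 ≤ s)
    (h : ¬ ∃ a : ℝ, ∀ y ∈ (marginal ν 1 s).support, g 1 y = a)
    (κ : ℝ) : ¬ ∀ᵐ u ∂unif, (poissonQuantile s u : ℝ) = κ := fun hae => by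
  refine h ⟨κ, ?_⟩
  have hmem : ∀ᵐ y ∂(marginal ν 1 s), y = κ := by
    have h1 : marginal ν 1 s = unif.map fun u => (poissonQuantile s u : ℝ) := by
      simp only [marginal]
      rw [← map_poissonQuantile hs, Measure.map_map measurable_from_nat
        (measurable_poissonQuantile_right s)]
      rfl
    rw [h1]
    exact (ae_map_iff (measurable_from_nat.comp
      (measurable_poissonQuantile_right s)).aemeasurable
      (measurableSet_eq_fun measurable_id measurable_const)).2 hae
  exact fun y hy => Measure.support_subset_of_isClosed
    (isClosed_eq continuous_id continuous_const) hmem hy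

variable [IsProbabilityMeasure ν]

/-- Scale one suffices, because the latent value enters the first transformed observation as a
multiplicative factor. -/
lemma not_ae_sq_quantile_const (h : ¬ ∃ a : ℝ, ∀ y ∈ (marginal ν 0 1).support, g 0 y = a)
    (κ : ℝ) : ¬ ∀ᵐ u ∂unif, quantile ν u ^ 2 = κ := fun hae => by
  refine h ⟨κ, ?_⟩
  have hmem : ∀ᵐ y ∂(marginal ν 0 1), y ^ 2 = κ := by
    have h1 : marginal ν 0 1 = ν := by simp [marginal]
    rw [h1, ← map_quantile ν]
    exact (ae_map_iff (measurable_quantile ν).aemeasurable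
      (measurableSet_eq_fun (by fun_prop) measurable_const)).2 hae
  exact fun y hy => Measure.support_subset_of_isClosed
    (isClosed_eq (by fun_prop : Continuous fun y : ℝ => y ^ 2) continuous_const) hmem hy

/-- A law with positive density on the open unit square charges every set of positive
Lebesgue measure of the square. -/
lemma ae_unif_ae_unif_of_density {C : Measure (Fin 2 → ℝ)} {c : (Fin 2 → ℝ) → ℝ}
    (hc : Measurable c) (hpos : ∀ u : Fin 2 → ℝ, (∀ i, u i ∈ Set.Ioo (0 : ℝ) 1) → 0 < c u)
    (hC : C = (volume.restrict (Set.Icc (0 : Fin 2 → ℝ) 1)).withDensity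
      (fun u => ENNReal.ofReal (c u))) {p : (Fin 2 → ℝ) → Prop} (hp : ∀ᵐ u ∂C, p u) :
    ∀ᵐ a ∂unif, ∀ᵐ b ∂unif, p ![a, b] := by
  rw [hC, ae_withDensity_iff hc.ennreal_ofReal, ae_restrict_iff' measurableSet_Icc] at hp
  have h1 := (volume_preserving_finTwoArrow ℝ).symm.quasiMeasurePreserving.ae hp
  have h2 := Measure.ae_ae_of_ae_prod h1
  have h3 : ∀ᵐ a ∂unif, ∀ᵐ b, _ := ae_restrict_of_ae h2
  filter_upwards [h3, ae_unif_mem_Ioo] with a ha hau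
  filter_upwards [(ae_restrict_of_ae ha : ∀ᵐ b ∂unif, _), ae_unif_mem_Ioo] with b hb hbu
  have hmem : ∀ i, (![a, b] : Fin 2 → ℝ) i ∈ Set.Ioo (0 : ℝ) 1 := by
    intro i
    fin_cases i
    · exact hau
    · exact hbu
  refine hb ⟨fun i => (hmem i).1.le, fun i => (hmem i).2.le⟩ ?_
  exact (ENNReal.ofReal_pos.2 (hpos _ hmem)).ne'

/-- A linear combination of the observations that is determined by a sigma-field independent of
the innovation is trivial. -/
theorem matrix_eq_zero_of_mulVec_transObs (hV : Measurable V) (hG : G ≤ mΩ)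
    (hind : Indep (MeasurableSpace.comap V inferInstance) G P) (hI2 : I2 ν (P.map V))
    {W Z : Ω → Fin 2 → ℝ} (hW : Measurable[G] W) (hZ : Measurable[G] Z)
    (hW0 : ∀ᵐ ω ∂P, ∀ i, 0 < W ω i) {M : Matrix (Fin 2) (Fin 2) ℝ}
    (hM : ∀ᵐ ω ∂P, M.mulVec (transObs ν (W ω) (V ω)) = Z ω) : M = 0 := by
  obtain ⟨hnc, c, hc, hcpos, hC⟩ := hI2
  have hm := measurable_transObs ν
  set A : Set (((Fin 2 → ℝ) × (Fin 2 → ℝ)) × (Fin 2 → ℝ)) :=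
    {p | M.mulVec (transObs ν p.1.1 p.2) = p.1.2}ᶜ with hA
  have hAm : MeasurableSet A := by
    refine (measurableSet_eq_fun ?_ measurable_fst.snd).compl
    exact (by fun_prop : Continuous fun v : Fin 2 → ℝ => M.mulVec v).measurable.comp
      (hm.comp (measurable_fst.fst.prodMk measurable_snd))
  have h0 := lintegral_comp_indep hV hG hind (hW.prodMk hZ)
    (F := A.indicator fun _ => 1) (measurable_const.indicator hAm)
  have hz : ∫⁻ ω, (A.indicator fun _ => (1 : ENNReal)) ((W ω, Z ω), V ω) ∂P = 0 := by
    rw [lintegral_eq_zero_iff (f := fun ω => (A.indicator fun _ => (1 : ENNReal)) ((W ω, Z ω), V ω))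
      ((measurable_const.indicator hAm).comp
      (((hW.prodMk hZ).mono hG le_rfl).prodMk hV))]
    filter_upwards [hM] with ω hω
    exact Set.indicator_of_notMem (fun h : ((W ω, Z ω), V ω) ∈ A => h hω) _
  rw [hz] at h0
  have : IsProbabilityMeasure (P.map V) := Measure.isProbabilityMeasure_map hV.aemeasurable
  have hlm : Measurable fun ω => ∫⁻ v, (A.indicator fun _ => (1 : ENNReal)) ((W ω, Z ω), v)
      ∂(P.map V) :=
    ((measurable_const.indicator hAm).lintegral_prod_right').comp ((hW.prodMk hZ).mono hG le_rfl)
  have h1 := (lintegral_eq_zero_iff hlm).1 h0.symm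
  -- A single typical `ω` is enough: with `W` and `Z` frozen there, the relation holds for almost
  -- every noise vector under the copula, hence for almost every pair under the product of uniform
  -- laws.
  obtain ⟨ω, hω, hpos⟩ := (h1.and hW0).exists
  have hsec : Measurable fun v => (A.indicator fun _ => (1 : ENNReal)) ((W ω, Z ω), v) :=
    (measurable_const.indicator hAm).comp (measurable_const.prodMk measurable_id)
  have h2 := (lintegral_eq_zero_iff hsec).1 hω
  have h3 : ∀ᵐ v ∂(P.map V), M.mulVec (transObs ν (W ω) v) = Z ω := by
    filter_upwards [h2] with v hv
    by_contra hne
    have hmem : ((W ω, Z ω), v) ∈ A := hne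
    rw [Set.indicator_of_mem hmem] at hv
    exact one_ne_zero hv
  have h4 := ae_unif_ae_unif_of_density hc hcpos hC h3
  have heq : ∀ i, ∀ᵐ a ∂unif, ∀ᵐ b ∂unif, M i 0 * (W ω 0 * quantile ν a ^ 2) +
      M i 1 * (poissonQuantile (W ω 1) b : ℝ) = Z ω i := fun i => by
    filter_upwards [h4] with a ha
    filter_upwards [ha] with b hb
    have := congrFun hb i
    simpa [Matrix.mulVec, dotProduct, Fin.sum_univ_two, transObs_zero ν (hpos 0).le,
      transObs_one] using this
  -- With the first noise coordinate fixed, a nonzero entry would make the Poisson quantile almost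
  -- surely constant. Once this column vanishes, the same reasoning in the first coordinate disposes
  -- of the other.
  have hcol1 : ∀ i, M i 1 = 0 := fun i => by
    by_contra hne
    obtain ⟨a, ha⟩ := (heq i).exists
    refine not_ae_poissonQuantile_const (hpos 1).le (hnc 1 _ (hpos 1))
      ((Z ω i - M i 0 * (W ω 0 * quantile ν a ^ 2)) / M i 1) ?_
    filter_upwards [ha] with b hb
    rw [eq_div_iff hne]
    linarith
  have hcol0 : ∀ i, M i 0 = 0 := fun i => by
    by_contra hne
    refine not_ae_sq_quantile_const (hnc 0 1 one_pos) (Z ω i / (M i 0 * W ω 0)) ?_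
    filter_upwards [heq i] with a ha
    obtain ⟨b, hb⟩ := ha.exists
    rw [hcol1, zero_mul, add_zero] at hb
    rw [eq_div_iff (mul_ne_zero hne (hpos 0).ne')]
    linarith
  ext i j
  fin_cases j
  · exact hcol0 i
  · exact hcol1 i

end Innovation

/-! ### The path space -/

/-- Shift of a bi-infinite sequence by `k`. -/
def shiftBy {E : Type*} (k : ℤ) (x : ℤ → E) : ℤ → E := fun t => x (t + k)

section Shift

variable {E : Type*}

@[simp] lemma shiftBy_apply (k : ℤ) (x : ℤ → E) (t : ℤ) : shiftBy k x t = x (t + k) := rfl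

@[simp] lemma shiftBy_shiftBy (k l : ℤ) (x : ℤ → E) :
    shiftBy k (shiftBy l x) = shiftBy (k + l) x := by
  funext t
  simp [add_assoc]

@[simp] lemma shiftBy_zero (x : ℤ → E) : shiftBy 0 x = x := by
  funext t
  simp

lemma iterate_shift (n : ℕ) (x : ℤ → E) : shift^[n] x = shiftBy n x := by
  induction n generalizing x with
  | zero => simp
  | succ n ih =>
    rw [Function.iterate_succ_apply, ih]
    funext t
    simp [shift, add_assoc]

variable [MeasurableSpace E]

lemma measurable_shiftBy (k : ℤ) : Measurable (shiftBy (E := E) k) :=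
  measurable_pi_lambda _ fun t => measurable_pi_apply (t + k)

lemma measurePreserving_shiftBy {μ : Measure (ℤ → E)} (h : MeasurePreserving shift μ μ) (k : ℤ) :
    MeasurePreserving (shiftBy k) μ μ := by
  have hnat : ∀ n : ℕ, MeasurePreserving (shiftBy (n : ℤ)) μ μ := fun n => by
    have := h.iterate n
    rwa [show shift^[n] = shiftBy (E := E) (n : ℤ) from funext (iterate_shift n)] at this
  have hneg : ∀ n : ℕ, MeasurePreserving (shiftBy (-(n : ℤ))) μ μ := fun n => by
    refine ⟨measurable_shiftBy _, ?_⟩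
    conv_lhs => rw [← (hnat n).map_eq]
    rw [Measure.map_map (measurable_shiftBy _) (measurable_shiftBy _)]
    have : shiftBy (E := E) (-(n : ℤ)) ∘ shiftBy (n : ℤ) = id := by
      funext x
      simp
    rw [this, Measure.map_id]
  obtain ⟨n, rfl | rfl⟩ := k.eq_nat_or_neg
  · exact hnat n
  · exact hneg n

lemma ae_shiftBy {μ : Measure (ℤ → E)} (h : MeasurePreserving shift μ μ) {p : (ℤ → E) → Prop}
    (hp : ∀ᵐ x ∂μ, p x) : ∀ᵐ x ∂μ, ∀ t : ℤ, p (shiftBy t x) :=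
  ae_all_iff.2 fun t => (measurePreserving_shiftBy h t).quasiMeasurePreserving.ae hp

lemma IsStationary.map_eq {Ω : Type*} [MeasurableSpace Ω] {P : Measure Ω} {Z : ℤ → Ω → E}
    (h : IsStationary P Z) (hZ : ∀ t, Measurable (Z t)) (t : ℤ) : P.map (Z t) = P.map (Z 0) := by
  have hψ : Measurable fun ω t => Z t ω := measurable_pi_lambda _ hZ
  have key : ∀ s : ℤ, P.map (Z s) = (processLaw P Z).map (fun x => x s) := fun s => by
    rw [processLaw, Measure.map_map (measurable_pi_apply s) hψ]
    rfl
  rw [key t, key 0]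
  conv_rhs => rw [← (measurePreserving_shiftBy h t).map_eq]
  rw [Measure.map_map (measurable_pi_apply 0) (measurable_shiftBy t)]
  congr 1
  funext x
  simp

end Shift

/-- Bi-infinite paths of noise and covariates. -/
abbrev Path (m : ℕ) : Type := ℤ → (Fin 2 → ℝ) × (Fin m → ℝ)

section PathSpace

variable {m : ℕ}

/-- The noise coordinate at time `t`. -/
def noise (t : ℤ) (z : Path m) : Fin 2 → ℝ := (z t).1

/-- The covariate coordinate at time `t`. -/
def covar (t : ℤ) (z : Path m) : Fin m → ℝ := (z t).2

/-- The sigma-field of the path space generated by the coordinates up to time `t`. -/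
@[reducible] def pathPast (m : ℕ) (t : ℤ) : MeasurableSpace (Path m) := past noise covar t

@[simp] lemma noise_shiftBy (t k : ℤ) (z : Path m) : noise t (shiftBy k z) = noise (t + k) z := rfl

@[simp] lemma covar_shiftBy (t k : ℤ) (z : Path m) : covar t (shiftBy k z) = covar (t + k) z := rfl

lemma measurable_noise (t : ℤ) : Measurable (noise (m := m) t) := (measurable_pi_apply t).fst

lemma measurable_covar (t : ℤ) : Measurable (covar (m := m) t) := (measurable_pi_apply t).snd

lemma past_le {Ω : Type*} [mΩ : MeasurableSpace Ω] {U : ℤ → Ω → Fin 2 → ℝ}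
    {X : ℤ → Ω → Fin m → ℝ} (hU : ∀ t, Measurable (U t)) (hX : ∀ t, Measurable (X t)) (t : ℤ) :
    past U X t ≤ mΩ :=
  iSup_le fun s => ((hU s).prodMk (hX s)).comap_le

lemma pathPast_le (t : ℤ) : pathPast m t ≤ MeasurableSpace.pi :=
  past_le measurable_noise measurable_covar t

lemma past_mono {Ω : Type*} {U : ℤ → Ω → Fin 2 → ℝ} {X : ℤ → Ω → Fin m → ℝ} {s t : ℤ}
    (h : s ≤ t) : past U X s ≤ past U X t :=
  iSup_le fun r => le_iSup_of_le ⟨r.1, r.2.trans h⟩ le_rfl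

lemma measurable_past_pair {Ω : Type*} {U : ℤ → Ω → Fin 2 → ℝ} {X : ℤ → Ω → Fin m → ℝ} {s t : ℤ}
    (h : s ≤ t) : Measurable[past U X t] fun ω => (U s ω, X s ω) := by
  rw [measurable_iff_comap_le]
  exact le_iSup (fun s : {s : ℤ // s ≤ t} =>
    MeasurableSpace.comap (fun ω => (U s ω, X s ω)) inferInstance) ⟨s, h⟩

lemma measurable_noise_past {s t : ℤ} (h : s ≤ t) : Measurable[pathPast m t] (noise s) :=
  measurable_fst.comp (measurable_past_pair h)

lemma measurable_covar_past {s t : ℤ} (h : s ≤ t) : Measurable[pathPast m t] (covar s) :=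
  measurable_snd.comp (measurable_past_pair h)

lemma measurable_comp_shiftBy_past {β : Type*} [MeasurableSpace β] {f : Path m → β} {t : ℤ}
    (hf : Measurable[pathPast m t] f) (k : ℤ) :
    Measurable[pathPast m (t + k)] fun z => f (shiftBy k z) := by
  have h : Measurable[pathPast m (t + k), pathPast m t] (shiftBy k) := by
    rw [measurable_iff_comap_le, MeasurableSpace.comap_iSup]
    refine iSup_le fun s => ?_
    rw [MeasurableSpace.comap_comp, ← measurable_iff_comap_le]
    exact measurable_past_pair (by have := s.2; omega)
  exact hf.comp h

/-- This is what allows adapted variables on `Ω` to be written as functions of the path with the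
same time horizon. -/
lemma past_eq_comap {Ω : Type*} (U : ℤ → Ω → Fin 2 → ℝ) (X : ℤ → Ω → Fin m → ℝ) (t : ℤ) :
    past U X t = (pathPast m t).comap fun ω t => (U t ω, X t ω) := by
  rw [MeasurableSpace.comap_iSup]
  refine iSup_congr fun s => ?_
  rw [MeasurableSpace.comap_comp]
  rfl

/-! ### Solutions of the recursion on the path space -/

/-- A predictable, integrable solution of the latent recursion on the path space. -/
structure IsPathSolution (μ : Measure (Path m)) (ν : Measure ℝ) (θ : Param m)
    (h : ℤ → Path m → Fin 2 → ℝ) : Prop where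
  meas : ∀ t, Measurable[pathPast m (t - 1)] (h t)
  integrable : ∀ t i, Integrable (fun z => h t z i) μ
  bound : ∃ K, ∀ t i, ∫ z, |h t z i| ∂μ ≤ K
  recursion : ∀ t, ∀ᵐ z ∂μ, h t z = latentStep θ (h (t - 1) z)
    (observe ν (h (t - 1) z) (noise (t - 1) z)) (covar (t - 1) z)

lemma latentStep_apply (θ : Param m) (s : Fin 2 → ℝ) (y : ℝ × ℕ) (x : Fin m → ℝ) (i : Fin 2) :
    latentStep θ s y x i =
      θ.d i + θ.B.mulVec s i + θ.A.mulVec (transformed y) i + θ.Γ.mulVec x i := rfl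

lemma mulVec_nonneg' {k : ℕ} {M : Matrix (Fin 2) (Fin k) ℝ} (hM : ∀ i j, 0 ≤ M i j)
    {v : Fin k → ℝ} (hv : ∀ j, 0 ≤ v j) (i : Fin 2) : 0 ≤ M.mulVec v i := by
  simp only [Matrix.mulVec, dotProduct]
  exact Finset.sum_nonneg fun j _ => mul_nonneg (hM i j) (hv j)

/-- Integrable solutions are bounded below by the intercept. -/
lemma IsPathSolution.ge {μ : Measure (Path m)} [IsProbabilityMeasure μ] {ν : Measure ℝ}
    {θ : Param m} {h : ℤ → Path m → Fin 2 → ℝ} (hh : IsPathSolution μ ν θ h)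
    (hA : ∀ i j, 0 ≤ θ.A i j) (hB : ∀ i j, 0 ≤ θ.B i j) (hρ : specRad θ.B < 1) {dmin : ℝ}
    (hdmin : 0 < dmin) (hd : ∀ i, dmin ≤ θ.d i)
    (hΓ : ∀ t, ∀ᵐ z ∂μ, ∀ i, 0 ≤ θ.Γ.mulVec (covar t z) i) (t : ℤ) :
    ∀ᵐ z ∂μ, ∀ i, dmin ≤ h t z i := by
  have hint : ∀ t i, Integrable (fun z => max (-h t z i) 0) μ := fun t i =>
    (hh.integrable t i).neg.pos_part
  obtain ⟨K, hK⟩ := hh.bound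
  have hlow : ∀ t, ∀ᵐ z ∂μ, ∀ i, dmin + θ.B.mulVec (h (t - 1) z) i ≤ h t z i := fun t => by
    filter_upwards [hh.recursion t, hΓ (t - 1)] with z hz hz' i
    rw [hz, latentStep_apply]
    have h1 := mulVec_nonneg' hA (transformed_nonneg (observe ν (h (t - 1) z) (noise (t - 1) z))) i
    linarith [hd i, hz' i]
  -- The means of the negative parts are dominated by `B` applied to their predecessors, since the
  -- rest of the recursion is nonnegative. Being bounded, they vanish; nonnegativity and one more
  -- use of the recursion then give the lower bound by the intercept.
  have hzero := eq_zero_of_le_mulVec_pred (K := K) hB hρ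
    (e := fun t i => ∫ z, max (-h t z i) 0 ∂μ)
    (fun t i => integral_nonneg fun z => le_max_right _ _)
    (fun t i => (integral_mono (hint t i) (hh.integrable t i).abs fun z =>
      max_le (neg_le_abs _) (abs_nonneg _)).trans (hK t i))
    (fun t i => by
      simp only [Matrix.mulVec, dotProduct]
      simp_rw [← integral_const_mul]
      rw [← integral_finsetSum _ fun j _ => (hint (t - 1) j).const_mul _]
      refine integral_mono_ae (hint t i)
        (integrable_finsetSum _ fun j _ => (hint (t - 1) j).const_mul _) ?_
      filter_upwards [hlow t] with z hz
      refine max_le ?_ (Finset.sum_nonneg fun j _ => mul_nonneg (hB i j) (le_max_right _ _))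
      have h1 : -∑ j, θ.B i j * max (-h (t - 1) z j) 0 ≤ θ.B.mulVec (h (t - 1) z) i := by
        simp only [Matrix.mulVec, dotProduct]
        rw [← Finset.sum_neg_distrib]
        refine Finset.sum_le_sum fun j _ => ?_
        rw [← mul_neg]
        exact mul_le_mul_of_nonneg_left (by linarith [le_max_left (-h (t - 1) z j) 0]) (hB i j)
      linarith [hz i])
  have hnn : ∀ t, ∀ᵐ z ∂μ, ∀ i, 0 ≤ h t z i := fun t => ae_all_iff.2 fun i => by
    have := (integral_eq_zero_iff_of_nonneg (fun z => le_max_right _ _) (hint t i)).1 (hzero t i)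
    filter_upwards [this] with z hz
    have h1 : max (-h t z i) 0 = 0 := hz
    linarith [le_max_left (-h t z i) 0]
  filter_upwards [hlow t, hnn (t - 1)] with z hz hz' i
  linarith [hz i, mulVec_nonneg' hB hz' i]

/-- Predictable integrable solutions driven by the same noise and covariates coincide. -/
lemma IsPathSolution.unique {μ : Measure (Path m)} [IsProbabilityMeasure μ] {ν : Measure ℝ}
    [IsProbabilityMeasure ν] {θ : Param m} {h h' : ℤ → Path m → Fin 2 → ℝ}
    (hh : IsPathSolution μ ν θ h) (hh' : IsPathSolution μ ν θ h')
    (hnn : ∀ t, ∀ᵐ z ∂μ, ∀ i, 0 ≤ h t z i) (hnn' : ∀ t, ∀ᵐ z ∂μ, ∀ i, 0 ≤ h' t z i)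
    (hA : ∀ i j, 0 ≤ θ.A i j) (hB : ∀ i j, 0 ≤ θ.B i j) (hρ : specRad (θ.A + θ.B) < 1)
    (hind : ∀ t, Indep (MeasurableSpace.comap (noise t) inferInstance) (pathPast m (t - 1)) μ)
    (hC : ∀ t, IsCopula (μ.map (noise t))) (hν_var : ∫ e, e ^ 2 ∂ν = 1) (t : ℤ) :
    h t =ᵐ[μ] h' t := by
  obtain ⟨K, hK⟩ := hh.bound
  obtain ⟨K', hK'⟩ := hh'.bound
  have hint : ∀ t i, Integrable (fun z => |h t z i - h' t z i|) μ := fun t i =>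
    ((hh.integrable t i).sub (hh'.integrable t i)).abs
  have hmeas : ∀ t j, Measurable fun z => transObs ν (h t z) (noise t z) j := fun t j =>
    (measurable_pi_apply j).comp ((measurable_transObs ν).comp
      (((hh.meas t).mono (pathPast_le _) le_rfl).prodMk (measurable_noise t)))
  have hmeas' : ∀ t j, Measurable fun z => transObs ν (h' t z) (noise t z) j := fun t j =>
    (measurable_pi_apply j).comp ((measurable_transObs ν).comp
      (((hh'.meas t).mono (pathPast_le _) le_rfl).prodMk (measurable_noise t)))
  have htr := fun t j => lintegral_abs_transObs_sub_comp (measurable_noise t)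
    (pathPast_le (t - 1)) (hind t) (hC t) hν_var (hh.meas t) (hh'.meas t) (hnn t) (hnn' t) j
  have hintT : ∀ t j, Integrable
      (fun z => |transObs ν (h t z) (noise t z) j - transObs ν (h' t z) (noise t z) j|) μ :=
    fun t j => by
      refine ⟨((hmeas t j).sub (hmeas' t j)).abs.aestronglyMeasurable, ?_⟩
      rw [hasFiniteIntegral_iff_ofReal (Eventually.of_forall fun z => abs_nonneg _), htr t j]
      exact (hasFiniteIntegral_iff_ofReal (Eventually.of_forall fun z => abs_nonneg _)).1
        (hint t j).2
  have hTeq : ∀ t j, ∫ z, |transObs ν (h t z) (noise t z) j - transObs ν (h' t z) (noise t z) j| ∂μ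
      = ∫ z, |h t z j - h' t z j| ∂μ := fun t j => by
    rw [integral_eq_lintegral_of_nonneg_ae (Eventually.of_forall fun z => abs_nonneg _)
      (hintT t j).1, integral_eq_lintegral_of_nonneg_ae (Eventually.of_forall fun z => abs_nonneg _)
      (hint t j).1, htr t j]
  -- The intercept and covariate terms cancel, and by the coupling the observation term contracts as
  -- the latent term does, so the mean distances are driven by `A + B`.
  have hzero := eq_zero_of_le_mulVec_pred (M := θ.A + θ.B) (K := K + K')
    (fun i j => add_nonneg (hA i j) (hB i j)) hρ
    (e := fun t i => ∫ z, |h t z i - h' t z i| ∂μ)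
    (fun t i => integral_nonneg fun z => abs_nonneg _)
    (fun t i => by
      refine (integral_mono (hint t i) ((hh.integrable t i).abs.add (hh'.integrable t i).abs)
        fun z => abs_sub _ _).trans ?_
      have := integral_add (hh.integrable t i).abs (hh'.integrable t i).abs
      simp only [Pi.add_apply] at this ⊢
      rw [this]
      exact add_le_add (hK t i) (hK' t i))
    (fun t i => by
      simp only [Matrix.mulVec, dotProduct, Matrix.add_apply, add_mul]
      have hsum : ∀ j : Fin 2, Integrable (fun z =>
          θ.A i j * |transObs ν (h (t - 1) z) (noise (t - 1) z) j -
            transObs ν (h' (t - 1) z) (noise (t - 1) z) j| +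
            θ.B i j * |h (t - 1) z j - h' (t - 1) z j|) μ := fun j =>
        ((hintT (t - 1) j).const_mul _).add ((hint (t - 1) j).const_mul _)
      have e1 : ∑ j, (θ.A i j * ∫ z, |h (t - 1) z j - h' (t - 1) z j| ∂μ +
          θ.B i j * ∫ z, |h (t - 1) z j - h' (t - 1) z j| ∂μ) =
          ∫ z, ∑ j, (θ.A i j * |transObs ν (h (t - 1) z) (noise (t - 1) z) j -
            transObs ν (h' (t - 1) z) (noise (t - 1) z) j| +
            θ.B i j * |h (t - 1) z j - h' (t - 1) z j|) ∂μ := by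
        rw [integral_finsetSum _ fun j _ => hsum j]
        refine Finset.sum_congr rfl fun j _ => ?_
        rw [integral_add ((hintT (t - 1) j).const_mul _) ((hint (t - 1) j).const_mul _),
          integral_const_mul, integral_const_mul, hTeq]
      rw [e1]
      refine integral_mono_ae (hint t i) (integrable_finsetSum _ fun j _ => hsum j) ?_
      filter_upwards [hh.recursion t, hh'.recursion t] with z hz hz'
      rw [hz, hz', latentStep_apply, latentStep_apply]
      simp only [Matrix.mulVec, dotProduct]
      have e2 : ∀ a b c d b' c' : ℝ, a + b + c + d - (a + b' + c' + d) = (c - c') + (b - b') := by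
        intros; ring
      rw [e2, ← Finset.sum_sub_distrib, ← Finset.sum_sub_distrib, ← Finset.sum_add_distrib]
      refine (Finset.abs_sum_le_sum_abs _ _).trans (Finset.sum_le_sum fun j _ => ?_)
      refine (abs_add_le _ _).trans (add_le_add ?_ ?_)
      · rw [← mul_sub, abs_mul, abs_of_nonneg (hA i j)]
        rfl
      · rw [← mul_sub, abs_mul, abs_of_nonneg (hB i j)])
  have hall : ∀ᵐ z ∂μ, ∀ i, h t z i = h' t z i := ae_all_iff.2 fun i => by
    have := (integral_eq_zero_iff_of_nonneg (fun z => abs_nonneg _) (hint t i)).1 (hzero t i)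
    filter_upwards [this] with z hz
    exact sub_eq_zero.1 (abs_eq_zero.1 hz)
  filter_upwards [hall] with z hz
  exact funext hz

/-- Shifting a solution by one step gives a solution. -/
lemma IsPathSolution.shift {μ : Measure (Path m)} {ν : Measure ℝ} {θ : Param m}
    {h : ℤ → Path m → Fin 2 → ℝ} (hh : IsPathSolution μ ν θ h)
    (hμ : MeasurePreserving Gain.shift μ μ) :
    IsPathSolution μ ν θ fun t z => h (t + 1) (shiftBy (-1) z) := by
  have hmp := measurePreserving_shiftBy hμ (-1)
  refine ⟨fun t => ?_, fun t i => ?_, ?_, fun t => ?_⟩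
  · have := measurable_comp_shiftBy_past (hh.meas (t + 1)) (-1)
    rwa [show t + 1 - 1 + -1 = t - 1 by ring] at this
  · exact hmp.integrable_comp_of_integrable (hh.integrable (t + 1) i)
  · obtain ⟨K, hK⟩ := hh.bound
    refine ⟨K, fun t i => ?_⟩
    have h1 : ∫ z, |h (t + 1) z i| ∂(μ.map (shiftBy (-1))) =
        ∫ z, |h (t + 1) (shiftBy (-1) z) i| ∂μ :=
      integral_map hmp.measurable.aemeasurable (by
        rw [hmp.map_eq]; exact (hh.integrable (t + 1) i).abs.1)
    rw [← h1, hmp.map_eq]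
    exact hK _ i
  · filter_upwards [hmp.quasiMeasurePreserving.ae (hh.recursion (t + 1))] with z hz
    rw [hz]
    simp only [noise_shiftBy, covar_shiftBy]
    rw [show t + 1 - 1 = t - 1 + 1 by ring, show t - 1 + 1 + -1 = t - 1 by ring]

end PathSpace

/-! ### The model as a stationary functional of the noise and covariate path. -/

section Representation

variable {m : ℕ}

/-- The model on the path space: the latent vector at time `t` is `f (shiftBy t z)`, where `f` is
a function of the coordinates at negative times. -/
structure StationaryModel (μ : Measure (Path m)) (ν : Measure ℝ) (θ₀ : Param m) (dmin : ℝ)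
    (f : Path m → Fin 2 → ℝ) : Prop where
  ergodic : Ergodic shift μ
  indep : ∀ t, Indep (MeasurableSpace.comap (noise t) inferInstance) (pathPast m (t - 1)) μ
  copula : ∀ t, IsCopula (μ.map (noise t))
  measurable_latent : Measurable[pathPast m (-1)] f
  integrable_latent : ∀ i, Integrable (fun z => f z i) μ
  latent_ge : ∀ᵐ z ∂μ, ∀ t i, dmin ≤ f (shiftBy t z) i
  recursion : ∀ᵐ z ∂μ, ∀ t, f (shiftBy (t + 1) z) = latentStep θ₀ (f (shiftBy t z))
    (observe ν (f (shiftBy t z)) (noise t z)) (covar t z)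

lemma measurable_latentStep (θ : Param m) :
    Measurable fun p : (Fin 2 → ℝ) × (ℝ × ℕ) × (Fin m → ℝ) => latentStep θ p.1 p.2.1 p.2.2 := by
  have hmul : ∀ {k : ℕ} (M : Matrix (Fin 2) (Fin k) ℝ), Measurable fun v => M.mulVec v := fun M =>
    (by fun_prop : Continuous fun v => M.mulVec v).measurable
  exact ((measurable_const.add ((hmul _).comp measurable_fst)).add
    ((hmul _).comp (measurable_transformed.comp measurable_snd.fst))).add
    ((hmul _).comp measurable_snd.snd)

variable {Ω : Type*} [mΩ : MeasurableSpace Ω] {P : Measure Ω}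
  {U : ℤ → Ω → Fin 2 → ℝ} {X : ℤ → Ω → Fin m → ℝ}

/-- The bi-infinite path of noise and covariates. -/
def pathOf (U : ℤ → Ω → Fin 2 → ℝ) (X : ℤ → Ω → Fin m → ℝ) (ω : Ω) : Path m :=
  fun t => (U t ω, X t ω)

lemma measurable_pathOf (hU : ∀ t, Measurable (U t)) (hX : ∀ t, Measurable (X t)) :
    Measurable (pathOf U X) :=
  measurable_pi_lambda _ fun t => (hU t).prodMk (hX t)

/-- Independence of the noise and the past carries over to the path space. -/
lemma indep_noise_pathPast (hU : ∀ t, Measurable (U t)) (hX : ∀ t, Measurable (X t)) {t s : ℤ}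
    (h : Indep (MeasurableSpace.comap (U t) inferInstance) (past U X s) P) :
    Indep (MeasurableSpace.comap (noise t) inferInstance) (pathPast m s)
      (P.map (pathOf U X)) := by
  have hφ := measurable_pathOf hU hX
  rw [Indep_iff] at h ⊢
  rintro A B ⟨A', hA', rfl⟩ hB
  have hBm : MeasurableSet B := pathPast_le s B hB
  have hAm : MeasurableSet (noise (m := m) t ⁻¹' A') := measurable_noise t hA'
  rw [Measure.map_apply hφ (hAm.inter hBm), Measure.map_apply hφ hAm, Measure.map_apply hφ hBm]
  refine h _ _ ⟨A', hA', rfl⟩ ?_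
  rw [past_eq_comap]
  exact ⟨B, hB, rfl⟩

lemma map_noise_pathOf (hU : ∀ t, Measurable (U t)) (hX : ∀ t, Measurable (X t)) (t : ℤ) :
    (P.map (pathOf U X)).map (noise t) = P.map (U t) := by
  rw [Measure.map_map (measurable_noise t) (measurable_pathOf hU hX)]
  rfl

/-- A stationary adapted solution is a stationary functional of the noise and the covariates. -/
theorem exists_stationaryModel [IsProbabilityMeasure P] (hU : ∀ t, Measurable (U t)) (hX : ∀ t, Measurable (X t))
    (hA1 : NoiseCovariateAssumption P U X) (hC : IsCopula (P.map (U 0)))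
    {ν : Measure ℝ} [IsProbabilityMeasure ν] (hν_var : ∫ e, e ^ 2 ∂ν = 1)
    {θ₀ : Param m} (hA : ∀ i j, 0 ≤ θ₀.A i j) (hB : ∀ i j, 0 ≤ θ₀.B i j) {dmin : ℝ}
    (hdmin : 0 < dmin) (hd : ∀ i, dmin ≤ θ₀.d i)
    (hΓX : ∀ᵐ ω ∂P, ∀ i, 0 ≤ θ₀.Γ.mulVec (X 0 ω) i)
    {Y : ℤ → Ω → ℝ × ℕ} {L : ℤ → Ω → Fin 2 → ℝ} (hYL : IsStationarySolution P ν θ₀ U X Y L)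
    (hρB : specRad θ₀.B < 1) (hρ : specRad (θ₀.A + θ₀.B) < 1) :
    ∃ f, StationaryModel (P.map (pathOf U X)) ν θ₀ dmin f ∧
      ∀ᵐ ω ∂P, ∀ t, Y t ω = observe ν (f (shiftBy t (pathOf U X ω))) (U t ω) := by
  have hφ := measurable_pathOf (m := m) hU hX
  set φ := pathOf U X with hφdef
  set μ := P.map φ with hμ
  have : IsProbabilityMeasure μ := Measure.isProbabilityMeasure_map hφ.aemeasurable
  have herg : Ergodic shift μ := hA1.stationary_ergodic
  have hmp : MeasurePreserving shift μ μ := herg.toMeasurePreserving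
  have hind : ∀ t, Indep (MeasurableSpace.comap (noise t) inferInstance) (pathPast m (t - 1)) μ :=
    fun t => indep_noise_pathPast hU hX (hA1.indep_past t)
  have hCt : ∀ t, IsCopula (μ.map (noise t)) := fun t => by
    have h1 : μ.map (noise t) = P.map (U 0) := by
      rw [← map_noise_pathOf hU hX 0]
      change μ.map (noise t) = μ.map (noise 0)
      conv_rhs => rw [← (measurePreserving_shiftBy hmp t).map_eq]
      rw [Measure.map_map (measurable_noise 0) (measurable_shiftBy t)]
      congr 1
      funext z
      simp
    rwa [h1]
  have hΓμ : ∀ t, ∀ᵐ z ∂μ, ∀ i, 0 ≤ θ₀.Γ.mulVec (covar t z) i := by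
    have h0 : ∀ᵐ z ∂μ, ∀ i, 0 ≤ θ₀.Γ.mulVec (covar 0 z) i := by
      refine (ae_map_iff hφ.aemeasurable ?_).2 hΓX
      have : Measurable fun z : Path m => θ₀.Γ.mulVec (covar 0 z) :=
        (by fun_prop : Continuous fun v => θ₀.Γ.mulVec v).measurable.comp (measurable_covar 0)
      simp only [Set.ofPred_forall]
      exact MeasurableSet.iInter fun i =>
        measurableSet_le measurable_const ((measurable_pi_apply i).comp this)
    intro t
    filter_upwards [ae_shiftBy hmp h0] with z hz
    simpa using hz t
  have hLm : ∀ t, Measurable[past U X t] (L t) := fun t => measurable_snd.comp (hYL.adapted t)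
  have hYLm : ∀ t, Measurable fun ω => (Y t ω, L t ω) := fun t =>
    (hYL.adapted t).mono (past_le hU hX t) le_rfl
  -- Doob-Dynkin factorization of the adapted process through the path.
  have hk : ∀ t, ∃ k : Path m → Fin 2 → ℝ, Measurable[pathPast m t] k ∧ L t = k ∘ φ := fun t => by
    have h1 := hLm t
    rw [past_eq_comap] at h1
    exact Measurable.exists_eq_measurable_comp (mY := pathPast m t) h1
  choose k hkm hkL using hk
  have hstep : ∀ {t : ℤ} {h : Path m → Fin 2 → ℝ}, Measurable[pathPast m t] h →
      Measurable[pathPast m t] fun z =>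
        latentStep θ₀ (h z) (observe ν (h z) (noise t z)) (covar t z) := fun {t h} hh =>
    (measurable_latentStep θ₀).comp (hh.prodMk (((measurable_observe ν).comp
      (hh.prodMk (measurable_noise_past le_rfl))).prodMk (measurable_covar_past le_rfl)))
  -- Adaptedness only gives measurability up to time `t`. Replacing `k t` by one step of the
  -- recursion gives a version known at time `t - 1`, hence independent of the noise at time `t`.
  set h : ℤ → Path m → Fin 2 → ℝ := fun t z => latentStep θ₀ (k (t - 1) z)
    (observe ν (k (t - 1) z) (noise (t - 1) z)) (covar (t - 1) z) with hh
  have hm : ∀ t, Measurable[pathPast m (t - 1)] (h t) := fun t => hstep (hkm (t - 1))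
  have hm' : ∀ t, Measurable (h t) := fun t => (hm t).mono (pathPast_le _) le_rfl
  have hLh : ∀ t, ∀ᵐ ω ∂P, L t ω = h t (φ ω) := fun t => by
    filter_upwards [hYL.latent t, hYL.observation (t - 1)] with ω h1 h2
    rw [h1, h2, hkL (t - 1)]
    rfl
  have hrec : ∀ t, ∀ᵐ z ∂μ, h t z = latentStep θ₀ (h (t - 1) z)
      (observe ν (h (t - 1) z) (noise (t - 1) z)) (covar (t - 1) z) := fun t => by
    have hms := (hstep ((hm (t - 1)).mono (past_mono (by omega : t - 1 - 1 ≤ t - 1)) le_rfl)).mono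
      (pathPast_le _) le_rfl
    refine (ae_map_iff hφ.aemeasurable (measurableSet_eq_fun (hm' t) hms)).2 ?_
    filter_upwards [hLh (t - 1)] with ω h1
    rw [← h1, hkL (t - 1)]
    rfl
  -- Stationarity of `(Y, L)` enters only here, to bound the means uniformly in time. Joint
  -- stationarity with the noise comes from the uniqueness argument below.
  have hmapL : ∀ t, P.map (L t) = P.map (L 0) := fun t => by
    have h1 := hYL.stationary.map_eq hYLm t
    have h2 := congrArg (fun Q => Q.map Prod.snd) h1
    simpa only [Measure.map_map measurable_snd (hYLm _), Function.comp_def] using h2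
  have hmapL' : ∀ t, μ.map (h t) = P.map (L 0) := fun t => by
    rw [← hmapL t, hμ, Measure.map_map (hm' t) hφ]
    refine Measure.map_congr ?_
    filter_upwards [hLh t] with ω h1
    exact h1.symm
  have hL0m : Measurable (L 0) := (hYLm 0).snd
  have hLint : ∀ i, Integrable (fun v : Fin 2 → ℝ => v i) (P.map (L 0)) := fun i =>
    (integrable_map_measure (measurable_pi_apply i).aestronglyMeasurable hL0m.aemeasurable).2
      (hYL.integrable i)
  have hsol : IsPathSolution μ ν θ₀ h := by
    refine ⟨hm, fun t i => ?_, ⟨∑ i, ∫ v, |v i| ∂(P.map (L 0)), fun t i => ?_⟩, hrec⟩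
    · have := hLint i
      rw [← hmapL' t] at this
      exact (integrable_map_measure (measurable_pi_apply i).aestronglyMeasurable
        (hm' t).aemeasurable).1 this
    · have h1 : ∫ z, |h t z i| ∂μ = ∫ v, |v i| ∂(P.map (L 0)) := by
        rw [← hmapL' t]
        exact (integral_map (hm' t).aemeasurable
          (measurable_pi_apply i).abs.aestronglyMeasurable).symm
      rw [h1]
      exact Finset.single_le_sum (f := fun i => ∫ v, |v i| ∂(P.map (L 0)))
        (fun i _ => integral_nonneg fun v => abs_nonneg _) (Finset.mem_univ i)
  have hge := fun t => hsol.ge hA hB hρB hdmin hd hΓμ t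
  have hge' := fun t => (hsol.shift hmp).ge hA hB hρB hdmin hd hΓμ t
  -- The solution agrees with its own shift; propagating this over all integers, in both directions,
  -- expresses every `h t` as `h 0` of the shifted path.
  have huniq := fun t => (hsol.shift hmp).unique hsol
    (fun t => (hge' t).mono fun z hz i => hdmin.le.trans (hz i))
    (fun t => (hge t).mono fun z hz i => hdmin.le.trans (hz i)) hA hB hρ hind hCt hν_var t
  have hcomp : ∀ t, ∀ᵐ z ∂μ, h t z = h 0 (shiftBy t z) := fun t => by
    induction t using Int.induction_on with
    | zero => simp
    | succ n ih =>
      filter_upwards [(measurePreserving_shiftBy hmp 1).quasiMeasurePreserving.ae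
        ((huniq n).and ih)] with z hz
      obtain ⟨h1, h2⟩ := hz
      simp only [shiftBy_shiftBy] at h1 h2
      rw [show (-1 : ℤ) + 1 = 0 by norm_num, shiftBy_zero] at h1
      rw [h1, h2]
    | pred n ih =>
      filter_upwards [(measurePreserving_shiftBy hmp (-1)).quasiMeasurePreserving.ae ih,
        huniq (-(n : ℤ) - 1)] with z h1 h2
      rw [← h2, show -(n : ℤ) - 1 + 1 = -n by ring, h1, shiftBy_shiftBy, sub_eq_add_neg]
  have hcomp' : ∀ᵐ z ∂μ, ∀ t, h t z = h 0 (shiftBy t z) := ae_all_iff.2 hcomp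
  refine ⟨h 0, ⟨herg, hind, hCt, ?_, hsol.integrable 0, ?_, ?_⟩, ?_⟩
  · simpa using hm 0
  · filter_upwards [hcomp', ae_all_iff.2 hge] with z h1 h2 t i
    rw [← h1]
    exact h2 t i
  · filter_upwards [hcomp', ae_all_iff.2 hrec] with z h1 h2 t
    rw [← h1, ← h1]
    have := h2 (t + 1)
    rwa [add_sub_cancel_right] at this
  · have hobs := ae_all_iff.2 hYL.observation
    filter_upwards [hobs, ae_of_ae_map hφ.aemeasurable hcomp', ae_all_iff.2 hLh] with ω h1 h2 h3 t
    rw [h1, h3, h2]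

end Representation

section Series

variable {m : ℕ} (ν : Measure ℝ) (f : Path m → Fin 2 → ℝ)

/-! ### Linear forms in the observations and the covariates -/

/-- The transformed observation at time `0` on the path space. -/
def obs (z : Path m) : Fin 2 → ℝ := transObs ν (f z) (noise 0 z)

/-- The affine form `a + M ȳ₀ + N x₀`. -/
def affineForm (a : Fin 2 → ℝ) (M : Matrix (Fin 2) (Fin 2) ℝ) (N : Matrix (Fin 2) (Fin m) ℝ)
    (z : Path m) : Fin 2 → ℝ := a + M.mulVec (obs ν f z) + N.mulVec (covar 0 z)

/-- The size of the coefficients of an affine form. -/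
def coeffSize (a : Fin 2 → ℝ) (M : Matrix (Fin 2) (Fin 2) ℝ) (N : Matrix (Fin 2) (Fin m) ℝ) : ℝ :=
  ∑ i, |a i| + entrySum M + entrySum N

/-- A bound on the observation and covariate at time `0`. -/
def envelope (z : Path m) : ℝ := 1 + ∑ i, obs ν f z i + ∑ j, |covar 0 z j|

lemma obs_nonneg (z : Path m) (i : Fin 2) : 0 ≤ obs ν f z i := transObs_nonneg _ _ _ i

lemma one_le_envelope (z : Path m) : 1 ≤ envelope ν f z := by
  have h1 : 0 ≤ ∑ i, obs ν f z i := Finset.sum_nonneg fun i _ => obs_nonneg ν f z i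
  have h2 : 0 ≤ ∑ j, |covar 0 z j| := Finset.sum_nonneg fun j _ => abs_nonneg _
  rw [envelope]
  linarith

lemma envelope_nonneg (z : Path m) : 0 ≤ envelope ν f z :=
  zero_le_one.trans (one_le_envelope ν f z)

lemma obs_le_envelope (z : Path m) (i : Fin 2) : obs ν f z i ≤ envelope ν f z := by
  have h1 := Finset.single_le_sum (f := fun i => obs ν f z i) (fun i _ => obs_nonneg ν f z i)
    (Finset.mem_univ i)
  have h2 : 0 ≤ ∑ j, |covar 0 z j| := Finset.sum_nonneg fun j _ => abs_nonneg _
  rw [envelope]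
  linarith

lemma covar_le_envelope (z : Path m) (j : Fin m) : |covar 0 z j| ≤ envelope ν f z := by
  have h1 : 0 ≤ ∑ i, obs ν f z i := Finset.sum_nonneg fun i _ => obs_nonneg ν f z i
  have h2 := Finset.single_le_sum (f := fun j => |covar 0 z j|) (fun j _ => abs_nonneg _)
    (Finset.mem_univ j)
  rw [envelope]
  linarith

lemma coeffSize_nonneg (a : Fin 2 → ℝ) (M : Matrix (Fin 2) (Fin 2) ℝ)
    (N : Matrix (Fin 2) (Fin m) ℝ) : 0 ≤ coeffSize a M N :=
  add_nonneg (add_nonneg (Finset.sum_nonneg fun _ _ => abs_nonneg _) (entrySum_nonneg M))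
    (entrySum_nonneg N)

/-- The parameter enters only through the coefficients and the path only through the envelope; this
separation makes the later bounds uniform in the parameter. -/
lemma abs_affineForm_le (a : Fin 2 → ℝ) (M : Matrix (Fin 2) (Fin 2) ℝ)
    (N : Matrix (Fin 2) (Fin m) ℝ) (z : Path m) (i : Fin 2) :
    |affineForm ν f a M N z i| ≤ coeffSize a M N * envelope ν f z := by
  have h0 := envelope_nonneg ν f z
  have h1 := abs_mulVec_le_entrySum M h0 (fun j => by
    rw [abs_of_nonneg (obs_nonneg ν f z j)]; exact obs_le_envelope ν f z j) i
  have h2 := abs_mulVec_le_entrySum N h0 (covar_le_envelope ν f z) i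
  have h3 : |a i| ≤ (∑ i, |a i|) * envelope ν f z := by
    have h4 := Finset.single_le_sum (f := fun i => |a i|) (fun i _ => abs_nonneg _)
      (Finset.mem_univ i)
    have h5 : 0 ≤ ∑ i, |a i| := Finset.sum_nonneg fun i _ => abs_nonneg _
    have h6 := mul_le_mul_of_nonneg_left (one_le_envelope ν f z) h5
    linarith
  rw [affineForm, coeffSize, add_mul, add_mul]
  simp only [Pi.add_apply]
  exact (abs_add_three _ _ _).trans (by linarith)

lemma affineForm_sub (a a' : Fin 2 → ℝ) (M M' : Matrix (Fin 2) (Fin 2) ℝ)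
    (N N' : Matrix (Fin 2) (Fin m) ℝ) (z : Path m) :
    affineForm ν f a M N z - affineForm ν f a' M' N' z =
      affineForm ν f (a - a') (M - M') (N - N') z := by
  simp only [affineForm, Matrix.sub_mulVec]
  abel

lemma mulVec_affineForm (B : Matrix (Fin 2) (Fin 2) ℝ) (a : Fin 2 → ℝ)
    (M : Matrix (Fin 2) (Fin 2) ℝ) (N : Matrix (Fin 2) (Fin m) ℝ) (z : Path m) :
    B.mulVec (affineForm ν f a M N z) = affineForm ν f (B.mulVec a) (B * M) (B * N) z := by
  simp only [affineForm, Matrix.mulVec_add, Matrix.mulVec_mulVec]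

lemma coeffSize_mul_le (B : Matrix (Fin 2) (Fin 2) ℝ) (a : Fin 2 → ℝ)
    (M : Matrix (Fin 2) (Fin 2) ℝ) (N : Matrix (Fin 2) (Fin m) ℝ) :
    coeffSize (B.mulVec a) (B * M) (B * N) ≤ entrySum B * coeffSize a M N := by
  have h1 : ∑ i, |B.mulVec a i| ≤ entrySum B * ∑ i, |a i| := by
    rw [entrySum, Finset.sum_mul]
    exact Finset.sum_le_sum fun i _ => abs_mulVec_le B (fun j => Finset.single_le_sum
      (f := fun i => |a i|) (fun i _ => abs_nonneg _) (Finset.mem_univ j)) i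
  have h2 := entrySum_mul_le B M
  have h3 := entrySum_mul_le B N
  rw [coeffSize, coeffSize, mul_add, mul_add]
  linarith

/-! ### The stationary latent process of a parameter -/

/-- The input `d + A ȳ₀ + Γ x₀` of the latent recursion. -/
def drive (θ : Param m) (z : Path m) : Fin 2 → ℝ := affineForm ν f θ.d θ.A θ.Γ z

/-- The stationary latent vector of the parameter `θ` at time `0`. -/
def latentSeries (θ : Param m) (z : Path m) : Fin 2 → ℝ := fun i =>
  ∑' j : ℕ, (θ.B ^ j).mulVec (drive ν f θ (shiftBy (-((j : ℤ) + 1)) z)) i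

/-- Uniform bounds on the coefficients of the parameters of a set. -/
structure UniformDecay (Θ : Set (Param m)) (C r K : ℝ) : Prop where
  C_nonneg : 0 ≤ C
  r_pos : 0 < r
  r_lt_one : r < 1
  pow_le : ∀ θ ∈ Θ, ∀ j, entrySum (θ.B ^ j) ≤ C * r ^ j
  size_le : ∀ θ ∈ Θ, coeffSize θ.d θ.A θ.Γ ≤ K
  K_nonneg : 0 ≤ K

lemma continuous_Param_B : Continuous (Param.B (m := m)) := continuous_snd.snd.snd
lemma continuous_Param_A : Continuous (Param.A (m := m)) := continuous_snd.snd.fst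
lemma continuous_Param_Γ : Continuous (Param.Γ (m := m)) := continuous_snd.fst
lemma continuous_Param_d : Continuous (Param.d (m := m)) := continuous_fst

lemma continuous_coeffSize : Continuous fun p : (Fin 2 → ℝ) × Matrix (Fin 2) (Fin 2) ℝ ×
    Matrix (Fin 2) (Fin m) ℝ => coeffSize p.1 p.2.1 p.2.2 := by
  unfold coeffSize entrySum
  fun_prop

lemma exists_uniformDecay {Θ : Set (Param m)} (hΘ : IsCompact Θ) (hI0 : I0 Θ) :
    ∃ C r K, UniformDecay Θ C r K := by
  obtain ⟨C, r, hC, hr, hr1, h⟩ := exists_geometric_bound (hΘ.image continuous_Param_B)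
    (by rintro _ ⟨θ, hθ, rfl⟩; exact hI0 θ hθ)
  obtain ⟨K, hK⟩ := (hΘ.image (continuous_coeffSize.comp (continuous_Param_d.prodMk
    (continuous_Param_A.prodMk continuous_Param_Γ)))).bddAbove
  exact ⟨C, r, max K 0, hC, hr, hr1, fun θ hθ => h _ ⟨θ, hθ, rfl⟩,
    fun θ hθ => (hK ⟨θ, hθ, rfl⟩).trans (le_max_left _ _), le_max_right _ _⟩

/-- The terms of the discounted sum of past envelopes. -/
def discTerm (r : ℝ) (z : Path m) (j : ℕ) : ℝ :=
  r ^ j * envelope ν f (shiftBy (-((j : ℤ) + 1)) z)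

/-- The discounted sum of the past envelopes. -/
def discSum (r : ℝ) (z : Path m) : ℝ := ∑' j, discTerm ν f r z j

variable {ν f} {Θ : Set (Param m)} {C r K : ℝ}

lemma discTerm_nonneg (hr : 0 < r) (z : Path m) (j : ℕ) : 0 ≤ discTerm ν f r z j :=
  mul_nonneg (pow_nonneg hr.le j) (envelope_nonneg ν f _)

lemma discSum_nonneg (hr : 0 < r) (z : Path m) : 0 ≤ discSum ν f r z :=
  tsum_nonneg fun j => discTerm_nonneg hr z j

lemma seriesTerm_eq (θ : Param m) (z : Path m) (j : ℕ) (i : Fin 2) :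
    (θ.B ^ j).mulVec (drive ν f θ (shiftBy (-((j : ℤ) + 1)) z)) i =
      affineForm ν f ((θ.B ^ j).mulVec θ.d) (θ.B ^ j * θ.A) (θ.B ^ j * θ.Γ)
        (shiftBy (-((j : ℤ) + 1)) z) i := by
  rw [drive, mulVec_affineForm]

lemma UniformDecay.coeffSize_le (hD : UniformDecay Θ C r K) {θ : Param m} (hθ : θ ∈ Θ) (j : ℕ) :
    coeffSize ((θ.B ^ j).mulVec θ.d) (θ.B ^ j * θ.A) (θ.B ^ j * θ.Γ) ≤ C * K * r ^ j := by
  refine (coeffSize_mul_le _ _ _ _).trans ?_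
  have h1 := hD.pow_le θ hθ j
  have h2 := hD.size_le θ hθ
  have h3 : 0 ≤ C * r ^ j := mul_nonneg hD.C_nonneg (pow_nonneg hD.r_pos.le j)
  calc _ ≤ C * r ^ j * K := mul_le_mul h1 h2 (coeffSize_nonneg _ _ _) h3
    _ = C * K * r ^ j := by ring

lemma UniformDecay.abs_seriesTerm_le (hD : UniformDecay Θ C r K) {θ : Param m} (hθ : θ ∈ Θ)
    (z : Path m) (j : ℕ) (i : Fin 2) :
    |(θ.B ^ j).mulVec (drive ν f θ (shiftBy (-((j : ℤ) + 1)) z)) i| ≤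
      C * K * discTerm ν f r z j := by
  rw [seriesTerm_eq]
  refine (abs_affineForm_le ν f _ _ _ _ i).trans ?_
  rw [discTerm, ← mul_assoc]
  exact mul_le_mul_of_nonneg_right (hD.coeffSize_le hθ j) (envelope_nonneg ν f _)

lemma UniformDecay.summable_seriesTerm (hD : UniformDecay Θ C r K) {θ : Param m} (hθ : θ ∈ Θ)
    {z : Path m} (hz : Summable (discTerm ν f r z)) (i : Fin 2) :
    Summable fun j : ℕ => (θ.B ^ j).mulVec (drive ν f θ (shiftBy (-((j : ℤ) + 1)) z)) i :=
  Summable.of_norm_bounded (hz.mul_left (C * K)) fun j => hD.abs_seriesTerm_le hθ z j i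

lemma UniformDecay.abs_latentSeries_le (hD : UniformDecay Θ C r K) {θ : Param m} (hθ : θ ∈ Θ)
    {z : Path m} (hz : Summable (discTerm ν f r z)) (i : Fin 2) :
    |latentSeries ν f θ z i| ≤ C * K * discSum ν f r z := by
  rw [discSum, ← tsum_mul_left]
  exact tsum_of_norm_bounded (f := fun j : ℕ =>
    (θ.B ^ j).mulVec (drive ν f θ (shiftBy (-((j : ℤ) + 1)) z)) i) (hz.mul_left (C * K)).hasSum fun j => hD.abs_seriesTerm_le hθ z j i

/-- The latent recursion satisfied by the stationary latent process. -/
lemma UniformDecay.latentSeries_succ (hD : UniformDecay Θ C r K) {θ : Param m} (hθ : θ ∈ Θ)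
    {z : Path m} (hz : ∀ t : ℤ, Summable (discTerm ν f r (shiftBy t z))) (t : ℤ) :
    latentSeries ν f θ (shiftBy (t + 1) z) =
      drive ν f θ (shiftBy t z) + θ.B.mulVec (latentSeries ν f θ (shiftBy t z)) := by
  funext i
  rw [latentSeries, (hD.summable_seriesTerm hθ (hz (t + 1)) i).tsum_eq_zero_add]
  simp only [pow_zero, Matrix.one_mulVec, Pi.add_apply, shiftBy_shiftBy]
  congr 1
  · norm_num
  · have h1 : ∀ j : ℕ, (θ.B ^ (j + 1)).mulVec
        (drive ν f θ (shiftBy (-(((j + 1 : ℕ) : ℤ) + 1) + (t + 1)) z)) i =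
        ∑ k, θ.B i k * (θ.B ^ j).mulVec (drive ν f θ (shiftBy (-((j : ℤ) + 1)) (shiftBy t z))) k :=
      fun j => by
        rw [pow_succ', ← Matrix.mulVec_mulVec, shiftBy_shiftBy,
          show -(((j + 1 : ℕ) : ℤ) + 1) + (t + 1) = -((j : ℤ) + 1) + t by push_cast; ring]
        simp only [Matrix.mulVec, dotProduct]
    rw [tsum_congr h1, Summable.tsum_finsetSum fun k _ =>
      (hD.summable_seriesTerm hθ (hz t) k).mul_left _]
    simp only [tsum_mul_left, Matrix.mulVec, dotProduct, latentSeries]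

/-- All terms of the series are nonnegative, and the recursion adds a drive of size at least `dmin`.
-/
lemma UniformDecay.latentSeries_ge (hD : UniformDecay Θ C r K) {θ : Param m} (hθ : θ ∈ Θ)
    (hA : ∀ i j, 0 ≤ θ.A i j) (hB : ∀ i j, 0 ≤ θ.B i j) {dmin : ℝ} (hdmin : 0 < dmin)
    (hd : ∀ i, dmin ≤ θ.d i)
    {z : Path m} (hz : ∀ t : ℤ, Summable (discTerm ν f r (shiftBy t z)))
    (hΓ : ∀ t i, 0 ≤ θ.Γ.mulVec (covar t z) i) (t : ℤ) (i : Fin 2) :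
    dmin ≤ latentSeries ν f θ (shiftBy t z) i := by
  have hdrive : ∀ t i, dmin ≤ drive ν f θ (shiftBy t z) i := fun t i => by
    have h1 := mulVec_nonneg' hA (obs_nonneg ν f (shiftBy t z)) i
    have h2 := hΓ (0 + t) i
    rw [drive, affineForm]
    simp only [Pi.add_apply, covar_shiftBy]
    linarith [hd i]
  have hpow0 : ∀ n i j, 0 ≤ (θ.B ^ n) i j := fun n => by
    induction n with
    | zero => intro i j; rw [pow_zero, Matrix.one_apply]; split_ifs <;> norm_num
    | succ n ih =>
      intro i j
      rw [pow_succ, Matrix.mul_apply]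
      exact Finset.sum_nonneg fun k _ => mul_nonneg (ih i k) (hB k j)
  have hnn : ∀ t i, 0 ≤ latentSeries ν f θ (shiftBy t z) i := fun t i =>
    tsum_nonneg fun j => mulVec_nonneg' (hpow0 j) (fun k => by
      rw [shiftBy_shiftBy]
      exact hdmin.le.trans (hdrive _ k)) i
  have h1 := congrFun (hD.latentSeries_succ hθ hz (t - 1)) i
  rw [sub_add_cancel] at h1
  rw [h1, Pi.add_apply]
  linarith [hdrive (t - 1) i, mulVec_nonneg' hB (hnn (t - 1)) i]

/-- The computable latent recursion forgets its initial value at a uniform geometric rate. -/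
lemma UniformDecay.abs_approxLatent_sub_le (hD : UniformDecay Θ C r K) {θ : Param m} (hθ : θ ∈ Θ)
    {z : Path m} (hz : ∀ t : ℤ, Summable (discTerm ν f r (shiftBy t z))) (l₀ : Fin 2 → ℝ) (n : ℕ)
    (i : Fin 2) :
    |approxLatent θ l₀ (fun t => observe ν (f (shiftBy t z)) (noise t z)) (fun t => covar t z) n i -
      latentSeries ν f θ (shiftBy n z) i| ≤
      C * r ^ n * (∑ i, |l₀ i| + C * K * discSum ν f r z) := by
  set y := fun t => observe ν (f (shiftBy t z)) (noise t z)
  set x := fun t => covar t z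
  -- Both sequences obey the same affine recursion with the same input, so their difference is only
  -- multiplied by `B` at each step.
  have hdiff : approxLatent θ l₀ y x n - latentSeries ν f θ (shiftBy n z) =
      (θ.B ^ n).mulVec (l₀ - latentSeries ν f θ z) := by
    induction n with
    | zero => simp [approxLatent]
    | succ n ih =>
      rw [approxLatent, latentStep, pow_succ', ← Matrix.mulVec_mulVec, ← ih]
      have h1 := hD.latentSeries_succ hθ hz n
      push_cast
      rw [h1, Matrix.mulVec_sub, drive, affineForm]
      have h2 : obs ν f (shiftBy (n : ℤ) z) = transformed (y n) := by
        simp [obs, transObs, y]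
      rw [h2]
      simp only [covar_shiftBy, zero_add, x]
      abel
  have h1 := congrFun hdiff i
  rw [Pi.sub_apply] at h1
  rw [h1]
  have hb : ∀ j, |(l₀ - latentSeries ν f θ z) j| ≤ ∑ i, |l₀ i| + C * K * discSum ν f r z := by
    intro j
    have h2 := hD.abs_latentSeries_le hθ (by simpa using hz 0) j
    have h3 := Finset.single_le_sum (f := fun i => |l₀ i|) (fun i _ => abs_nonneg _)
      (Finset.mem_univ j)
    exact (abs_sub _ _).trans (add_le_add h3 h2)
  have h0 : 0 ≤ ∑ i, |l₀ i| + C * K * discSum ν f r z := (abs_nonneg _).trans (hb 0)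
  exact (abs_mulVec_le_entrySum _ h0 hb i).trans
    (mul_le_mul_of_nonneg_right (hD.pow_le θ hθ n) h0)

/-- A bound on the oscillation of the stationary latent vector near a parameter. -/
def oscBound (ν : Measure ℝ) (f : Path m → Fin 2 → ℝ) (r L : ℝ) (N : ℕ) (z : Path m) : ℝ :=
  (1 / ((N : ℝ) + 1)) * discSum ν f r z +
    L * (discSum ν f r z - ∑ j ∈ Finset.range N, discTerm ν f r z j)

lemma discSum_sub_nonneg (hr : 0 < r) {z : Path m} (hz : Summable (discTerm ν f r z)) (N : ℕ) :
    0 ≤ discSum ν f r z - ∑ j ∈ Finset.range N, discTerm ν f r z j :=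
  sub_nonneg.2 (hz.sum_le_tsum _ fun j _ => discTerm_nonneg hr z j)

lemma oscBound_nonneg (hr : 0 < r) {L : ℝ} (hL : 0 ≤ L) {z : Path m}
    (hz : Summable (discTerm ν f r z)) (N : ℕ) : 0 ≤ oscBound ν f r L N z :=
  add_nonneg (mul_nonneg (by positivity) (discSum_nonneg hr z))
    (mul_nonneg hL (discSum_sub_nonneg hr hz N))

lemma oscBound_le (hr : 0 < r) {L : ℝ} (hL : 0 ≤ L) (z : Path m) (N : ℕ) :
    oscBound ν f r L N z ≤ (1 + L) * discSum ν f r z := by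
  have h1 : 1 / ((N : ℝ) + 1) ≤ 1 := by
    rw [div_le_one (by positivity)]
    have : (0 : ℝ) ≤ N := Nat.cast_nonneg N
    linarith
  have h2 : 0 ≤ ∑ j ∈ Finset.range N, discTerm ν f r z j :=
    Finset.sum_nonneg fun j _ => discTerm_nonneg hr z j
  have h3 := discSum_nonneg (ν := ν) (f := f) hr z
  have h4 := mul_le_mul_of_nonneg_right h1 h3
  have h5 := mul_nonneg hL h2
  rw [oscBound]
  linarith

lemma tendsto_oscBound {L : ℝ} {z : Path m} (hz : Summable (discTerm ν f r z)) :
    Tendsto (fun N => oscBound ν f r L N z) atTop (𝓝 0) := by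
  have h1 : Tendsto (fun N : ℕ => 1 / ((N : ℝ) + 1)) atTop (𝓝 0) :=
    tendsto_one_div_add_atTop_nhds_zero_nat
  have h2 := (tendsto_const_nhds (x := discSum ν f r z)).sub hz.hasSum.tendsto_sum_nat
  have h3 := (h1.mul_const (discSum ν f r z)).add (h2.const_mul L)
  simpa [oscBound, discSum] using h3

/-- Near `θ₁` the stationary latent vectors differ by at most the oscillation bound. -/
lemma UniformDecay.eventually_abs_latentSeries_sub_le (hD : UniformDecay Θ C r K) {θ₁ : Param m}
    (hθ₁ : θ₁ ∈ Θ) (N : ℕ) :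
    ∀ᶠ θ in 𝓝 θ₁, θ ∈ Θ → ∀ z : Path m, Summable (discTerm ν f r z) → ∀ i,
      |latentSeries ν f θ z i - latentSeries ν f θ₁ z i| ≤ oscBound ν f r (2 * (C * K)) N z := by
  have hN0 : (0 : ℝ) < 1 / ((N : ℝ) + 1) := by positivity
  -- Only the first `N` coefficients are required to be close. These are finitely many continuous
  -- conditions on `θ`, so the neighbourhood does not depend on the path.
  have hev : ∀ᶠ θ in 𝓝 θ₁, ∀ j ∈ Finset.range N,
      coeffSize ((θ.B ^ j).mulVec θ.d - (θ₁.B ^ j).mulVec θ₁.d)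
        (θ.B ^ j * θ.A - θ₁.B ^ j * θ₁.A) (θ.B ^ j * θ.Γ - θ₁.B ^ j * θ₁.Γ) <
        1 / ((N : ℝ) + 1) * r ^ j := by
    refine (Filter.eventually_all_finset _).2 fun j _ => ?_
    have hc : Continuous fun θ : Param m =>
        coeffSize ((θ.B ^ j).mulVec θ.d - (θ₁.B ^ j).mulVec θ₁.d)
          (θ.B ^ j * θ.A - θ₁.B ^ j * θ₁.A) (θ.B ^ j * θ.Γ - θ₁.B ^ j * θ₁.Γ) := by
      have hB := continuous_Param_B (m := m)
      have hA := continuous_Param_A (m := m)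
      have hΓ := continuous_Param_Γ (m := m)
      have hd := continuous_Param_d (m := m)
      exact continuous_coeffSize.comp ((((hB.pow j).matrix_mulVec hd).sub continuous_const).prodMk
        ((((hB.pow j).matrix_mul hA).sub continuous_const).prodMk
          (((hB.pow j).matrix_mul hΓ).sub continuous_const)))
    refine hc.continuousAt.eventually_lt continuousAt_const ?_
    simp only [sub_self]
    have : coeffSize (0 : Fin 2 → ℝ) (0 : Matrix (Fin 2) (Fin 2) ℝ)
        (0 : Matrix (Fin 2) (Fin m) ℝ) = 0 := by simp [coeffSize, entrySum]
    rw [this]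
    exact mul_pos hN0 (pow_pos hD.r_pos j)
  filter_upwards [hev] with θ hθN hθ z hz i
  -- For `j < N` the closeness of the coefficients is used; the tail is bounded crudely by twice the
  -- uniform geometric bound.
  have hterm : ∀ j : ℕ, ‖(θ.B ^ j).mulVec (drive ν f θ (shiftBy (-((j : ℤ) + 1)) z)) i -
      (θ₁.B ^ j).mulVec (drive ν f θ₁ (shiftBy (-((j : ℤ) + 1)) z)) i‖ ≤
      1 / ((N : ℝ) + 1) * discTerm ν f r z j + 2 * (C * K) * (discTerm ν f r z j -
        if j ∈ Finset.range N then discTerm ν f r z j else 0) := fun j => by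
    rw [Real.norm_eq_abs]
    split_ifs with hj
    · rw [sub_self, mul_zero, add_zero, seriesTerm_eq, seriesTerm_eq, ← Pi.sub_apply,
        affineForm_sub]
      refine (abs_affineForm_le ν f _ _ _ _ i).trans ?_
      rw [discTerm, ← mul_assoc]
      exact mul_le_mul_of_nonneg_right (hθN j hj).le (envelope_nonneg ν f _)
    · have h1 := hD.abs_seriesTerm_le (ν := ν) (f := f) hθ z j i
      have h2 := hD.abs_seriesTerm_le (ν := ν) (f := f) hθ₁ z j i
      have h3 := mul_nonneg hN0.le (discTerm_nonneg (ν := ν) (f := f) hD.r_pos z j)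
      rw [sub_zero]
      refine (abs_sub _ _).trans ?_
      linarith
  have hfin : HasSum (fun j => if j ∈ Finset.range N then discTerm ν f r z j else 0)
      (∑ j ∈ Finset.range N, discTerm ν f r z j) := by
    have : HasSum (fun j => if j ∈ Finset.range N then discTerm ν f r z j else 0)
        (∑ j ∈ Finset.range N, if j ∈ Finset.range N then discTerm ν f r z j else 0) :=
      hasSum_sum_of_ne_finset_zero fun j hj => if_neg hj
    rwa [Finset.sum_congr rfl fun j hj => if_pos hj] at this
  have hsum := (hz.hasSum.mul_left (1 / ((N : ℝ) + 1))).add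
    ((hz.hasSum.sub hfin).mul_left (2 * (C * K)))
  have h1 := tsum_of_norm_bounded hsum hterm
  rw [(hD.summable_seriesTerm hθ hz i).tsum_sub (hD.summable_seriesTerm hθ₁ hz i)] at h1
  exact h1

end Series

/-! ### Measurability, integrability and almost sure convergence of the stationary latent series. -/

section StationaryFacts

variable {m : ℕ} {μ : Measure (Path m)} {ν : Measure ℝ} {θ₀ : Param m} {dmin : ℝ} {f : Path m → Fin 2 → ℝ}

lemma StationaryModel.measurePreserving (hS : StationaryModel μ ν θ₀ dmin f) (t : ℤ) :
    MeasurePreserving (shiftBy t) μ μ :=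
  measurePreserving_shiftBy hS.ergodic.toMeasurePreserving t

lemma measurable_obs_past (hf : Measurable[pathPast m (-1)] f) :
    Measurable[pathPast m 0] (obs ν f) :=
  (measurable_transObs ν).comp ((hf.mono (past_mono (by norm_num)) le_rfl).prodMk
    (measurable_noise_past le_rfl))

lemma measurable_affineForm_past (hf : Measurable[pathPast m (-1)] f) (a : Fin 2 → ℝ)
    (M : Matrix (Fin 2) (Fin 2) ℝ) (N : Matrix (Fin 2) (Fin m) ℝ) :
    Measurable[pathPast m 0] (affineForm ν f a M N) := by
  have hmul : ∀ {k : ℕ} (M : Matrix (Fin 2) (Fin k) ℝ), Measurable fun v => M.mulVec v := fun M =>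
    (by fun_prop : Continuous fun v => M.mulVec v).measurable
  have h : Measurable fun p : (Fin 2 → ℝ) × (Fin m → ℝ) => a + M.mulVec p.1 + N.mulVec p.2 :=
    (measurable_const.add ((hmul M).comp measurable_fst)).add ((hmul N).comp measurable_snd)
  exact h.comp ((measurable_obs_past hf).prodMk (measurable_covar_past le_rfl))

lemma measurable_envelope_past (hf : Measurable[pathPast m (-1)] f) :
    Measurable[pathPast m 0] (envelope ν f) := by
  have h : Measurable fun p : (Fin 2 → ℝ) × (Fin m → ℝ) => 1 + ∑ i, p.1 i + ∑ j, |p.2 j| := by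
    fun_prop
  exact h.comp ((measurable_obs_past hf).prodMk (measurable_covar_past le_rfl))

lemma measurable_comp_shiftBy_neg {β : Type*} [MeasurableSpace β] {g : Path m → β}
    (hg : Measurable[pathPast m 0] g) (j : ℕ) :
    Measurable[pathPast m (-1)] fun z => g (shiftBy (-((j : ℤ) + 1)) z) :=
  (measurable_comp_shiftBy_past hg _).mono (past_mono (by omega)) le_rfl

lemma measurable_latentSeries_past (hf : Measurable[pathPast m (-1)] f) (θ : Param m) :
    Measurable[pathPast m (-1)] (latentSeries ν f θ) := by
  refine @measurable_pi_lambda _ _ _ (pathPast m (-1)) _ _ fun i => ?_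
  refine @Measurable.tsum _ _ _ (pathPast m (-1)) _ _ _ _ _ _ _ _ _ _ _ _ fun j => ?_
  have h : Measurable fun v : Fin 2 → ℝ => (θ.B ^ j).mulVec v i :=
    (measurable_pi_apply i).comp (by fun_prop : Continuous fun v => (θ.B ^ j).mulVec v).measurable
  exact h.comp (measurable_comp_shiftBy_neg (measurable_affineForm_past hf _ _ _) j)

lemma measurable_discTerm_past (hf : Measurable[pathPast m (-1)] f) (r : ℝ) (j : ℕ) :
    Measurable[pathPast m (-1)] fun z => discTerm ν f r z j :=
  (measurable_const_mul (r ^ j)).comp (measurable_comp_shiftBy_neg (measurable_envelope_past hf) j)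

lemma measurable_discSum_past (hf : Measurable[pathPast m (-1)] f) (r : ℝ) :
    Measurable[pathPast m (-1)] (discSum ν f r) :=
  @Measurable.tsum _ _ _ (pathPast m (-1)) _ _ _ _ _ _ _ _ _ _ _ _
    fun j => measurable_discTerm_past hf r j

lemma measurable_oscBound (hf : Measurable[pathPast m (-1)] f) (r L : ℝ) (N : ℕ) :
    Measurable (oscBound ν f r L N) := by
  have h1 := (measurable_discSum_past (ν := ν) hf r).mono (pathPast_le _) le_rfl
  have h2 := fun j => (measurable_discTerm_past (ν := ν) hf r j).mono (pathPast_le _) le_rfl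
  exact (h1.const_mul _).add ((h1.sub (Finset.measurable_sum _ fun j _ => h2 j)).const_mul _)

lemma StationaryModel.ae_ge (hS : StationaryModel μ ν θ₀ dmin f) : ∀ᵐ z ∂μ, ∀ i, dmin ≤ f z i := by
  filter_upwards [hS.latent_ge] with z hz i
  simpa using hz 0 i

lemma StationaryModel.indep_zero (hS : StationaryModel μ ν θ₀ dmin f) :
    Indep (MeasurableSpace.comap (noise 0) inferInstance) (pathPast m (-1)) μ := by
  simpa using hS.indep 0

lemma latentStep_eq_drive_add (θ : Param m) (z : Path m) (t : ℤ) (s : Fin 2 → ℝ) :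
    latentStep θ s (observe ν (f (shiftBy t z)) (noise t z)) (covar t z) =
      drive ν f θ (shiftBy t z) + θ.B.mulVec s := by
  have h : obs ν f (shiftBy t z) = transformed (observe ν (f (shiftBy t z)) (noise t z)) := by
    simp [obs, transObs]
  rw [latentStep, drive, affineForm, h]
  simp only [covar_shiftBy, zero_add]
  abel

variable [IsProbabilityMeasure μ] [IsProbabilityMeasure ν]

/-- The tower property for the observation at time `0`. -/
lemma StationaryModel.integral_obs_mul (hS : StationaryModel μ ν θ₀ dmin f) (hdmin : 0 < dmin)
    (hν_var : ∫ e, e ^ 2 ∂ν = 1) {w : Path m → ℝ} (hw : Measurable[pathPast m (-1)] w) (i : Fin 2)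
    (hint : Integrable (fun z => f z i * w z) μ) :
    Integrable (fun z => obs ν f z i * w z) μ ∧
      ∫ z, obs ν f z i * w z ∂μ = ∫ z, f z i * w z ∂μ :=
  integral_transObs_mul (measurable_noise 0) (pathPast_le _) hS.indep_zero (hS.copula 0) hν_var
    hS.measurable_latent (hS.ae_ge.mono fun _ hz i => hdmin.le.trans (hz i)) hw i hint

lemma StationaryModel.integrable_obs (hS : StationaryModel μ ν θ₀ dmin f) (hdmin : 0 < dmin)
    (hν_var : ∫ e, e ^ 2 ∂ν = 1) (i : Fin 2) : Integrable (fun z => obs ν f z i) μ := by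
  have := (hS.integral_obs_mul hdmin hν_var (w := fun _ => 1) measurable_const i
    (by simpa using hS.integrable_latent i)).1
  simpa using this

lemma StationaryModel.integrable_envelope (hS : StationaryModel μ ν θ₀ dmin f) (hdmin : 0 < dmin)
    (hν_var : ∫ e, e ^ 2 ∂ν = 1) (hX : ∀ j, Integrable (fun z : Path m => covar 0 z j) μ) :
    Integrable (envelope ν f) μ :=
  ((integrable_const 1).add (integrable_finsetSum _ fun i _ =>
    hS.integrable_obs hdmin hν_var i)).add (integrable_finsetSum _ fun j _ => (hX j).abs)

variable {r : ℝ}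

/-- By shift invariance every past envelope has the same finite mean, so the expected sum is a
geometric series. This gives both almost sure convergence and integrability of `discSum`. -/
lemma StationaryModel.tsum_lintegral_discTerm (hS : StationaryModel μ ν θ₀ dmin f)
    (hdmin : 0 < dmin) (hν_var : ∫ e, e ^ 2 ∂ν = 1)
    (hX : ∀ j, Integrable (fun z : Path m => covar 0 z j) μ) (hr : 0 < r) (hr1 : r < 1) :
    ∫⁻ z, ∑' j, ENNReal.ofReal (discTerm ν f r z j) ∂μ < ⊤ := by
  have hm := fun j => (measurable_discTerm_past (ν := ν) hS.measurable_latent r j).mono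
    (pathPast_le _) le_rfl
  have henv := hS.integrable_envelope hdmin hν_var hX
  rw [lintegral_tsum fun j => (hm j).ennreal_ofReal.aemeasurable]
  have h1 : ∀ j, ∫⁻ z, ENNReal.ofReal (discTerm ν f r z j) ∂μ =
      ENNReal.ofReal (r ^ j * ∫ z, envelope ν f z ∂μ) := fun j => by
    have hmp := hS.measurePreserving (-((j : ℤ) + 1))
    have hint : Integrable (fun z => discTerm ν f r z j) μ :=
      (hmp.integrable_comp_of_integrable henv).const_mul _
    rw [← ofReal_integral_eq_lintegral_ofReal hint
      (Eventually.of_forall fun z => discTerm_nonneg hr z j)]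
    congr 1
    simp only [discTerm]
    rw [integral_const_mul]
    congr 1
    have h2 : ∫ z, envelope ν f z ∂(μ.map (shiftBy (-((j : ℤ) + 1)))) =
        ∫ z, envelope ν f (shiftBy (-((j : ℤ) + 1)) z) ∂μ :=
      integral_map hmp.measurable.aemeasurable (by rw [hmp.map_eq]; exact henv.1)
    rw [← h2, hmp.map_eq]
  simp_rw [h1]
  have h0 : 0 ≤ ∫ z, envelope ν f z ∂μ := integral_nonneg fun z => envelope_nonneg ν f z
  rw [← ENNReal.ofReal_tsum_of_nonneg (fun j => by positivity)
    ((summable_geometric_of_lt_one hr.le hr1).mul_right _)]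
  exact ENNReal.ofReal_lt_top

/-- The discounted sums of past envelopes converge along almost every path. -/
lemma StationaryModel.ae_summable_discTerm (hS : StationaryModel μ ν θ₀ dmin f)
    (hdmin : 0 < dmin) (hν_var : ∫ e, e ^ 2 ∂ν = 1)
    (hX : ∀ j, Integrable (fun z : Path m => covar 0 z j) μ) (hr : 0 < r) (hr1 : r < 1) :
    ∀ᵐ z ∂μ, ∀ t : ℤ, Summable (discTerm ν f r (shiftBy t z)) := by
  refine ae_shiftBy hS.ergodic.toMeasurePreserving (p := fun z => Summable (discTerm ν f r z)) ?_
  have hm := fun j => (measurable_discTerm_past (ν := ν) hS.measurable_latent r j).mono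
    (pathPast_le _) le_rfl
  filter_upwards [ae_lt_top (Measurable.tsum fun j => (hm j).ennreal_ofReal)
    (hS.tsum_lintegral_discTerm hdmin hν_var hX hr hr1).ne] with z hz
  have h1 := ENNReal.summable_toReal hz.ne
  refine h1.congr fun j => ?_
  rw [ENNReal.toReal_ofReal (discTerm_nonneg hr z j)]

lemma StationaryModel.integrable_discSum (hS : StationaryModel μ ν θ₀ dmin f)
    (hdmin : 0 < dmin) (hν_var : ∫ e, e ^ 2 ∂ν = 1)
    (hX : ∀ j, Integrable (fun z : Path m => covar 0 z j) μ) (hr : 0 < r) (hr1 : r < 1) :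
    Integrable (discSum ν f r) μ := by
  refine ⟨((measurable_discSum_past hS.measurable_latent r).mono
    (pathPast_le _) le_rfl).aestronglyMeasurable, ?_⟩
  rw [hasFiniteIntegral_iff_ofReal (Eventually.of_forall fun z => discSum_nonneg hr z)]
  refine lt_of_le_of_lt (lintegral_mono_ae ?_)
    (hS.tsum_lintegral_discTerm hdmin hν_var hX hr hr1)
  filter_upwards [hS.ae_summable_discTerm hdmin hν_var hX hr hr1] with z hz
  have hz0 : Summable (discTerm ν f r z) := by simpa using hz 0
  rw [discSum, ENNReal.ofReal_tsum_of_nonneg (fun j => discTerm_nonneg hr z j) hz0]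

variable {Θ : Set (Param m)} {C K : ℝ}

lemma StationaryModel.integrable_latentSeries (hS : StationaryModel μ ν θ₀ dmin f)
    (hdmin : 0 < dmin) (hν_var : ∫ e, e ^ 2 ∂ν = 1)
    (hX : ∀ j, Integrable (fun z : Path m => covar 0 z j) μ) (hD : UniformDecay Θ C r K)
    {θ : Param m} (hθ : θ ∈ Θ) (i : Fin 2) : Integrable (fun z => latentSeries ν f θ z i) μ := by
  refine ((hS.integrable_discSum hdmin hν_var hX hD.r_pos hD.r_lt_one).const_mul (C * K)).mono'
    ((measurable_pi_apply i).comp ((measurable_latentSeries_past hS.measurable_latent θ).mono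
      (pathPast_le _) le_rfl)).aestronglyMeasurable ?_
  filter_upwards [hS.ae_summable_discTerm hdmin hν_var hX hD.r_pos hD.r_lt_one] with z hz
  exact hD.abs_latentSeries_le hθ (by simpa using hz 0) i

/-- At the true parameter the stationary latent process is the latent process of the model. -/
lemma StationaryModel.latentSeries_eq (hS : StationaryModel μ ν θ₀ dmin f)
    (hdmin : 0 < dmin) (hν_var : ∫ e, e ^ 2 ∂ν = 1)
    (hX : ∀ j, Integrable (fun z : Path m => covar 0 z j) μ) (hD : UniformDecay Θ C r K)
    (hθ₀ : θ₀ ∈ Θ) (hB : ∀ i j, 0 ≤ θ₀.B i j) (hρ : specRad θ₀.B < 1) :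
    ∀ᵐ z ∂μ, ∀ t, latentSeries ν f θ₀ (shiftBy t z) = f (shiftBy t z) := by
  refine ae_shiftBy hS.ergodic.toMeasurePreserving
    (p := fun z => latentSeries ν f θ₀ z = f z) ?_
  have hint0 : ∀ i, Integrable (fun z => |latentSeries ν f θ₀ z i - f z i|) μ := fun i =>
    ((hS.integrable_latentSeries hdmin hν_var hX hD hθ₀ i).sub (hS.integrable_latent i)).abs
  have hint : ∀ t i, Integrable (fun z => |latentSeries ν f θ₀ (shiftBy t z) i -
      f (shiftBy t z) i|) μ := fun t i =>
    (hS.measurePreserving t).integrable_comp_of_integrable (hint0 i)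
  have hconst : ∀ t i, ∫ z, |latentSeries ν f θ₀ (shiftBy t z) i - f (shiftBy t z) i| ∂μ =
      ∫ z, |latentSeries ν f θ₀ z i - f z i| ∂μ := fun t i => by
    have hmp := hS.measurePreserving t
    have h2 : ∫ z, |latentSeries ν f θ₀ z i - f z i| ∂(μ.map (shiftBy t)) =
        ∫ z, |latentSeries ν f θ₀ (shiftBy t z) i - f (shiftBy t z) i| ∂μ :=
      integral_map hmp.measurable.aemeasurable (by rw [hmp.map_eq]; exact (hint0 i).1)
    rw [← h2, hmp.map_eq]
  have hsumm := hS.ae_summable_discTerm hdmin hν_var hX hD.r_pos hD.r_lt_one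
  -- The series and the latent process share the same drive, so their difference obeys the
  -- homogeneous recursion with matrix `B₀`; its mean absolute value is constant in time, hence
  -- zero.
  have hzero := eq_zero_of_le_mulVec_pred hB hρ
    (K := ∑ i, ∫ z, |latentSeries ν f θ₀ z i - f z i| ∂μ)
    (e := fun t i => ∫ z, |latentSeries ν f θ₀ (shiftBy t z) i - f (shiftBy t z) i| ∂μ)
    (fun t i => integral_nonneg fun z => abs_nonneg _)
    (fun t i => by
      simp only [hconst]
      exact Finset.single_le_sum (f := fun i => ∫ z, |latentSeries ν f θ₀ z i - f z i| ∂μ)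
        (fun i _ => integral_nonneg fun z => abs_nonneg _) (Finset.mem_univ i))
    (fun t i => by
      simp only [Matrix.mulVec, dotProduct]
      simp_rw [← integral_const_mul]
      rw [← integral_finsetSum _ fun j _ => (hint (t - 1) j).const_mul _]
      refine integral_mono_ae (hint t i)
        (integrable_finsetSum _ fun j _ => (hint (t - 1) j).const_mul _) ?_
      filter_upwards [hsumm, hS.recursion] with z hz hz'
      have h1 := hD.latentSeries_succ hθ₀ hz (t - 1)
      have h2 := hz' (t - 1)
      rw [latentStep_eq_drive_add] at h2
      rw [sub_add_cancel] at h1 h2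
      rw [h1, h2, Pi.add_apply, Pi.add_apply, add_sub_add_left_eq_sub, ← Pi.sub_apply,
        ← Matrix.mulVec_sub]
      simp only [Matrix.mulVec, dotProduct]
      refine (Finset.abs_sum_le_sum_abs _ _).trans (Finset.sum_le_sum fun j _ => ?_)
      rw [abs_mul, abs_of_nonneg (hB i j)]
      rfl)
  have hall : ∀ᵐ z ∂μ, ∀ i, latentSeries ν f θ₀ z i = f z i := ae_all_iff.2 fun i => by
    have h0 := hzero 0 i
    simp only [hconst] at h0
    have := (integral_eq_zero_iff_of_nonneg (fun z => abs_nonneg _) (hint0 i)).1 h0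
    filter_upwards [this] with z hz
    exact sub_eq_zero.1 (abs_eq_zero.1 hz)
  filter_upwards [hall] with z hz
  exact funext hz

end StationaryFacts

/-! ### Identifiability -/

section Independence

/-- The intersections of sets from `m₂` and `m₃` form a π-system generating the join, and on them
the three probabilities factor. -/
lemma indep_sup_right {Ω : Type*} {m₁ m₂ m₃ : MeasurableSpace Ω} [mΩ : MeasurableSpace Ω]
    {P : Measure Ω} [IsProbabilityMeasure P] (h₁ : m₁ ≤ mΩ) (h₂ : m₂ ≤ mΩ) (h₃ : m₃ ≤ mΩ)
    (h12 : Indep m₁ m₂ P) (h123 : Indep (m₁ ⊔ m₂) m₃ P) : Indep m₁ (m₂ ⊔ m₃) P := by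
  set p : Set (Set Ω) := {u | ∃ s t, MeasurableSet[m₂] s ∧ MeasurableSet[m₃] t ∧ u = s ∩ t} with hp
  have hgen : m₂ ⊔ m₃ = MeasurableSpace.generateFrom p := by
    refine le_antisymm (sup_le (fun s hs => ?_) (fun t ht => ?_))
      (MeasurableSpace.generateFrom_le ?_)
    · exact MeasurableSpace.measurableSet_generateFrom
        ⟨s, Set.univ, hs, MeasurableSet.univ, (Set.inter_univ s).symm⟩
    · exact MeasurableSpace.measurableSet_generateFrom
        ⟨Set.univ, t, MeasurableSet.univ, ht, (Set.univ_inter t).symm⟩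
    · rintro _ ⟨s, t, hs, ht, rfl⟩
      exact MeasurableSet.inter ((le_sup_left : m₂ ≤ m₂ ⊔ m₃) s hs)
        ((le_sup_right : m₃ ≤ m₂ ⊔ m₃) t ht)
  have hpi : IsPiSystem p := by
    rintro _ ⟨s, t, hs, ht, rfl⟩ _ ⟨s', t', hs', ht', rfl⟩ -
    exact ⟨s ∩ s', t ∩ t', hs.inter hs', ht.inter ht', Set.inter_inter_inter_comm s t s' t'⟩
  refine IndepSets.indep h₁ (sup_le h₂ h₃) (@MeasurableSpace.isPiSystem_measurableSet Ω m₁) hpi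
    (@MeasurableSpace.generateFrom_measurableSet Ω m₁).symm hgen ?_
  rw [IndepSets_iff]
  rw [Indep_iff] at h12 h123
  rintro A _ hA ⟨s, t, hs, ht, rfl⟩
  have hA' : MeasurableSet[m₁ ⊔ m₂] A := (le_sup_left : m₁ ≤ m₁ ⊔ m₂) A hA
  have hs' : MeasurableSet[m₁ ⊔ m₂] s := (le_sup_right : m₂ ≤ m₁ ⊔ m₂) s hs
  rw [← Set.inter_assoc, h123 _ _ (MeasurableSet.inter hA' hs') ht, h12 _ _ hA hs,
    h123 _ _ hs' ht, mul_assoc]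

end Independence

/-! ### Transfer of the conditions on the covariates to the path space. -/

section Transfer

variable {m : ℕ} {Ω : Type*} [mΩ : MeasurableSpace Ω] {P : Measure Ω}
  {U : ℤ → Ω → Fin 2 → ℝ} {X : ℤ → Ω → Fin m → ℝ}

lemma I1.path (hU : ∀ t, Measurable (U t)) (hX : ∀ t, Measurable (X t)) (h : I1 P U X) :
    I1 (P.map (pathOf U X)) noise covar := by
  rintro v ⟨Z, hZ, hvZ⟩
  refine h v ⟨Z ∘ pathOf U X, ?_, ae_of_ae_map (measurable_pathOf hU hX).aemeasurable hvZ⟩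
  have hφ : Measurable[past U X 0 ⊔ MeasurableSpace.comap (U 1) inferInstance,
      pathPast m 0 ⊔ MeasurableSpace.comap (noise 1) inferInstance] (pathOf U X) := by
    rw [measurable_iff_comap_le, MeasurableSpace.comap_sup, MeasurableSpace.comap_comp,
      past_eq_comap]
    exact le_rfl
  exact hZ.comp hφ

lemma I1'.path [IsProbabilityMeasure P] (hU : ∀ t, Measurable (U t)) (hX : ∀ t, Measurable (X t))
    (h : I1' P U X) : I1' (P.map (pathOf U X)) noise covar := by
  have hφ := measurable_pathOf hU hX
  refine ⟨?_, fun Φ c hΦ => h.2 Φ c (ae_of_ae_map hφ.aemeasurable hΦ)⟩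
  have hN : Measurable fun (z : Path m) t => noise t z := measurable_pi_lambda _ measurable_noise
  have hV : Measurable fun (z : Path m) t => covar t z := measurable_pi_lambda _ measurable_covar
  have h1 := h.1
  rw [indepFun_iff_measure_inter_preimage_eq_mul] at h1 ⊢
  intro s t hs ht
  rw [Measure.map_apply hφ ((hN hs).inter (hV ht)), Measure.map_apply hφ (hN hs),
    Measure.map_apply hφ (hV ht)]
  exact h1 s t hs ht

end Transfer

/-! ### From equality of the latent processes to equality of the parameters. -/

section Identification

variable {m : ℕ} {μ : Measure (Path m)} {ν : Measure ℝ}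
  {θ₀ : Param m} {dmin : ℝ} {f : Path m → Fin 2 → ℝ}

/-- The sigma-field generated by the covariates at all times. -/
@[reducible] def covarField (m : ℕ) : MeasurableSpace (Path m) :=
  MeasurableSpace.comap (fun z t => covar t z) inferInstance

/-- The sigma-field generated by the noise at negative times. -/
@[reducible] def noisePast (m : ℕ) : MeasurableSpace (Path m) :=
  ⨆ s : {s : ℤ // s ≤ -1}, MeasurableSpace.comap (noise s) inferInstance

lemma measurable_covar_covarField (t : ℤ) : Measurable[covarField m] (covar (m := m) t) :=
  (measurable_pi_apply t).comp (comap_measurable fun (z : Path m) t => covar t z)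

lemma measurable_comp_shiftBy_covarField {β : Type*} [MeasurableSpace β] {g : Path m → β}
    (hg : Measurable[covarField m] g) (k : ℤ) :
    Measurable[covarField m] fun z => g (shiftBy k z) := by
  have h : Measurable[covarField m, covarField m] (shiftBy (E := (Fin 2 → ℝ) × (Fin m → ℝ)) k) := by
    rw [measurable_iff_comap_le, MeasurableSpace.comap_comp, ← measurable_iff_comap_le]
    exact @measurable_pi_lambda _ _ _ (covarField m) _ _ fun t => measurable_covar_covarField (t + k)
  exact hg.comp h

lemma covarField_le : covarField m ≤ MeasurableSpace.pi :=
  (measurable_pi_lambda _ measurable_covar).comap_le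

lemma noisePast_le_pathPast : noisePast m ≤ pathPast m (-1) :=
  iSup_le fun s => (measurable_noise_past s.2).comap_le

lemma pathPast_le_noisePast_sup : pathPast m (-1) ≤ noisePast m ⊔ covarField m := by
  refine iSup_le fun s => ?_
  rw [← measurable_iff_comap_le]
  refine Measurable.prodMk ?_ ?_
  · refine Measurable.mono (ma := noisePast m) ?_ le_sup_left le_rfl
    rw [measurable_iff_comap_le]
    exact le_iSup (fun s : {s : ℤ // s ≤ -1} =>
      MeasurableSpace.comap (noise (m := m) s) inferInstance) s
  · exact (measurable_covar_covarField (s : ℤ)).mono le_sup_right le_rfl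

lemma measurable_mulVec_const {k l : ℕ} (M : Matrix (Fin k) (Fin l) ℝ) :
    Measurable fun v => M.mulVec v :=
  (by fun_prop : Continuous fun v => M.mulVec v).measurable

lemma measurable_sub_mulVec (a : Fin 2 → ℝ) (D : Matrix (Fin 2) (Fin 2) ℝ)
    {G : MeasurableSpace (Path m)} (hf : Measurable[G] f) {Z : Path m → Fin 2 → ℝ}
    (hZ : Measurable[G] Z) : Measurable[G] fun z => a + Z z - D.mulVec (f z) :=
  ((measurable_const.add measurable_fst).sub
    ((measurable_mulVec_const D).comp measurable_snd) :
    Measurable fun p : (Fin 2 → ℝ) × (Fin 2 → ℝ) => a + p.1 - D.mulVec p.2).comp (hZ.prodMk hf)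

/-- The latent recursion in matrix form. -/
lemma StationaryModel.recursion' (hS : StationaryModel μ ν θ₀ dmin f) :
    ∀ᵐ z ∂μ, f (shiftBy 1 z) = drive ν f θ₀ z + θ₀.B.mulVec (f z) := by
  filter_upwards [hS.recursion] with z hz
  have := hz 0
  rw [latentStep_eq_drive_add] at this
  simpa using this

variable [IsProbabilityMeasure μ]

/-- The standing assumption makes the current noise independent of the past only. When noise and
covariates are independent processes, the covariates of all times, future ones included, may be
added to the conditioning. -/
lemma StationaryModel.indep_noisePast_sup (hS : StationaryModel μ ν θ₀ dmin f)
    (h : IndepFun (fun (z : Path m) (t : ℤ) => noise t z) (fun z t => covar t z) μ) :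
    Indep (MeasurableSpace.comap (noise 0) inferInstance) (noisePast m ⊔ covarField m) μ := by
  have hn : (MeasurableSpace.comap (noise (m := m) 0) inferInstance) ≤ MeasurableSpace.pi :=
    (measurable_noise 0).comap_le
  refine indep_sup_right hn (noisePast_le_pathPast.trans (pathPast_le _)) covarField_le
    (indep_of_indep_of_le_right hS.indep_zero noisePast_le_pathPast) ?_
  refine indep_of_indep_of_le_left ((IndepFun_iff_Indep _ _ _).1 h) ?_
  have hcoord : ∀ s : ℤ, MeasurableSpace.comap (noise (m := m) s) inferInstance ≤
      MeasurableSpace.comap (fun (z : Path m) (t : ℤ) => noise t z) inferInstance := fun s =>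
    Measurable.comap_le ((measurable_pi_apply s).comp
      (comap_measurable fun (z : Path m) (t : ℤ) => noise t z))
  exact sup_le (hcoord 0) (iSup_le fun s => hcoord s)

/-- A linear combination of the current observations that is determined by a sigma-field
independent of the current noise is trivial. -/
lemma StationaryModel.matrix_eq_zero [IsProbabilityMeasure ν]
    (hS : StationaryModel μ ν θ₀ dmin f) (hdmin : 0 < dmin) (hI2 : I2 ν (μ.map (noise 0)))
    {G : MeasurableSpace (Path m)} (hG : G ≤ MeasurableSpace.pi) (hGp : pathPast m (-1) ≤ G)
    (hind : Indep (MeasurableSpace.comap (noise 0) inferInstance) G μ)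
    {M : Matrix (Fin 2) (Fin 2) ℝ} {Z : Path m → Fin 2 → ℝ} (hZ : Measurable[G] Z)
    (h : ∀ᵐ z ∂μ, M.mulVec (obs ν f z) = Z z) : M = 0 :=
  matrix_eq_zero_of_mulVec_transObs (mΩ := MeasurableSpace.pi) (measurable_noise 0) hG hind hI2
    (hS.measurable_latent.mono hGp le_rfl) hZ
    (hS.ae_ge.mono fun _ hz i => hdmin.trans_le (hz i)) h

variable [IsProbabilityMeasure ν]

/-- Shifted to time one, the relation expresses `N X₁` through `𝓕₀` and `U₁`, so (I1) gives `N = 0`.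
What remains determines `M ȳ₀` from the past, because `f` is predictable, and non-degeneracy of the
innovations gives `M = 0`. -/
lemma StationaryModel.coeffs_eq_zero_of_I1 (hS : StationaryModel μ ν θ₀ dmin f)
    (hdmin : 0 < dmin) (hI2 : I2 ν (μ.map (noise 0))) (hI1 : I1 μ noise covar)
    {M D : Matrix (Fin 2) (Fin 2) ℝ} {N : Matrix (Fin 2) (Fin m) ℝ} {a : Fin 2 → ℝ}
    (h : ∀ᵐ z ∂μ, M.mulVec (obs ν f z) + N.mulVec (covar 0 z) + D.mulVec (f z) = a) :
    M = 0 ∧ N = 0 := by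
  have hf := hS.measurable_latent
  have hN : N = 0 := by
    have hrow : ∀ i, N i = 0 := fun i => by
      refine hI1 (N i) ⟨fun z => a i - M.mulVec (transObs ν (f (shiftBy 1 z)) (noise 1 z)) i -
        D.mulVec (f (shiftBy 1 z)) i, ?_, ?_⟩
      · have hf1 : Measurable[pathPast m 0 ⊔ MeasurableSpace.comap (noise 1) inferInstance]
            fun z => f (shiftBy 1 z) :=
          (measurable_comp_shiftBy_past hf 1).mono le_sup_left le_rfl
        have hn1 : Measurable[pathPast m 0 ⊔ MeasurableSpace.comap (noise 1) inferInstance]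
            (noise (m := m) 1) :=
          (comap_measurable (noise 1)).mono le_sup_right le_rfl
        have hg : Measurable fun p : (Fin 2 → ℝ) × (Fin 2 → ℝ) =>
            a i - M.mulVec (transObs ν p.1 p.2) i - D.mulVec p.1 i :=
          (measurable_const.sub ((measurable_pi_apply i).comp ((measurable_mulVec_const M).comp
            (measurable_transObs ν)))).sub
            ((measurable_pi_apply i).comp ((measurable_mulVec_const D).comp measurable_fst))
        exact @Measurable.comp _ _ _ (pathPast m 0 ⊔ MeasurableSpace.comap (noise 1) inferInstance)
          _ _ _ (fun z => (f (shiftBy 1 z), noise 1 z)) hg (hf1.prodMk hn1)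
      · filter_upwards [(hS.measurePreserving 1).quasiMeasurePreserving.ae h] with z hz
        have h1 := congrFun hz i
        simp only [Pi.add_apply, covar_shiftBy, zero_add] at h1
        have h2 : obs ν f (shiftBy 1 z) = transObs ν (f (shiftBy 1 z)) (noise 1 z) := by
          simp [obs]
        rw [h2] at h1
        have h3 : N i ⬝ᵥ covar 1 z = N.mulVec (covar 1 z) i := rfl
        rw [h3]
        linarith
    ext i j
    exact congrFun (hrow i) j
  refine ⟨?_, hN⟩
  refine hS.matrix_eq_zero hdmin hI2 (pathPast_le _) le_rfl hS.indep_zero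
    (measurable_sub_mulVec a D hf (measurable_const (a := (0 : Fin 2 → ℝ)))) ?_
  filter_upwards [h] with z hz
  rw [← hz, hN]
  simp

/-- If `D` annihilates the randomness of the latent vector, it annihilates the impulse
responses. -/
lemma StationaryModel.impulse_eq_zero_of_I1 (hS : StationaryModel μ ν θ₀ dmin f)
    (hdmin : 0 < dmin) (hI2 : I2 ν (μ.map (noise 0))) (hI1 : I1 μ noise covar) (j : ℕ) :
    ∀ {D : Matrix (Fin 2) (Fin 2) ℝ} {a : Fin 2 → ℝ}, (∀ᵐ z ∂μ, D.mulVec (f z) = a) →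
      D * θ₀.B ^ j * θ₀.A = 0 ∧ D * θ₀.B ^ j * θ₀.Γ = 0 := by
  -- One step of the recursion turns a relation for `D` into one with coefficients `D A₀`, `D Γ₀`
  -- and `D B₀`. The first two vanish, which leaves a relation of the original kind for `D B₀`;
  -- hence the induction is over all `D` and `a`.
  have hstep : ∀ {D : Matrix (Fin 2) (Fin 2) ℝ} {a : Fin 2 → ℝ}, (∀ᵐ z ∂μ, D.mulVec (f z) = a) →
      (∀ᵐ z ∂μ, (D * θ₀.A).mulVec (obs ν f z) + (D * θ₀.Γ).mulVec (covar 0 z) +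
        (D * θ₀.B).mulVec (f z) = a - D.mulVec θ₀.d) := fun {D a} h => by
    filter_upwards [hS.recursion', (hS.measurePreserving 1).quasiMeasurePreserving.ae h]
      with z h1 h2
    rw [h1, drive, affineForm] at h2
    simp only [Matrix.mulVec_add, Matrix.mulVec_mulVec] at h2
    rw [← h2]
    abel
  induction j with
  | zero =>
    intro D a h
    simpa using hS.coeffs_eq_zero_of_I1 hdmin hI2 hI1 (hstep h)
  | succ j ih =>
    intro D a h
    obtain ⟨h1, h2⟩ := hS.coeffs_eq_zero_of_I1 hdmin hI2 hI1 (hstep h)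
    have h3 : ∀ᵐ z ∂μ, (D * θ₀.B).mulVec (f z) = a - D.mulVec θ₀.d := by
      filter_upwards [hstep h] with z hz
      simpa [h1, h2] using hz
    have := ih h3
    rwa [Matrix.mul_assoc D, ← pow_succ'] at this

/-- If `D` makes the latent vector a function of the covariates, it annihilates the impulse
responses to the observations. -/
lemma StationaryModel.impulse_eq_zero_of_indep (hS : StationaryModel μ ν θ₀ dmin f)
    (hdmin : 0 < dmin) (hI2 : I2 ν (μ.map (noise 0)))
    (hI : IndepFun (fun (z : Path m) (t : ℤ) => noise t z) (fun z t => covar t z) μ) (j : ℕ) :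
    ∀ {D : Matrix (Fin 2) (Fin 2) ℝ} {Z : Path m → Fin 2 → ℝ}, Measurable[covarField m] Z →
      (∀ᵐ z ∂μ, D.mulVec (f z) = Z z) → D * θ₀.B ^ j * θ₀.A = 0 := by
  have hstep : ∀ {D : Matrix (Fin 2) (Fin 2) ℝ} {Z : Path m → Fin 2 → ℝ},
      Measurable[covarField m] Z → (∀ᵐ z ∂μ, D.mulVec (f z) = Z z) →
      ∃ Z' : Path m → Fin 2 → ℝ, Measurable[covarField m] Z' ∧ D * θ₀.A = 0 ∧
        ∀ᵐ z ∂μ, (D * θ₀.B).mulVec (f z) = Z' z := fun {D Z} hZ h => by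
    -- The covariate terms cannot be cancelled here, so they are absorbed into the right-hand side.
    -- The shift brings in later covariates, which is why the σ-field contains all times.
    set Z' : Path m → Fin 2 → ℝ := fun z =>
      -D.mulVec θ₀.d + (Z (shiftBy 1 z) - (D * θ₀.Γ).mulVec (covar 0 z)) with hZ'
    have hZm : Measurable[covarField m] Z' := by
      have hg : Measurable fun p : (Fin 2 → ℝ) × (Fin m → ℝ) =>
          -D.mulVec θ₀.d + (p.1 - (D * θ₀.Γ).mulVec p.2) :=
        measurable_const.add (measurable_fst.sub
          ((measurable_mulVec_const _).comp measurable_snd))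
      exact hg.comp ((measurable_comp_shiftBy_covarField hZ 1).prodMk
        (measurable_covar_covarField 0))
    have hrel : ∀ᵐ z ∂μ, (D * θ₀.A).mulVec (obs ν f z) + (D * θ₀.B).mulVec (f z) = Z' z := by
      filter_upwards [hS.recursion', (hS.measurePreserving 1).quasiMeasurePreserving.ae h]
        with z h1 h2
      rw [h1, drive, affineForm] at h2
      simp only [Matrix.mulVec_add, Matrix.mulVec_mulVec] at h2
      rw [hZ']
      simp only
      rw [← h2]
      abel
    have hDA : D * θ₀.A = 0 := by
      refine hS.matrix_eq_zero hdmin hI2 (sup_le (noisePast_le_pathPast.trans (pathPast_le _))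
        covarField_le) pathPast_le_noisePast_sup (hS.indep_noisePast_sup hI)
        (measurable_sub_mulVec 0 (D * θ₀.B)
          (hS.measurable_latent.mono pathPast_le_noisePast_sup le_rfl)
          (hZm.mono le_sup_right le_rfl)) ?_
      filter_upwards [hrel] with z hz
      rw [← hz]
      simp
    refine ⟨Z', hZm, hDA, ?_⟩
    filter_upwards [hrel] with z hz
    simpa [hDA] using hz
  induction j with
  | zero =>
    intro D Z hZ h
    obtain ⟨Z', -, h1, -⟩ := hstep hZ h
    simpa using h1
  | succ j ih =>
    intro D Z hZ h
    obtain ⟨Z', hZ', -, h2⟩ := hstep hZ h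
    have := ih hZ' h2
    rwa [Matrix.mul_assoc D, ← pow_succ'] at this

/-- The impulse relation replaces the outermost factor `B` by `B₀` once the inner powers already
agree on `M`. -/
lemma pow_mul_eq_of_impulse {k : ℕ} {B B₀ : Matrix (Fin 2) (Fin 2) ℝ}
    {M : Matrix (Fin 2) (Fin k) ℝ} (h : ∀ j : ℕ, (B - B₀) * B₀ ^ j * M = 0) (j : ℕ) :
    B ^ j * M = B₀ ^ j * M := by
  induction j with
  | zero => simp
  | succ j ih =>
    have h1 := h j
    rw [sub_mul, Matrix.sub_mul, sub_eq_zero] at h1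
    rw [pow_succ', Matrix.mul_assoc, ih, ← Matrix.mul_assoc, h1, ← pow_succ']

lemma I3.eq {Θ : Set (Param m)} (hI3 : I3 Θ θ₀) {θ : Param m} (hθ : θ ∈ Θ)
    (hA : ∀ j : ℕ, θ.B ^ j * θ₀.A = θ₀.B ^ j * θ₀.A)
    (hΓ : ∀ j : ℕ, θ.B ^ j * θ₀.Γ = θ₀.B ^ j * θ₀.Γ) : θ.B = θ₀.B := by
  have hcol : ∀ {k : ℕ} (B : Matrix (Fin 2) (Fin 2) ℝ) (M : Matrix (Fin 2) (Fin k) ℝ) (c : Fin k),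
      B.mulVec (M.col c) = (B * M).col c := fun B M c => rfl
  refine hI3 θ hθ ?_
  rintro v (⟨c, rfl⟩ | ⟨c, rfl⟩) j -
  · rw [hcol, hcol, hA]
  · rw [hcol, hcol, hΓ]

/-- The stationary latent process identifies the parameter. -/
theorem StationaryModel.param_eq (hS : StationaryModel μ ν θ₀ dmin f)
    (hdmin : 0 < dmin) (hν_var : ∫ e, e ^ 2 ∂ν = 1)
    (hX : ∀ j, Integrable (fun z : Path m => covar 0 z j) μ)
    {Θ : Set (Param m)} {C r K : ℝ} (hD : UniformDecay Θ C r K)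
    (hθ₀ : θ₀ ∈ Θ) (hB : ∀ i j, 0 ≤ θ₀.B i j) (hρ : specRad θ₀.B < 1)
    (hI1 : I1 μ noise covar ∨ I1' μ noise covar) (hI2 : I2 ν (μ.map (noise 0)))
    (hI3 : I3 Θ θ₀) {θ : Param m} (hθ : θ ∈ Θ)
    (h : ∀ᵐ z ∂μ, latentSeries ν f θ z = f z) : θ = θ₀ := by
  have hsumm := hS.ae_summable_discTerm hdmin hν_var hX hD.r_pos hD.r_lt_one
  have hall := ae_shiftBy hS.ergodic.toMeasurePreserving
    (p := fun z => latentSeries ν f θ z = f z) h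
  -- The difference of the two recursions over the same step, since both produce the same latent
  -- process. Once `A`, `Γ` and `B` agree, it also identifies `d`.
  have hrel : ∀ᵐ z ∂μ, (θ.A - θ₀.A).mulVec (obs ν f z) + (θ.Γ - θ₀.Γ).mulVec (covar 0 z) +
      (θ.B - θ₀.B).mulVec (f z) = θ₀.d - θ.d := by
    filter_upwards [hsumm, hall, hS.recursion'] with z h1 h2 h3
    have h4 := hD.latentSeries_succ hθ h1 0
    rw [h2, h2, zero_add, h3, shiftBy_zero, drive, drive, affineForm, affineForm] at h4
    simp only [Matrix.sub_mulVec]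
    rw [← sub_eq_zero] at h4 ⊢
    rw [← neg_eq_zero, ← h4]
    abel
  suffices hABΓ : θ.A = θ₀.A ∧ θ.Γ = θ₀.Γ ∧ θ.B = θ₀.B by
    obtain ⟨hA, hΓ, hB⟩ := hABΓ
    obtain ⟨z, hz⟩ := hrel.exists
    have hd : θ.d = θ₀.d := by
      rw [hA, hΓ, hB] at hz
      simp only [sub_self, Matrix.zero_mulVec, add_zero] at hz
      exact (sub_eq_zero.1 hz.symm).symm
    exact Prod.ext hd (Prod.ext hΓ (Prod.ext hA hB))
  rcases hI1 with hI1 | hI1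
  · obtain ⟨hA, hΓ⟩ := hS.coeffs_eq_zero_of_I1 hdmin hI2 hI1 hrel
    have hBf : ∀ᵐ z ∂μ, (θ.B - θ₀.B).mulVec (f z) = θ₀.d - θ.d := by
      filter_upwards [hrel] with z hz
      simpa [hA, hΓ] using hz
    have himp := fun j => hS.impulse_eq_zero_of_I1 hdmin hI2 hI1 j hBf
    exact ⟨sub_eq_zero.1 hA, sub_eq_zero.1 hΓ, hI3.eq hθ
      (pow_mul_eq_of_impulse fun j => (himp j).1) (pow_mul_eq_of_impulse fun j => (himp j).2)⟩
  · obtain ⟨hind, hseries⟩ := hI1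
    have hZm : Measurable[covarField m] fun z : Path m =>
        θ₀.d - θ.d - (θ.Γ - θ₀.Γ).mulVec (covar 0 z) :=
      (measurable_const.sub (measurable_mulVec_const (θ.Γ - θ₀.Γ)) :
        Measurable fun v => θ₀.d - θ.d - (θ.Γ - θ₀.Γ).mulVec v).comp
        (measurable_covar_covarField 0)
    have hA : θ.A - θ₀.A = 0 := by
      refine hS.matrix_eq_zero hdmin hI2 (sup_le (noisePast_le_pathPast.trans (pathPast_le _))
        covarField_le) pathPast_le_noisePast_sup (hS.indep_noisePast_sup hind)
        (measurable_sub_mulVec 0 (θ.B - θ₀.B)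
          (hS.measurable_latent.mono pathPast_le_noisePast_sup le_rfl)
          (hZm.mono le_sup_right le_rfl)) ?_
      filter_upwards [hrel] with z hz
      rw [← hz]
      abel
    have hBf : ∀ᵐ z ∂μ, (θ.B - θ₀.B).mulVec (f z) =
        θ₀.d - θ.d - (θ.Γ - θ₀.Γ).mulVec (covar 0 z) := by
      filter_upwards [hrel] with z hz
      rw [← hz, hA]
      simp
    have hpowA := pow_mul_eq_of_impulse fun j =>
      hS.impulse_eq_zero_of_indep hdmin hI2 hind j hZm hBf
    have hA' : θ.A = θ₀.A := sub_eq_zero.1 hA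
    have hdsumm : ∀ {θ : Param m}, θ ∈ Θ → ∀ i, Summable fun j : ℕ => (θ.B ^ j).mulVec θ.d i :=
      fun {θ} hθ i => by
        refine Summable.of_norm_bounded (((summable_geometric_of_lt_one hD.r_pos.le
          hD.r_lt_one).mul_left (C * K))) fun j => ?_
        refine le_trans ?_ (hD.coeffSize_le hθ j)
        rw [coeffSize, Real.norm_eq_abs]
        have h1 := Finset.single_le_sum (f := fun i => |(θ.B ^ j).mulVec θ.d i|)
          (fun i _ => abs_nonneg _) (Finset.mem_univ i)
        have h2 := entrySum_nonneg (θ.B ^ j * θ.A)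
        have h3 := entrySum_nonneg (θ.B ^ j * θ.Γ)
        have h4 : |(θ.B ^ j).mulVec θ.d i| ≤ ∑ i, |(θ.B ^ j).mulVec θ.d i| := h1
        linarith
    have h0 := hS.latentSeries_eq hdmin hν_var hX hD hθ₀ hB hρ
    -- Both series represent the same latent vector. Their observation parts cancel, because `A =
    -- A₀` and the impulse responses to the observations agree; a vanishing covariate series plus a
    -- constant is left, as in (I1').
    have hΦ : ∀ᵐ z ∂μ, HasSum (fun j : ℕ => (θ.B ^ j * θ.Γ - θ₀.B ^ j * θ₀.Γ).mulVec
        (covar (-((j : ℤ) + 1)) z))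
        (-(fun i => ∑' j : ℕ, ((θ.B ^ j).mulVec θ.d i - (θ₀.B ^ j).mulVec θ₀.d i))) := by
      filter_upwards [hsumm, h, h0] with z h1 h2 h3
      have hz : Summable (discTerm ν f r z) := by simpa using h1 0
      have h3' : latentSeries ν f θ₀ z = f z := by simpa using h3 0
      refine Pi.hasSum.2 fun i => ?_
      have e1 := ((hD.summable_seriesTerm hθ hz i).hasSum.sub
        (hD.summable_seriesTerm hθ₀ hz i).hasSum)
      have e2 : (∑' j : ℕ, (θ.B ^ j).mulVec (drive ν f θ (shiftBy (-((j : ℤ) + 1)) z)) i) -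
          ∑' j : ℕ, (θ₀.B ^ j).mulVec (drive ν f θ₀ (shiftBy (-((j : ℤ) + 1)) z)) i = 0 := by
        rw [sub_eq_zero]
        exact congrFun (h2.trans h3'.symm) i
      rw [e2] at e1
      have e3 := e1.sub ((hdsumm hθ i).sub (hdsumm hθ₀ i)).hasSum
      rw [zero_sub] at e3
      refine e3.congr_fun fun j => ?_
      rw [seriesTerm_eq, seriesTerm_eq, affineForm, affineForm, hA', hpowA j]
      simp only [Pi.add_apply, Matrix.sub_mulVec, Pi.sub_apply, covar_shiftBy, zero_add]
      ring
    -- The coefficient of index zero identifies `Γ`; the others then say that the powers of `B` and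
    -- `B₀` agree on the columns of `Γ₀`.
    obtain ⟨hΦ0, -⟩ := hseries _ _ hΦ
    have hΓ' : θ.Γ = θ₀.Γ := by
      have := hΦ0 0
      simpa [sub_eq_zero] using this
    refine ⟨hA', hΓ', hI3.eq hθ hpowA fun j => ?_⟩
    have := hΦ0 j
    rw [hΓ'] at this
    exact sub_eq_zero.1 this

end Identification

/-! ### Lower bounds for differences of the contrast -/

section Contrast

/-- A lower bound for the difference of the contrasts at two latent vectors which are known up to
errors `ρ` (around `b`) and `ε` (around `a`); the logarithm is truncated from above. -/
def contrastLower (dmin : ℝ) (o a b : Fin 2 → ℝ) (ρ ε : ℝ) : ℝ :=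
  o 0 * (1 / (b 0 + ρ) - 1 / max dmin (a 0 - ε)) +
    (Real.log (max dmin (b 0 - ρ)) - Real.log (a 0 + ε) + (b 1 - ρ) - (a 1 + ε)) +
    o 1 * min (Real.log (max dmin (a 1 - ε) / (b 1 + ρ))) 1

lemma contrastLower_le {dmin : ℝ} (hdmin : 0 < dmin) (y : ℝ × ℕ) {a b a' b' : Fin 2 → ℝ}
    {ρ ε : ℝ} (ha' : ∀ i, dmin ≤ a' i) (hb' : ∀ i, dmin ≤ b' i) (ha : ∀ i, |a' i - a i| ≤ ε)
    (hb : ∀ i, |b' i - b i| ≤ ρ) :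
    contrastLower dmin (transformed y) a b ρ ε ≤
      (contrastGaussian y.1 (b' 0) + contrastPoisson y.2 (b' 1)) -
        (contrastGaussian y.1 (a' 0) + contrastPoisson y.2 (a' 1)) := by
  have ha0 := abs_le.1 (ha 0)
  have ha1 := abs_le.1 (ha 1)
  have hb0 := abs_le.1 (hb 0)
  have hb1 := abs_le.1 (hb 1)
  have pa0 := hdmin.trans_le (ha' 0)
  have pa1 := hdmin.trans_le (ha' 1)
  have pb0 := hdmin.trans_le (hb' 0)
  have pb1 := hdmin.trans_le (hb' 1)
  have hma : ∀ i, max dmin (a i - ε) ≤ a' i := fun i =>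
    max_le (ha' i) (by have := abs_le.1 (ha i); linarith)
  have hmpos : ∀ x, 0 < max dmin x := fun x => hdmin.trans_le (le_max_left _ _)
  have h1 : y.1 ^ 2 * (1 / (b 0 + ρ) - 1 / max dmin (a 0 - ε)) ≤ y.1 ^ 2 / b' 0 - y.1 ^ 2 / a' 0 := by
    rw [div_eq_mul_one_div (y.1 ^ 2) (b' 0), div_eq_mul_one_div (y.1 ^ 2) (a' 0), ← mul_sub]
    refine mul_le_mul_of_nonneg_left (sub_le_sub ?_ ?_) (sq_nonneg _)
    · exact one_div_le_one_div_of_le pb0 (by linarith)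
    · exact one_div_le_one_div_of_le (hmpos _) (hma 0)
  have h2 : Real.log (max dmin (b 0 - ρ)) ≤ Real.log (b' 0) :=
    Real.log_le_log (hmpos _) (max_le (hb' 0) (by linarith))
  have h3 : Real.log (a' 0) ≤ Real.log (a 0 + ε) := Real.log_le_log pa0 (by linarith)
  have h4 : (y.2 : ℝ) * min (Real.log (max dmin (a 1 - ε) / (b 1 + ρ))) 1 ≤
      (y.2 : ℝ) * (Real.log (a' 1) - Real.log (b' 1)) := by
    refine mul_le_mul_of_nonneg_left ((min_le_left _ _).trans ?_) (Nat.cast_nonneg _)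
    rw [← Real.log_div pa1.ne' pb1.ne']
    exact Real.log_le_log (div_pos (hmpos _) (by linarith))
      (div_le_div₀ pa1.le (hma 1) pb1 (by linarith))
  simp only [contrastLower, contrastGaussian, contrastPoisson, transformed, Matrix.cons_val_zero,
    Matrix.cons_val_one]
  linarith

/-- The truncated logarithmic weight in the lower bound. -/
lemma abs_min_log_le {x : ℝ} : |min (Real.log x) 1| ≤ 1 + max 0 (-Real.log x) := by
  rcases le_total 0 (Real.log x) with h | h
  · rw [abs_of_nonneg (le_min h zero_le_one)]
    linarith [min_le_right (Real.log x) 1, le_max_left 0 (-Real.log x)]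
  · rw [min_eq_left (h.trans zero_le_one), abs_of_nonpos h]
    linarith [le_max_right 0 (-Real.log x)]

lemma abs_log_le_of_le {dmin x : ℝ} (hdmin : 0 < dmin) (hx : dmin ≤ x) :
    |Real.log x| ≤ |Real.log dmin| + x := by
  have hx0 := hdmin.trans_le hx
  have h1 := Real.log_le_log hdmin hx
  have h2 := Real.log_le_sub_one_of_pos hx0
  rw [abs_le]
  constructor
  · linarith [neg_abs_le (Real.log dmin)]
  · linarith [abs_nonneg (Real.log dmin)]

/-- An envelope for the lower bound, uniform in the errors. -/
def contrastEnvelope (dmin : ℝ) (o a b : Fin 2 → ℝ) (R : ℝ) : ℝ :=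
  o 0 * (2 / dmin) + (2 * |Real.log dmin| + b 0 + a 0 + b 1 + a 1 + R + 2) +
    o 1 * (1 + max 0 (Real.log ((1 + 1 / dmin) * (b 1 + R) / a 1)))

lemma abs_contrastLower_le {dmin : ℝ} (hdmin : 0 < dmin) {o a b : Fin 2 → ℝ} {ρ ε R : ℝ}
    (ho : ∀ i, 0 ≤ o i) (ha : ∀ i, dmin ≤ a i) (hb : ∀ i, dmin ≤ b i) (hρ : 0 ≤ ρ) (hρR : ρ ≤ R)
    (hε : 0 ≤ ε) (hε1 : ε ≤ 1) :
    |contrastLower dmin o a b ρ ε| ≤ contrastEnvelope dmin o a b R := by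
  have hmpos : ∀ x, 0 < max dmin x := fun x => hdmin.trans_le (le_max_left _ _)
  have pa : ∀ i, 0 < a i := fun i => hdmin.trans_le (ha i)
  have pb : ∀ i, 0 < b i := fun i => hdmin.trans_le (hb i)
  have e1 : |o 0 * (1 / (b 0 + ρ) - 1 / max dmin (a 0 - ε))| ≤ o 0 * (2 / dmin) := by
    rw [abs_mul, abs_of_nonneg (ho 0)]
    refine mul_le_mul_of_nonneg_left ?_ (ho 0)
    have i1 : 1 / (b 0 + ρ) ≤ 1 / dmin := one_div_le_one_div_of_le hdmin (by linarith [hb 0])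
    have i2 : 1 / max dmin (a 0 - ε) ≤ 1 / dmin := one_div_le_one_div_of_le hdmin (le_max_left _ _)
    have i3 : 0 ≤ 1 / (b 0 + ρ) := by have := pb 0; positivity
    have i4 : 0 ≤ 1 / max dmin (a 0 - ε) := (one_div_pos.2 (hmpos _)).le
    refine (abs_sub _ _).trans ?_
    rw [abs_of_nonneg i3, abs_of_nonneg i4]
    calc _ ≤ 1 / dmin + 1 / dmin := add_le_add i1 i2
      _ = 2 / dmin := by ring
  have e2 : |Real.log (max dmin (b 0 - ρ))| ≤ |Real.log dmin| + b 0 :=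
    (abs_log_le_of_le hdmin (le_max_left _ _)).trans
      (by linarith [max_le (hb 0) (by linarith : b 0 - ρ ≤ b 0)])
  have e3 : |Real.log (a 0 + ε)| ≤ |Real.log dmin| + (a 0 + 1) :=
    (abs_log_le_of_le hdmin (by linarith [ha 0])).trans (by linarith)
  have e4 : |o 1 * min (Real.log (max dmin (a 1 - ε) / (b 1 + ρ))) 1| ≤
      o 1 * (1 + max 0 (Real.log ((1 + 1 / dmin) * (b 1 + R) / a 1))) := by
    rw [abs_mul, abs_of_nonneg (ho 1)]
    refine mul_le_mul_of_nonneg_left (abs_min_log_le.trans ?_) (ho 1)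
    refine add_le_add le_rfl (max_le_max le_rfl ?_)
    rw [← Real.log_inv, inv_div]
    have hbρ : 0 < b 1 + ρ := by linarith [pb 1]
    refine Real.log_le_log (div_pos hbρ (hmpos _)) ?_
    -- With `ε ≤ 1`, `a` exceeds the truncated value by at most one, and one is at most `1 / dmin`
    -- times that value.
    have hca : a 1 ≤ (1 + 1 / dmin) * max dmin (a 1 - ε) := by
      have j1 : 1 ≤ 1 / dmin * max dmin (a 1 - ε) := by
        rw [one_div, inv_mul_eq_div, le_div_iff₀ hdmin, one_mul]
        exact le_max_left _ _
      have j2 := le_max_right dmin (a 1 - ε)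
      linarith
    rw [div_le_div_iff₀ (hmpos _) (pa 1)]
    calc (b 1 + ρ) * a 1 ≤ (b 1 + R) * ((1 + 1 / dmin) * max dmin (a 1 - ε)) :=
          mul_le_mul (by linarith) hca (pa 1).le (by linarith)
      _ = _ := by ring
  have hR : 0 ≤ R := hρ.trans hρR
  have e5 : |Real.log (max dmin (b 0 - ρ)) - Real.log (a 0 + ε) + (b 1 - ρ) - (a 1 + ε)| ≤
      2 * |Real.log dmin| + b 0 + a 0 + b 1 + a 1 + R + 2 := by
    rw [abs_le] at e2 e3 ⊢
    constructor
    · linarith [pb 1]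
    · linarith [pa 1]
  exact (abs_add_three _ _ _).trans (add_le_add (add_le_add e1 e5) e4)

lemma tendsto_contrastLower {dmin : ℝ} (hdmin : 0 < dmin) (o : Fin 2 → ℝ) {a b : Fin 2 → ℝ}
    (ha : ∀ i, dmin ≤ a i) (hb : ∀ i, dmin ≤ b i) {ρ ε : ℕ → ℝ} (hρ : Tendsto ρ atTop (𝓝 0))
    (hε : Tendsto ε atTop (𝓝 0)) :
    Tendsto (fun n => contrastLower dmin o a b (ρ n) (ε n)) atTop
      (𝓝 (contrastLower dmin o a b 0 0)) := by
  have hmpos : ∀ x, 0 < max dmin x := fun x => hdmin.trans_le (le_max_left _ _)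
  have pa : ∀ i, 0 < a i := fun i => hdmin.trans_le (ha i)
  have pb : ∀ i, 0 < b i := fun i => hdmin.trans_le (hb i)
  have hbρ : ∀ i, Tendsto (fun n => b i + ρ n) atTop (𝓝 (b i + 0)) := fun i => hρ.const_add _
  have haε : ∀ i, Tendsto (fun n => a i + ε n) atTop (𝓝 (a i + 0)) := fun i => hε.const_add _
  have hbρ' : ∀ i, Tendsto (fun n => b i - ρ n) atTop (𝓝 (b i - 0)) := fun i => hρ.const_sub _
  have haε' : ∀ i, Tendsto (fun n => max dmin (a i - ε n)) atTop (𝓝 (max dmin (a i - 0))) :=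
    fun i => tendsto_const_nhds.max (hε.const_sub _)
  have hb0 : ∀ i, b i + 0 ≠ 0 := fun i => by rw [add_zero]; exact (pb i).ne'
  have ha0 : ∀ i, a i + 0 ≠ 0 := fun i => by rw [add_zero]; exact (pa i).ne'
  unfold contrastLower
  refine ((Tendsto.const_mul _ ((tendsto_const_nhds.div (hbρ 0) (hb0 0)).sub
    (tendsto_const_nhds.div (haε' 0) (hmpos _).ne'))).add
    ((((tendsto_const_nhds.max (hbρ' 0)).log (hmpos _).ne').sub ((haε 0).log (ha0 0))).add
      (hbρ' 1) |>.sub (haε 1))).add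
    (Tendsto.const_mul _ (((((haε' 1).div (hbρ 1) (hb0 1)).log ?_)).min tendsto_const_nhds))
  exact div_ne_zero (hmpos _).ne' (hb0 1)

/-- The conditional mean of the lower bound without errors. -/
def contrastGap (a b : Fin 2 → ℝ) : ℝ :=
  a 0 * (1 / b 0 - 1 / a 0) + (Real.log (b 0) - Real.log (a 0) + b 1 - a 1) +
    a 1 * min (Real.log (a 1 / b 1)) 1

/-- This is `x - 1 - log x` at `x = a / b`. -/
lemma gaussianGap_nonneg {a b : ℝ} (ha : 0 < a) (hb : 0 < b) :
    0 ≤ a * (1 / b - 1 / a) + (Real.log b - Real.log a) ∧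
      (a * (1 / b - 1 / a) + (Real.log b - Real.log a) = 0 → a = b) := by
  have h1 : a * (1 / b - 1 / a) + (Real.log b - Real.log a) = a / b - 1 - Real.log (a / b) := by
    rw [Real.log_div ha.ne' hb.ne']
    field_simp
    ring
  have hab : 0 < a / b := div_pos ha hb
  rw [h1]
  refine ⟨by linarith [Real.log_le_sub_one_of_pos hab], fun h => ?_⟩
  by_contra hne
  have := Real.log_lt_sub_one_of_pos hab (fun h => hne ((div_eq_one_iff_eq hb.ne').1 h))
  linarith

/-- Where the truncation is inactive this is `a (x - 1 - log x)` at `x = b / a`. Where it is active,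
level one makes `a` cancel and leaves `b > 0`, so strict positivity survives. -/
lemma poissonGap_nonneg {a b : ℝ} (ha : 0 < a) (hb : 0 < b) :
    0 ≤ b - a + a * min (Real.log (a / b)) 1 ∧
      (b - a + a * min (Real.log (a / b)) 1 = 0 → a = b) := by
  rcases le_total (Real.log (a / b)) 1 with h | h
  · have hba : 0 < b / a := div_pos hb ha
    have h1 : b - a + a * min (Real.log (a / b)) 1 = a * (b / a - 1 - Real.log (b / a)) := by
      rw [min_eq_left h, Real.log_div ha.ne' hb.ne', Real.log_div hb.ne' ha.ne']
      field_simp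
      ring
    rw [h1]
    refine ⟨mul_nonneg ha.le (by linarith [Real.log_le_sub_one_of_pos hba]), fun h0 => ?_⟩
    by_contra hne
    have h2 := Real.log_lt_sub_one_of_pos hba (fun h => hne ((div_eq_one_iff_eq ha.ne').1 h).symm)
    have := mul_pos ha (by linarith : 0 < b / a - 1 - Real.log (b / a))
    linarith
  · rw [min_eq_right h]
    refine ⟨by linarith, fun h0 => ?_⟩
    linarith

lemma contrastGap_nonneg {a b : Fin 2 → ℝ} (ha : ∀ i, 0 < a i) (hb : ∀ i, 0 < b i) :
    0 ≤ contrastGap a b := by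
  have h1 := (gaussianGap_nonneg (ha 0) (hb 0)).1
  have h2 := (poissonGap_nonneg (ha 1) (hb 1)).1
  rw [contrastGap]
  linarith

lemma eq_of_contrastGap_eq_zero {a b : Fin 2 → ℝ} (ha : ∀ i, 0 < a i) (hb : ∀ i, 0 < b i)
    (h : contrastGap a b = 0) : a = b := by
  have h1 := (gaussianGap_nonneg (ha 0) (hb 0))
  have h2 := (poissonGap_nonneg (ha 1) (hb 1))
  rw [contrastGap] at h
  funext i
  fin_cases i
  · exact h1.2 (by linarith [h1.1, h2.1])
  · exact h2.2 (by linarith [h1.1, h2.1])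

lemma contrastLower_zero {dmin : ℝ} (o : Fin 2 → ℝ) {a b : Fin 2 → ℝ} (ha : ∀ i, dmin ≤ a i)
    (hb : ∀ i, dmin ≤ b i) : contrastLower dmin o a b 0 0 =
      o 0 * (1 / b 0 - 1 / a 0) + (Real.log (b 0) - Real.log (a 0) + b 1 - a 1) +
        o 1 * min (Real.log (a 1 / b 1)) 1 := by
  simp only [contrastLower, add_zero, sub_zero, max_eq_right (ha _), max_eq_right (hb _)]

lemma measurable_contrastLower {α : Type*} [MeasurableSpace α] (dmin : ℝ) {o a b : α → Fin 2 → ℝ}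
    {ρ : α → ℝ} (ho : Measurable o) (ha : Measurable a) (hb : Measurable b) (hρ : Measurable ρ)
    (ε : ℝ) : Measurable fun z => contrastLower dmin (o z) (a z) (b z) (ρ z) ε := by
  unfold contrastLower
  fun_prop

end Contrast

/-! ### Integrability and positive mean of the lower bounds. -/

section PositiveMean

variable {m : ℕ} {μ : Measure (Path m)} [IsProbabilityMeasure μ] {ν : Measure ℝ}
  [IsProbabilityMeasure ν] {θ₀ : Param m} {dmin : ℝ} {f : Path m → Fin 2 → ℝ}

/-- The envelope of the lower bound is integrable. -/
lemma StationaryModel.integrable_contrastEnvelope (hS : StationaryModel μ ν θ₀ dmin f)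
    (hdmin : 0 < dmin) (hν_var : ∫ e, e ^ 2 ∂ν = 1) {b : Path m → Fin 2 → ℝ} {R : Path m → ℝ}
    (hb : Measurable[pathPast m (-1)] b) (hR : Measurable[pathPast m (-1)] R)
    (hbi : ∀ i, Integrable (fun z => b z i) μ) (hRi : Integrable R μ)
    (hbd : ∀ᵐ z ∂μ, ∀ i, dmin ≤ b z i) (hR0 : ∀ᵐ z ∂μ, 0 ≤ R z) :
    Integrable (fun z => contrastEnvelope dmin (obs ν f z) (f z) (b z) (R z)) μ := by
  have hfm := hS.measurable_latent
  have hw : Measurable[pathPast m (-1)] fun z =>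
      1 + max 0 (Real.log ((1 + 1 / dmin) * (b z 1 + R z) / f z 1)) := by
    have hg : Measurable fun p : (Fin 2 → ℝ) × (Fin 2 → ℝ) × ℝ =>
        1 + max 0 (Real.log ((1 + 1 / dmin) * (p.1 1 + p.2.2) / p.2.1 1)) := by fun_prop
    exact @Measurable.comp _ _ _ (pathPast m (-1)) _ _ _ (fun z => (b z, f z, R z)) hg
      (hb.prodMk (hfm.prodMk hR))
  -- By `log x ≤ x` the product of `f` with the logarithm of a ratio over `f` is at most the
  -- numerator of that ratio, so first moments suffice. The tower property then replaces `f` by the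
  -- observation.
  have hint : Integrable (fun z => f z 1 *
      (1 + max 0 (Real.log ((1 + 1 / dmin) * (b z 1 + R z) / f z 1)))) μ := by
    have hg : Integrable (fun z => f z 1 + (1 + 1 / dmin) * (b z 1 + R z)) μ :=
      (hS.integrable_latent 1).add (((hbi 1).add hRi).const_mul _)
    refine hg.mono' (((measurable_pi_apply 1).comp
      (hfm.mono (pathPast_le _) le_rfl)).mul (hw.mono (pathPast_le _) le_rfl)).aestronglyMeasurable ?_
    filter_upwards [hS.ae_ge, hbd, hR0] with z h1 h2 h3
    have p1 := hdmin.trans_le (h1 1)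
    have p2 : 0 < (1 + 1 / dmin) * (b z 1 + R z) :=
      mul_pos (by positivity) (by linarith [h2 1])
    have h4 : 0 ≤ max 0 (Real.log ((1 + 1 / dmin) * (b z 1 + R z) / f z 1)) := le_max_left _ _
    rw [Real.norm_of_nonneg (mul_nonneg p1.le (by linarith)), mul_add, mul_one]
    refine add_le_add le_rfl ?_
    have h5 : max 0 (Real.log ((1 + 1 / dmin) * (b z 1 + R z) / f z 1)) ≤
        (1 + 1 / dmin) * (b z 1 + R z) / f z 1 := by
      refine max_le (div_pos p2 p1).le ?_
      linarith [Real.log_le_sub_one_of_pos (div_pos p2 p1)]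
    calc _ ≤ f z 1 * ((1 + 1 / dmin) * (b z 1 + R z) / f z 1) :=
          mul_le_mul_of_nonneg_left h5 p1.le
      _ = _ := by field_simp
  have h1 := (hS.integral_obs_mul hdmin hν_var hw 1 hint).1
  have h0 := (hS.integrable_obs hdmin hν_var 0).mul_const (2 / dmin)
  have hmid : Integrable (fun z => 2 * |Real.log dmin| + b z 0 + f z 0 + b z 1 + f z 1 +
      R z + 2) μ :=
    ((((((integrable_const _).add (hbi 0)).add (hS.integrable_latent 0)).add (hbi 1)).add
      (hS.integrable_latent 1)).add hRi).add (integrable_const _)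
  exact (h0.add hmid).add h1

/-- The limiting lower bound has positive mean unless the latent processes coincide. -/
lemma StationaryModel.integral_contrastLower_pos (hS : StationaryModel μ ν θ₀ dmin f)
    (hdmin : 0 < dmin) (hν_var : ∫ e, e ^ 2 ∂ν = 1) {b : Path m → Fin 2 → ℝ}
    (hb : Measurable[pathPast m (-1)] b) (hbi : ∀ i, Integrable (fun z => b z i) μ)
    (hbd : ∀ᵐ z ∂μ, ∀ i, dmin ≤ b z i) (hne : ¬ ∀ᵐ z ∂μ, b z = f z) :
    0 < ∫ z, contrastLower dmin (obs ν f z) (f z) (b z) 0 0 ∂μ := by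
  have hfm := hS.measurable_latent
  have hfm' := hfm.mono (pathPast_le _) (le_refl _)
  have hbm' := hb.mono (pathPast_le _) (le_refl _)
  have hpair : Measurable[pathPast m (-1)] fun z => (f z, b z) := hfm.prodMk hb
  have hw0 : Measurable[pathPast m (-1)] fun z => 1 / b z 0 - 1 / f z 0 := by
    have hg : Measurable fun p : (Fin 2 → ℝ) × (Fin 2 → ℝ) => 1 / p.2 0 - 1 / p.1 0 := by fun_prop
    exact hg.comp hpair
  have hw1 : Measurable[pathPast m (-1)] fun z => min (Real.log (f z 1 / b z 1)) 1 := by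
    have hg : Measurable fun p : (Fin 2 → ℝ) × (Fin 2 → ℝ) =>
        min (Real.log (p.1 1 / p.2 1)) 1 := by fun_prop
    exact hg.comp hpair
  have henv := hS.integrable_contrastEnvelope hdmin hν_var (R := fun _ => 0) hb measurable_const
    hbi (integrable_const _) hbd (Eventually.of_forall fun _ => le_rfl)
  have hi0 : Integrable (fun z => f z 0 * (1 / b z 0 - 1 / f z 0)) μ := by
    refine ((hS.integrable_latent 0).abs.mul_const (2 / dmin)).mono'
      (((measurable_pi_apply 0).comp hfm').mul
        (hw0.mono (pathPast_le _) le_rfl)).aestronglyMeasurable ?_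
    filter_upwards [hS.ae_ge, hbd] with z h1 h2
    rw [norm_mul, Real.norm_eq_abs, Real.norm_eq_abs]
    refine mul_le_mul_of_nonneg_left ?_ (abs_nonneg _)
    have i1 : 1 / b z 0 ≤ 1 / dmin := one_div_le_one_div_of_le hdmin (h2 0)
    have i2 : 1 / f z 0 ≤ 1 / dmin := one_div_le_one_div_of_le hdmin (h1 0)
    have i3 : 0 < 1 / b z 0 := one_div_pos.2 (hdmin.trans_le (h2 0))
    have i4 : 0 < 1 / f z 0 := one_div_pos.2 (hdmin.trans_le (h1 0))
    refine (abs_sub _ _).trans ?_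
    rw [abs_of_pos i3, abs_of_pos i4]
    calc _ ≤ 1 / dmin + 1 / dmin := add_le_add i1 i2
      _ = 2 / dmin := by ring
  have hi1 : Integrable (fun z => f z 1 * min (Real.log (f z 1 / b z 1)) 1) μ := by
    have hg : Integrable (fun z => f z 1 + b z 1) μ := (hS.integrable_latent 1).add (hbi 1)
    refine hg.mono' (((measurable_pi_apply 1).comp hfm').mul
        (hw1.mono (pathPast_le _) le_rfl)).aestronglyMeasurable ?_
    filter_upwards [hS.ae_ge, hbd] with z h1 h2
    have p1 := hdmin.trans_le (h1 1)
    have p2 := hdmin.trans_le (h2 1)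
    rw [norm_mul, Real.norm_of_nonneg p1.le, Real.norm_eq_abs]
    have h3 : max 0 (-Real.log (f z 1 / b z 1)) ≤ b z 1 / f z 1 := by
      refine max_le (div_pos p2 p1).le ?_
      rw [← Real.log_inv, inv_div]
      linarith [Real.log_le_sub_one_of_pos (div_pos p2 p1)]
    calc _ ≤ f z 1 * (1 + b z 1 / f z 1) :=
          mul_le_mul_of_nonneg_left (abs_min_log_le.trans (by linarith)) p1.le
      _ = _ := by field_simp
  have hmid : Integrable (fun z => Real.log (b z 0) - Real.log (f z 0) + b z 1 - f z 1) μ := by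
    have hlog : ∀ {c : Path m → ℝ}, Measurable c → Integrable c μ → (∀ᵐ z ∂μ, dmin ≤ c z) →
        Integrable (fun z => Real.log (c z)) μ := fun {c} hcm hci hc => by
      refine ((integrable_const |Real.log dmin|).add hci).mono'
        hcm.log.aestronglyMeasurable ?_
      filter_upwards [hc] with z hz
      exact abs_log_le_of_le hdmin hz
    exact (((hlog ((measurable_pi_apply 0).comp hbm') (hbi 0) (hbd.mono fun z h => h 0)).sub
      (hlog ((measurable_pi_apply 0).comp hfm') (hS.integrable_latent 0)
        (hS.ae_ge.mono fun z h => h 0))).add (hbi 1)).sub (hS.integrable_latent 1)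
  -- The weights depend on the past only, so the observations may be replaced by their conditional
  -- means, which turns the lower bound into `contrastGap`.
  obtain ⟨t0i, t0⟩ := hS.integral_obs_mul hdmin hν_var hw0 0 hi0
  obtain ⟨t1i, t1⟩ := hS.integral_obs_mul hdmin hν_var hw1 1 hi1
  have hgapi : Integrable (fun z => contrastGap (f z) (b z)) μ := (hi0.add hmid).add hi1
  have heq : ∫ z, contrastLower dmin (obs ν f z) (f z) (b z) 0 0 ∂μ =
      ∫ z, contrastGap (f z) (b z) ∂μ := by
    have e1 : ∫ z, contrastLower dmin (obs ν f z) (f z) (b z) 0 0 ∂μ =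
        ∫ z, (obs ν f z 0 * (1 / b z 0 - 1 / f z 0) +
          (Real.log (b z 0) - Real.log (f z 0) + b z 1 - f z 1) +
          obs ν f z 1 * min (Real.log (f z 1 / b z 1)) 1) ∂μ := by
      refine integral_congr_ae ?_
      filter_upwards [hS.ae_ge, hbd] with z h1 h2
      exact contrastLower_zero _ h1 h2
    have e2 := integral_add (t0i.add hmid) t1i
    have e3 := integral_add t0i hmid
    have e4 := integral_add (hi0.add hmid) hi1
    have e5 := integral_add hi0 hmid
    simp only [Pi.add_apply] at e2 e3 e4 e5
    rw [e1, e2, e3, t0, t1]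
    simp only [contrastGap]
    rw [e4, e5]
  rw [heq]
  have hnn : 0 ≤ᵐ[μ] fun z => contrastGap (f z) (b z) := by
    filter_upwards [hS.ae_ge, hbd] with z h1 h2
    exact contrastGap_nonneg (fun i => hdmin.trans_le (h1 i)) (fun i => hdmin.trans_le (h2 i))
  refine lt_of_le_of_ne (integral_nonneg_of_ae hnn) fun h0 => hne ?_
  have hz := (integral_eq_zero_iff_of_nonneg_ae hnn hgapi).1 h0.symm
  filter_upwards [hz, hS.ae_ge, hbd] with z h1 h2 h3
  exact (eq_of_contrastGap_eq_zero (fun i => hdmin.trans_le (h2 i))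
    (fun i => hdmin.trans_le (h3 i)) h1).symm

/-- For a parameter other than the true one, some lower bound of the contrast differences near
this parameter has positive mean. -/
theorem StationaryModel.exists_integral_contrastLower_pos (hS : StationaryModel μ ν θ₀ dmin f)
    (hdmin : 0 < dmin) (hν_var : ∫ e, e ^ 2 ∂ν = 1)
    (hX : ∀ j, Integrable (fun z : Path m => covar 0 z j) μ)
    {Θ : Set (Param m)} {C r K : ℝ} (hD : UniformDecay Θ C r K) {θ : Param m} (hθ : θ ∈ Θ)
    (hge : ∀ᵐ z ∂μ, ∀ i, dmin ≤ latentSeries ν f θ z i)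
    (hne : ¬ ∀ᵐ z ∂μ, latentSeries ν f θ z = f z) :
    ∃ N : ℕ, Measurable (fun z => contrastLower dmin (obs ν f z) (f z) (latentSeries ν f θ z)
        (oscBound ν f r (2 * (C * K)) N z + 1 / ((N : ℝ) + 1)) (1 / ((N : ℝ) + 1))) ∧
      Integrable (fun z => contrastLower dmin (obs ν f z) (f z) (latentSeries ν f θ z)
        (oscBound ν f r (2 * (C * K)) N z + 1 / ((N : ℝ) + 1)) (1 / ((N : ℝ) + 1))) μ ∧
      0 < ∫ z, contrastLower dmin (obs ν f z) (f z) (latentSeries ν f θ z)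
        (oscBound ν f r (2 * (C * K)) N z + 1 / ((N : ℝ) + 1)) (1 / ((N : ℝ) + 1)) ∂μ := by
  have hfm := hS.measurable_latent
  set L := 2 * (C * K) with hL
  have hL0 : 0 ≤ L := mul_nonneg two_pos.le (mul_nonneg hD.C_nonneg hD.K_nonneg)
  -- Each radius contains `1 / (N + 1)` for the forgotten initial value; the radius around the
  -- candidate parameter also contains the oscillation over its neighbourhood.
  set F : ℕ → Path m → ℝ := fun N z => contrastLower dmin (obs ν f z) (f z) (latentSeries ν f θ z)
    (oscBound ν f r L N z + 1 / ((N : ℝ) + 1)) (1 / ((N : ℝ) + 1)) with hF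
  set R : Path m → ℝ := fun z => (1 + L) * discSum ν f r z + 1 with hR
  have hRm : Measurable[pathPast m (-1)] R :=
    ((measurable_const_mul (1 + L)).add_const 1).comp (measurable_discSum_past hfm r)
  have hRi : Integrable R μ :=
    ((hS.integrable_discSum hdmin hν_var hX hD.r_pos hD.r_lt_one).const_mul _).add
      (integrable_const _)
  have hR0 : ∀ z, 0 ≤ R z := fun z => by
    have := discSum_nonneg (ν := ν) (f := f) hD.r_pos z
    positivity
  have hbm := measurable_latentSeries_past (ν := ν) hfm θ
  have hbi := hS.integrable_latentSeries hdmin hν_var hX hD hθ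
  have henv := hS.integrable_contrastEnvelope hdmin hν_var hbm hRm hbi hRi hge
    (Eventually.of_forall hR0)
  have hFm : ∀ N, Measurable (F N) := fun N =>
    measurable_contrastLower dmin ((measurable_obs_past hfm).mono (pathPast_le _) le_rfl)
      (hfm.mono (pathPast_le _) le_rfl) (hbm.mono (pathPast_le _) le_rfl)
      ((measurable_oscBound hfm r L N).add_const _) _
  have hε : ∀ N : ℕ, (0 : ℝ) ≤ 1 / ((N : ℝ) + 1) ∧ 1 / ((N : ℝ) + 1) ≤ 1 := fun N => by
    refine ⟨by positivity, ?_⟩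
    rw [div_le_one (by positivity)]
    linarith [(Nat.cast_nonneg N : (0 : ℝ) ≤ N)]
  have hsumm : ∀ᵐ z ∂μ, Summable (discTerm ν f r z) :=
    (hS.ae_summable_discTerm hdmin hν_var hX hD.r_pos hD.r_lt_one).mono fun z hz => by
      simpa using hz 0
  have hbound : ∀ N, ∀ᵐ z ∂μ, ‖F N z‖ ≤
      contrastEnvelope dmin (obs ν f z) (f z) (latentSeries ν f θ z) (R z) := fun N => by
    filter_upwards [hS.ae_ge, hge, hsumm] with z h1 h2 h3
    exact abs_contrastLower_le hdmin (obs_nonneg ν f z) h1 h2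
      (add_nonneg (oscBound_nonneg hD.r_pos hL0 h3 N) (hε N).1)
      (add_le_add (oscBound_le hD.r_pos hL0 z N) (hε N).2) (hε N).1 (hε N).2
  -- As `N` grows both radii vanish, so the means converge to that of the error-free lower bound,
  -- which is positive; some finite `N` already does.
  have hlim := tendsto_integral_of_dominated_convergence _
    (fun N => (hFm N).aestronglyMeasurable) henv hbound
    (f := fun z => contrastLower dmin (obs ν f z) (f z) (latentSeries ν f θ z) 0 0) (by
      filter_upwards [hS.ae_ge, hge, hsumm] with z h1 h2 h3
      refine tendsto_contrastLower hdmin _ h1 h2 ?_ tendsto_one_div_add_atTop_nhds_zero_nat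
      simpa using (tendsto_oscBound h3).add tendsto_one_div_add_atTop_nhds_zero_nat)
  have hpos := hS.integral_contrastLower_pos hdmin hν_var hbm hbi hge hne
  obtain ⟨N, hN⟩ := (hlim.eventually_const_lt hpos).exists
  exact ⟨N, hFm N, henv.mono' (hFm N).aestronglyMeasurable (hbound N), hN⟩

end PositiveMean

/-! ### Consistency of minimizers -/

instance {k l : ℕ} : SecondCountableTopology (Matrix (Fin k) (Fin l) ℝ) :=
  inferInstanceAs (SecondCountableTopology (Fin k → Fin l → ℝ))

instance {k l : ℕ} : TopologicalSpace.PseudoMetrizableSpace (Matrix (Fin k) (Fin l) ℝ) :=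
  inferInstanceAs (TopologicalSpace.PseudoMetrizableSpace (Fin k → Fin l → ℝ))

section Deterministic

variable {E : Type*} [TopologicalSpace E] {Θ V : Set E} {θ₀ : E} {h : ℕ → E → ℝ}

/-- Partial sums separate a set from a point if, up to finitely many terms, the increments are
bounded below by a sequence whose partial sums diverge. -/
lemma eventually_sum_lt_of_tendsto (hΘ : IsCompact Θ) (hh : ∀ t, 1 ≤ t → ContinuousOn (h t) Θ)
    {G : ℕ → ℝ} {T : ℕ} (hG : ∀ t, T < t → ∀ θ ∈ Θ, θ ∈ V → G t ≤ h t θ - h t θ₀)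
    (hlim : Tendsto (fun n => ∑ t ∈ Finset.Icc 1 n, G t) atTop atTop) :
    ∀ᶠ n in atTop, ∀ θ ∈ Θ, θ ∈ V →
      ∑ t ∈ Finset.Icc 1 n, h t θ₀ < ∑ t ∈ Finset.Icc 1 n, h t θ := by
  -- The terms up to `T` escape the lower bound, but their sum is continuous on a compact set and so
  -- costs only a constant.
  have hc : ContinuousOn (fun θ => ∑ t ∈ Finset.Icc 1 T, (h t θ - h t θ₀ - G t)) Θ :=
    continuousOn_finsetSum _ fun t ht =>
      ((hh t (Finset.mem_Icc.1 ht).1).sub continuousOn_const).sub continuousOn_const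
  obtain ⟨b, hb⟩ := (hΘ.image_of_continuousOn hc).bddBelow
  filter_upwards [hlim.eventually_gt_atTop (-b), eventually_ge_atTop T] with n h1 h2 θ hθ hV
  have h3 : b ≤ ∑ t ∈ Finset.Icc 1 T, (h t θ - h t θ₀ - G t) := hb ⟨θ, hθ, rfl⟩
  have h4 : ∑ t ∈ Finset.Icc 1 T, (h t θ - h t θ₀ - G t) ≤
      ∑ t ∈ Finset.Icc 1 n, (h t θ - h t θ₀ - G t) := by
    refine Finset.sum_le_sum_of_subset_of_nonneg (Finset.Icc_subset_Icc le_rfl h2) ?_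
    intro t ht ht'
    simp only [Finset.mem_Icc] at ht ht'
    linarith [hG t (by omega) θ hθ hV]
  simp only [Finset.sum_sub_distrib] at h3 h4
  linarith

/-- Local separation away from `θ₀` confines the minimizers to any neighbourhood of `θ₀`. -/
lemma eventually_separated_of_cover {S : ℕ → E → ℝ} (hΘ : IsCompact Θ) {ι : Type*} {V : ι → Set E}
    {I : Set ι} (hV : ∀ i ∈ I, IsOpen (V i)) (hcov : Θ \ {θ₀} ⊆ ⋃ i ∈ I, V i)
    (hsep : ∀ i ∈ I, ∀ᶠ n in atTop, ∀ θ ∈ Θ, θ ∈ V i → S n θ₀ < S n θ) {W : Set E}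
    (hW : W ∈ 𝓝 θ₀) : ∀ᶠ n in atTop, ∀ θ ∈ Θ, θ ∉ W → S n θ₀ < S n θ := by
  -- Removing a neighbourhood of `θ₀` restores compactness, so finitely many sets of the cover are
  -- enough.
  have hK : IsCompact (Θ \ interior W) := hΘ.diff isOpen_interior
  obtain ⟨J, hJI, hJ, hJcov⟩ := hK.elim_finite_subcover_image hV
    (fun θ hθ => hcov ⟨hθ.1, fun h => hθ.2 (h ▸ mem_interior_iff_mem_nhds.2 hW)⟩)
  filter_upwards [(eventually_all_finite hJ).2 fun i hi => hsep i (hJI hi)] with n hn θ hθ hθW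
  have := hJcov ⟨hθ, fun h => hθW (interior_subset h)⟩
  simp only [Set.mem_iUnion] at this
  obtain ⟨i, hi, hi'⟩ := this
  exact hn i hi θ hθ hi'

end Deterministic

/-! ### Positivity and continuity of the computable criterion, and existence of minimizers. -/

section Approx

variable {m : ℕ} {Θ : Set (Param m)} {l₀ : Fin 2 → ℝ} {y : ℤ → ℝ × ℕ} {x : ℤ → Fin m → ℝ}

lemma approxLatent_nonneg {θ : Param m} (hA : ∀ i j, 0 ≤ θ.A i j) (hB : ∀ i j, 0 ≤ θ.B i j)
    (hd : ∀ i, 0 ≤ θ.d i) (hΓ : ∀ t i, 0 ≤ θ.Γ.mulVec (x t) i) (hl₀ : ∀ i, 0 ≤ l₀ i) (n : ℕ)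
    (i : Fin 2) : 0 ≤ approxLatent θ l₀ y x n i := by
  induction n generalizing i with
  | zero => exact hl₀ i
  | succ n ih =>
    rw [approxLatent, latentStep_apply]
    have h1 := mulVec_nonneg' hA (transformed_nonneg (y n)) i
    have h2 := mulVec_nonneg' hB ih i
    linarith [hd i, hΓ n i]

/-- Time zero is excluded since the initial value may vanish; the criterion only involves times from
one on. -/
lemma approxLatent_ge {θ : Param m} (hA : ∀ i j, 0 ≤ θ.A i j) (hB : ∀ i j, 0 ≤ θ.B i j) {dmin : ℝ}
    (hdmin : 0 < dmin) (hd : ∀ i, dmin ≤ θ.d i) (hΓ : ∀ t i, 0 ≤ θ.Γ.mulVec (x t) i)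
    (hl₀ : ∀ i, 0 ≤ l₀ i) {n : ℕ} (hn : 1 ≤ n) (i : Fin 2) :
    dmin ≤ approxLatent θ l₀ y x n i := by
  obtain ⟨n, rfl⟩ := Nat.exists_eq_add_of_le' hn
  rw [approxLatent, latentStep_apply]
  have h1 := mulVec_nonneg' hA (transformed_nonneg (y n)) i
  have h2 := mulVec_nonneg' hB
    (approxLatent_nonneg (y := y) hA hB (fun i => hdmin.le.trans (hd i)) hΓ hl₀ n) i
  linarith [hd i, hΓ n i]

lemma continuous_approxLatent (n : ℕ) : Continuous fun θ : Param m => approxLatent θ l₀ y x n := by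
  induction n with
  | zero => exact continuous_const
  | succ n ih =>
    simp only [approxLatent, latentStep]
    exact ((continuous_Param_d.add (continuous_Param_B.matrix_mulVec ih)).add
      (continuous_Param_A.matrix_mulVec continuous_const)).add
      (continuous_Param_Γ.matrix_mulVec continuous_const)

/-- The contribution of time `t` to the criterion. -/
def contrastTerm (l₀ : Fin 2 → ℝ) (y : ℤ → ℝ × ℕ) (x : ℤ → Fin m → ℝ) (t : ℕ) (θ : Param m) : ℝ :=
  contrastGaussian (y t).1 (approxLatent θ l₀ y x t 0) +
    contrastPoisson (y t).2 (approxLatent θ l₀ y x t 1)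

lemma continuousOn_contrastTerm {dmin : ℝ} (hdmin : 0 < dmin) {t : ℕ}
    (hge : ∀ θ ∈ Θ, ∀ i, dmin ≤ approxLatent θ l₀ y x t i) :
    ContinuousOn (contrastTerm l₀ y x t) Θ := by
  have hc : ∀ i, ContinuousOn (fun θ : Param m => approxLatent θ l₀ y x t i) Θ := fun i =>
    ((continuous_apply i).comp (continuous_approxLatent t)).continuousOn
  have h0 : ∀ i, ∀ θ ∈ Θ, approxLatent θ l₀ y x t i ≠ 0 := fun i θ hθ =>
    (hdmin.trans_le (hge θ hθ i)).ne'
  unfold contrastTerm contrastGaussian contrastPoisson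
  exact ((continuousOn_const.div (hc 0) (h0 0)).add ((hc 0).log (h0 0))).add
    ((hc 1).sub (continuousOn_const.mul ((hc 1).log (h0 1))))

lemma exists_isPMLE (hΘ : IsCompact Θ) (hne : Θ.Nonempty)
    (hc : ∀ t, 1 ≤ t → ContinuousOn (contrastTerm l₀ y x t) Θ) (n : ℕ) :
    ∃ θ', IsPMLE Θ l₀ y x n θ' :=
  hΘ.exists_isMinOn hne (continuousOn_const.mul
    (continuousOn_finsetSum _ fun t ht => hc t (Finset.mem_Icc.1 ht).1))

lemma IsPMLE.mem_of_separated {θ₀ θ' : Param m} {W : Set (Param m)} {n : ℕ} (hn : 1 ≤ n)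
    (h : IsPMLE Θ l₀ y x n θ') (hθ₀ : θ₀ ∈ Θ)
    (hsep : ∀ θ ∈ Θ, θ ∉ W → ∑ t ∈ Finset.Icc 1 n, contrastTerm l₀ y x t θ₀ <
      ∑ t ∈ Finset.Icc 1 n, contrastTerm l₀ y x t θ) : θ' ∈ W := by
  by_contra hW
  have hn' : (0 : ℝ) < (n : ℝ)⁻¹ := inv_pos.2 (Nat.cast_pos.2 hn)
  have h1 : criterion l₀ y x n θ' ≤ criterion l₀ y x n θ₀ := h.2 hθ₀
  exact absurd h1 (not_le.2 (mul_lt_mul_of_pos_left (hsep θ' h.1 hW) hn'))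

end Approx

/-! ### Strong consistency on the path space. -/

section PathConsistency

variable {m : ℕ} {μ : Measure (Path m)} {ν : Measure ℝ} {θ₀ : Param m} {dmin : ℝ}
  {f : Path m → Fin 2 → ℝ} {Θ : Set (Param m)}

/-- Nonnegativity of the covariate effects holds simultaneously for all parameters and times. -/
lemma ae_forall_mulVec_covar_nonneg (hmp : MeasurePreserving shift μ μ)
    (hΓ : ∀ θ ∈ Θ, ∀ᵐ z ∂μ, ∀ i, 0 ≤ θ.Γ.mulVec (covar 0 z) i) :
    ∀ᵐ z ∂μ, ∀ θ ∈ Θ, ∀ t i, 0 ≤ θ.Γ.mulVec (covar t z) i := by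
  -- A countable dense subset merges the null sets, and the inequality, being closed in `θ`, extends
  -- to all of `Θ`.
  obtain ⟨D, hDΘ, hD, hΘD⟩ :=
    (TopologicalSpace.IsSeparable.of_separableSpace Θ).exists_countable_dense_subset
  have h0 : ∀ᵐ z ∂μ, ∀ θ ∈ D, ∀ i, 0 ≤ θ.Γ.mulVec (covar 0 z) i :=
    (ae_ball_iff hD).2 fun θ hθ => hΓ θ (hDΘ hθ)
  filter_upwards [ae_shiftBy hmp h0] with z hz θ hθ t i
  have hcl : IsClosed {θ : Param m | 0 ≤ θ.Γ.mulVec (covar t z) i} :=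
    isClosed_le continuous_const ((continuous_apply i).comp
      (continuous_Param_Γ.matrix_mulVec continuous_const))
  refine closure_minimal (fun θ' hθ' => ?_) hcl (hΘD hθ)
  have := hz t θ' hθ' i
  simpa using this

variable [IsProbabilityMeasure μ] [IsProbabilityMeasure ν]

/-- Around any parameter other than the true one the criterion eventually exceeds its value at
the true parameter. -/
lemma StationaryModel.exists_isOpen_separated (hS : StationaryModel μ ν θ₀ dmin f)
    (hdmin : 0 < dmin) (hν_var : ∫ e, e ^ 2 ∂ν = 1)
    (hX : ∀ j, Integrable (fun z : Path m => covar 0 z j) μ) (hΘ : IsCompact Θ)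
    (hnn : ∀ θ ∈ Θ, (∀ i j, 0 ≤ θ.A i j) ∧ (∀ i j, 0 ≤ θ.B i j))
    (hd : ∀ θ ∈ Θ, ∀ i, dmin ≤ θ.d i)
    (hΓ : ∀ᵐ z ∂μ, ∀ θ ∈ Θ, ∀ t i, 0 ≤ θ.Γ.mulVec (covar t z) i)
    {C r K : ℝ} (hD : UniformDecay Θ C r K) (hθ₀ : θ₀ ∈ Θ) (hρB : specRad θ₀.B < 1)
    {l₀ : Fin 2 → ℝ} (hl₀ : ∀ i, 0 ≤ l₀ i) {θ₁ : Param m} (hθ₁ : θ₁ ∈ Θ)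
    (hne : ¬ ∀ᵐ z ∂μ, latentSeries ν f θ₁ z = f z) :
    ∃ V : Set (Param m), IsOpen V ∧ θ₁ ∈ V ∧ ∀ᵐ z ∂μ, ∀ᶠ n in atTop, ∀ θ ∈ Θ, θ ∈ V →
      ∑ t ∈ Finset.Icc 1 n, contrastTerm l₀ (fun t => observe ν (f (shiftBy t z)) (noise t z))
        (fun t => covar t z) t θ₀ <
      ∑ t ∈ Finset.Icc 1 n, contrastTerm l₀ (fun t => observe ν (f (shiftBy t z)) (noise t z))
        (fun t => covar t z) t θ := by
  have hmp := hS.ergodic.toMeasurePreserving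
  have hsumm := hS.ae_summable_discTerm hdmin hν_var hX hD.r_pos hD.r_lt_one
  have hge : ∀ᵐ z ∂μ, ∀ i, dmin ≤ latentSeries ν f θ₁ z i := by
    filter_upwards [hsumm, hΓ] with z h1 h2 i
    simpa using hD.latentSeries_ge hθ₁ (hnn θ₁ hθ₁).1 (hnn θ₁ hθ₁).2 hdmin (hd θ₁ hθ₁) h1
      (h2 θ₁ hθ₁) 0 i
  obtain ⟨N, hGm, hGi, hGpos⟩ :=
    hS.exists_integral_contrastLower_pos hdmin hν_var hX hD hθ₁ hge hne
  set G : Path m → ℝ := fun z => contrastLower dmin (obs ν f z) (f z) (latentSeries ν f θ₁ z)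
    (oscBound ν f r (2 * (C * K)) N z + 1 / ((N : ℝ) + 1)) (1 / ((N : ℝ) + 1)) with hG
  obtain ⟨V, hV, hVo, hθ₁V⟩ :=
    eventually_nhds_iff.1 (hD.eventually_abs_latentSeries_sub_le (ν := ν) (f := f) hθ₁ N)
  refine ⟨V, hVo, hθ₁V, ?_⟩
  filter_upwards [hsumm, hΓ, ae_tendsto_birkhoffSum_atTop hS.ergodic hGm hGi hGpos,
    hS.latentSeries_eq hdmin hν_var hX hD hθ₀ (hnn θ₀ hθ₀).2 hρB] with z hz hΓz hbirk heq
  set y : ℤ → ℝ × ℕ := fun t => observe ν (f (shiftBy t z)) (noise t z) with hy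
  set x : ℤ → Fin m → ℝ := fun t => covar t z with hx
  have happrox : ∀ θ ∈ Θ, ∀ t, 1 ≤ t → ∀ i, dmin ≤ approxLatent θ l₀ y x t i := fun θ hθ t ht i =>
    approxLatent_ge (hnn θ hθ).1 (hnn θ hθ).2 hdmin (hd θ hθ) (hΓz θ hθ) hl₀ ht i
  have herr : ∀ᶠ t : ℕ in atTop,
      C * r ^ t * (∑ i, |l₀ i| + C * K * discSum ν f r z) < 1 / ((N : ℝ) + 1) := by
    have h1 := ((tendsto_pow_atTop_nhds_zero_of_lt_one hD.r_pos.le hD.r_lt_one).const_mul C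
      ).mul_const (∑ i, |l₀ i| + C * K * discSum ν f r z)
    rw [mul_zero, zero_mul] at h1
    exact h1.eventually_lt_const (by positivity)
  -- Beyond this path-dependent time the effect of the initial value is below `1 / (N + 1)`,
  -- uniformly over `Θ`.
  obtain ⟨T, hT⟩ := eventually_atTop.1 herr
  refine eventually_sum_lt_of_tendsto (G := fun t : ℕ => G (shiftBy t z)) (T := T) hΘ
    (fun t ht => continuousOn_contrastTerm hdmin fun θ hθ => happrox θ hθ t ht) ?_ ?_
  · intro t ht θ hθ hθV
    have h1 : obs ν f (shiftBy t z) = transformed (y t) := by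
      simp [obs, transObs, hy]
    simp only [hG, h1]
    have ht1 : 1 ≤ t := by omega
    have hε := (hT t ht.le).le
    refine contrastLower_le hdmin (y t) (happrox θ₀ hθ₀ t ht1) (happrox θ hθ t ht1) ?_ ?_
    · intro i
      have := hD.abs_approxLatent_sub_le hθ₀ hz l₀ t i
      rw [heq t] at this
      exact this.trans hε
    · intro i
      have h2 := hD.abs_approxLatent_sub_le hθ hz l₀ t i
      have h3 := hV θ hθV hθ (shiftBy t z) (hz t) i
      refine (abs_sub_le _ (latentSeries ν f θ (shiftBy t z) i) _).trans ?_
      rw [add_comm]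
      exact add_le_add h3 (h2.trans hε)
  -- The Birkhoff sum over times `0, …, n` becomes the sum over `1, …, n` by removing its first
  -- term.
  · have h1 := tendsto_atTop_add_const_right _ (-G z) (hbirk.comp (tendsto_add_atTop_nat 1))
    refine h1.congr fun n => ?_
    simp only [Function.comp_apply, birkhoffSum, iterate_shift]
    induction n with
    | zero => simp
    | succ n ih =>
      rw [Finset.sum_range_succ, Finset.sum_Icc_succ_top (by omega), ← ih]
      ring

/-- Existence and strong consistency of the estimator on the path space. -/
theorem StationaryModel.ae_consistent (hS : StationaryModel μ ν θ₀ dmin f)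
    (hdmin : 0 < dmin) (hν_var : ∫ e, e ^ 2 ∂ν = 1)
    (hX : ∀ j, Integrable (fun z : Path m => covar 0 z j) μ) (hΘ : IsCompact Θ)
    (hnn : ∀ θ ∈ Θ, (∀ i j, 0 ≤ θ.A i j) ∧ (∀ i j, 0 ≤ θ.B i j))
    (hd : ∀ θ ∈ Θ, ∀ i, dmin ≤ θ.d i)
    (hΓX : ∀ θ ∈ Θ, ∀ᵐ z ∂μ, ∀ i, 0 ≤ θ.Γ.mulVec (covar 0 z) i)
    (hθ₀ : θ₀ ∈ Θ) (hI0 : I0 Θ)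
    (hI1 : I1 μ noise covar ∨ I1' μ noise covar) (hI2 : I2 ν (μ.map (noise 0)))
    (hI3 : I3 Θ θ₀) {l₀ : Fin 2 → ℝ} (hl₀ : ∀ i, 0 ≤ l₀ i) :
    ∀ᵐ z ∂μ,
      (∀ n : ℕ, ∃ θ', IsPMLE Θ l₀ (fun t => observe ν (f (shiftBy t z)) (noise t z))
        (fun t => covar t z) n θ') ∧
      ∀ W ∈ 𝓝 θ₀, ∀ᶠ n : ℕ in atTop, ∀ θ', IsPMLE Θ l₀
        (fun t => observe ν (f (shiftBy t z)) (noise t z)) (fun t => covar t z) n θ' → θ' ∈ W := by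
  obtain ⟨C, r, K, hD⟩ := exists_uniformDecay hΘ hI0
  have hΓ := ae_forall_mulVec_covar_nonneg hS.ergodic.toMeasurePreserving hΓX
  have hloc : ∀ θ₁ ∈ Θ \ {θ₀}, ∃ V : Set (Param m), IsOpen V ∧ θ₁ ∈ V ∧
      ∀ᵐ z ∂μ, ∀ᶠ n in atTop, ∀ θ ∈ Θ, θ ∈ V →
      ∑ t ∈ Finset.Icc 1 n, contrastTerm l₀ (fun t => observe ν (f (shiftBy t z)) (noise t z))
        (fun t => covar t z) t θ₀ <
      ∑ t ∈ Finset.Icc 1 n, contrastTerm l₀ (fun t => observe ν (f (shiftBy t z)) (noise t z))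
        (fun t => covar t z) t θ := fun θ₁ hθ₁ =>
    hS.exists_isOpen_separated hdmin hν_var hX hΘ hnn hd hΓ hD hθ₀ (hI0 θ₀ hθ₀) hl₀ hθ₁.1
      fun h => hθ₁.2 (hS.param_eq hdmin hν_var hX hD hθ₀ (hnn θ₀ hθ₀).2 (hI0 θ₀ hθ₀) hI1 hI2 hI3
        hθ₁.1 h)
  choose! V hVo hV hVsep using hloc
  -- A countable subcover of the non-compact set `Θ \ {θ₀}` is fixed before the path, so that one
  -- null set serves every neighbourhood of `θ₀`.
  obtain ⟨I, hIΘ, hI, hcov⟩ := TopologicalSpace.countable_cover_nhdsWithin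
    (s := Θ \ {θ₀}) (f := V) fun θ hθ => mem_nhdsWithin_of_mem_nhds ((hVo θ hθ).mem_nhds (hV θ hθ))
  filter_upwards [(ae_ball_iff hI).2 fun θ hθ => hVsep θ (hIΘ hθ), hΓ] with z hz hΓz
  refine ⟨fun n => exists_isPMLE hΘ ⟨θ₀, hθ₀⟩ (fun t ht => continuousOn_contrastTerm hdmin
    fun θ hθ i => approxLatent_ge (hnn θ hθ).1 (hnn θ hθ).2 hdmin (hd θ hθ) (hΓz θ hθ) hl₀ ht i) n,
    fun W hW => ?_⟩
  filter_upwards [eventually_separated_of_cover (S := fun n θ => ∑ t ∈ Finset.Icc 1 n,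
      contrastTerm l₀ (fun t => observe ν (f (shiftBy t z)) (noise t z)) (fun t => covar t z) t θ)
      hΘ (fun θ hθ => hVo θ (hIΘ hθ)) hcov hz hW,
    eventually_ge_atTop 1] with n hn hn1 θ' hθ'
  exact hθ'.mem_of_separated hn1 hθ₀ hn

end PathConsistency

end Gain

end

/-! ### Return to the original probability space. -/

theorem mainTheorem7 {Ω : Type*} [MeasurableSpace Ω] (P : Measure Ω) [IsProbabilityMeasure P]
    (m : ℕ)
    -- noise and covariates
    (U : ℤ → Ω → Fin 2 → ℝ) (X : ℤ → Ω → Fin m → ℝ)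
    (hU : ∀ t, Measurable (U t)) (hX : ∀ t, Measurable (X t))
    (hA1 : Gain.NoiseCovariateAssumption P U X)
    (hC : Gain.IsCopula (P.map (U 0)))
    -- the law of the variable `ε`, centered with unit variance
    (ν : Measure ℝ) [IsProbabilityMeasure ν]
    (hν_mean : ∫ e, e ∂ν = 0) (hν_var : ∫ e, e ^ 2 ∂ν = 1)
    -- the parameter space and the true parameter
    (Θ : Set (Gain.Param m)) (hΘ : IsCompact Θ)
    (hΘ_nonneg : ∀ θ ∈ Θ,
      (∀ i j, 0 ≤ θ.Γ i j) ∧ (∀ i j, 0 ≤ θ.A i j) ∧ (∀ i j, 0 ≤ θ.B i j))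
    (dmin : ℝ) (hdmin : 0 < dmin) (hΘ_dmin : ∀ θ ∈ Θ, ∀ i, dmin ≤ θ.d i)
    (hΓX : ∀ θ ∈ Θ, ∀ᵐ ω ∂P, ∀ i, 0 ≤ θ.Γ.mulVec (X 0 ω) i)
    (θ₀ : Gain.Param m) (hθ₀ : θ₀ ∈ Θ)
    -- the stationary solution of the model with parameter `θ₀`
    (Y : ℤ → Ω → ℝ × ℕ) (L : ℤ → Ω → Fin 2 → ℝ)
    (hYL : Gain.IsStationarySolution P ν θ₀ U X Y L)
    -- identifiability, stability and moment conditions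
    (hI0 : Gain.I0 Θ)
    (hI1 : Gain.I1 P U X ∨ Gain.I1' P U X)
    (hI2 : Gain.I2 ν (P.map (U 0)))
    (hI3 : Gain.I3 Θ θ₀)
    (hρ : Gain.specRad (θ₀.A + θ₀.B) < 1)
    (δ : ℝ) (hδ : 0 < δ)
    (hX_mom : Integrable (fun ω => (∑ j, |X 0 ω j|) ^ (1 + δ)) P)
    (hν_mom : Integrable (fun e : ℝ => |e| ^ (2 * (1 + δ))) ν)
    -- initial value of the computable latent process
    (l₀ : Fin 2 → ℝ) (hl₀ : ∀ i, 0 ≤ l₀ i) :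
    (∀ᵐ ω ∂P, ∀ n : ℕ, 1 ≤ n →
      ∃ θ', Gain.IsPMLE Θ l₀ (fun t => Y t ω) (fun t => X t ω) n θ') ∧
    ∀ θhat : ℕ → Ω → Gain.Param m,
      (∀ n : ℕ, 1 ≤ n →
        ∀ᵐ ω ∂P, Gain.IsPMLE Θ l₀ (fun t => Y t ω) (fun t => X t ω) n (θhat n ω)) →
      ∀ᵐ ω ∂P, Tendsto (fun n => θhat n ω) atTop (𝓝 θ₀) := by
  obtain ⟨hΓ₀, hA₀, hB₀⟩ := hΘ_nonneg θ₀ hθ₀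
  have hφ := Gain.measurable_pathOf (m := m) hU hX
  have hμ : IsProbabilityMeasure (P.map (Gain.pathOf U X)) :=
    Measure.isProbabilityMeasure_map hφ.aemeasurable
  obtain ⟨f, hS, hY⟩ := Gain.exists_stationaryModel hU hX hA1 hC hν_var hA₀ hB₀ hdmin
    (hΘ_dmin θ₀ hθ₀) (hΓX θ₀ hθ₀) hYL (hI0 θ₀ hθ₀) hρ
  have hXi : ∀ j, Integrable (fun z : Gain.Path m => Gain.covar 0 z j)
      (P.map (Gain.pathOf U X)) := fun j => by
    refine (integrable_map_measure ((measurable_pi_apply j).comp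
      (Gain.measurable_covar 0)).aestronglyMeasurable hφ.aemeasurable).2 ?_
    -- The first moment follows from `s ≤ 1 + s ^ (1 + δ)` for `s ≥ 0`.
    refine ((integrable_const 1).add hX_mom).mono'
      ((measurable_pi_apply j).comp (hX 0)).aestronglyMeasurable (ae_of_all _ fun ω => ?_)
    have h0 : 0 ≤ ∑ j, |X 0 ω j| := Finset.sum_nonneg fun _ _ => abs_nonneg _
    have h1 : |X 0 ω j| ≤ ∑ j, |X 0 ω j| :=
      Finset.single_le_sum (f := fun j => |X 0 ω j|) (fun _ _ => abs_nonneg _) (Finset.mem_univ j)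
    have h2 := Real.rpow_nonneg h0 (1 + δ)
    refine h1.trans ?_
    rcases le_total (∑ j, |X 0 ω j|) 1 with h | h
    · exact h.trans (le_add_of_nonneg_right h2)
    · exact (Real.self_le_rpow_of_one_le h (by linarith)).trans
        (le_add_of_nonneg_left zero_le_one)
  have hΓμ : ∀ θ ∈ Θ, ∀ᵐ z ∂(P.map (Gain.pathOf U X)),
      ∀ i, 0 ≤ θ.Γ.mulVec (Gain.covar 0 z) i := fun θ hθ => by
    refine (ae_map_iff hφ.aemeasurable ?_).2 (hΓX θ hθ)
    have : Measurable fun z : Gain.Path m => θ.Γ.mulVec (Gain.covar 0 z) :=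
      (Gain.measurable_mulVec_const θ.Γ).comp (Gain.measurable_covar 0)
    simp only [Set.ofPred_forall]
    exact MeasurableSet.iInter fun i =>
      measurableSet_le measurable_const ((measurable_pi_apply i).comp this)
  have hmain := ae_of_ae_map hφ.aemeasurable (hS.ae_consistent hdmin hν_var hXi hΘ
    (fun θ hθ => (hΘ_nonneg θ hθ).2) hΘ_dmin hΓμ hθ₀ hI0
    (hI1.imp (Gain.I1.path hU hX) (Gain.I1'.path hU hX))
    ((Gain.map_noise_pathOf hU hX 0).symm ▸ hI2) hI3 hl₀)
  have hpath : ∀ᵐ ω ∂P, (fun t => Y t ω) =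
      fun t => Gain.observe ν (f (Gain.shiftBy t (Gain.pathOf U X ω)))
        (Gain.noise t (Gain.pathOf U X ω)) := hY.mono fun ω h => funext h
  constructor
  · filter_upwards [hmain, hpath] with ω h1 h2 n _
    rw [h2]
    exact h1.1 n
  · intro θhat hθhat
    -- The minimizing property is assumed for each sample size separately; there are countably many.
    have hθhat' := ae_all_iff.2 fun n => ae_all_iff.2 fun hn : 1 ≤ n => hθhat n hn
    filter_upwards [hmain, hpath, hθhat'] with ω h1 h2 h3
    refine tendsto_def.2 fun W hW => ?_
    filter_upwards [h1.2 W hW, eventually_ge_atTop 1] with n hn hn1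
    have h4 := h3 n hn1
    rw [h2] at h4
    exact hn _ h4
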